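/- For $\lambda\in\{-1,0,1\}$ let $\mathbb{H}^1_\lambda=\{(z_1,z_2)\in\mathbb{C}^2 : |z_1|^2-\lambda|z_2|^2=1\}$, identified with the Lie group of matrices $h=\begin{pmatrix} z_1&\lambda\bar z_2\\ z_2&\bar z_1\end{pmatrix}$. Its real Lie algebra has the basis $$t_0=-\tfrac i2\begin{pmatrix}1&0\\0&-1\end{pmatrix},\quad t_1=-\tfrac i2\begin{pmatrix}0&-\lambda\\1&0\end{pmatrix},\quad t_2=\tfrac12\begin{pmatrix}0&\lambda\\1&0\end{pmatrix},$$ and $t_\pm=t_1\pm i t_2$ in its (abstract) complexification. Let $\pi:\mathbb{H}^1_\lambda\to M_\lambda$, $h\mapsto z_2/z_1$, where $M_\lambda=\{z : 1-\lambda|z|^2>0\}$, with the point $\infty$ added if $\lambda=-1$, is the Riemann sphere, the plane or the unit disc for $\lambda=-1,0,1$. Fix $\lambda_0,\lambda\in\{-1,0,1\}$. On $\mathbb{H}^1_{\lambda_0}$ write $h^{-1}dh=\sum_a\sigma^a s_a$, where $s_a$ are the generators $t_a$ formed with $\lambda_0$, put $\sigma=\sigma^1+i\sigma^2$, let $X_a$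 be the left-invariant vector fields generating $h\mapsto h s_a$, and put $X_-=X_1-iX_2$. On $\mathbb{H}^1_\lambda$ write $\tau^0,\tau$ for the forms corresponding to $\sigma^0,\sigma$. A vortex configuration is a pair of a smooth function $\Phi:\mathbb{H}^1_{\lambda_0}\to\mathbb{C}$ and a smooth real one-form $A$ on $\mathbb{H}^1_{\lambda_0}$ with $$(d\Phi+iA\Phi)\wedge\sigma=0,\qquad dA=\tfrac i2(\lambda_0-\lambda|\Phi|^2)\,\bar\sigma\wedge\sigma .$$ A flat connection is a smooth $\mathrm{Lie}(\mathbb{H}^1_\lambda)$-valued one-form $\mathcal{A}$ on $\mathbb{H}^1_{\lambda_0}$ with $d\mathcal{A}+\mathcal{A}\wedge\mathcal{A}=0$. **Theorem.** 1. Let $\Phi$ be a complex function and $A$ a real one-form on $\mathbb{H}^1_{\lambda_0}$. Then $(\Phi,A)$ is a vortex configuration if and only if $$\mathcal{A}=(A+\sigma^0)t_0+\tfrac12\Phi\sigma t_-+\tfrac12\bar\Phi\bar\sigma t_+ \qquad (*)$$ is a flat connection. 2. Conversely, let $\mathcal{A}$ be a flat connection such that $\mathcal{A}(X_0)=p\,t_0$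 and $\mathcal{A}(X_-)=\alpha t_0+\Phi t_-$ for functions $p:\mathbb{H}^1_{\lambda_0}\to\mathbb{R}$ and $\alpha,\Phi:\mathbb{H}^1_{\lambda_0}\to\mathbb{C}$. Then there is a unique real one-form $A$ such that $(*)$ holds and $(\Phi,A)$ is a vortex configuration. 3. Let $\mathcal{A}$ be a flat connection of the form $(*)$ such that $\int_\gamma\mathcal{A}=4\pi n\,t_0$ for some $n\in\mathbb{Z}$, where $\gamma$ is the closed curve $\varphi\mapsto e^{\varphi s_0}$, $0\le\varphi\le4\pi$, in $\mathbb{H}^1_{\lambda_0}$. Then there is a smooth map $U:\mathbb{H}^1_{\lambda_0}\to\mathbb{H}^1_\lambda$ with $\mathcal{A}=U^{-1}dU$. Every such $U$ is a bundle map covering a holomorphic map $f:M_{\lambda_0}\to M_\lambda$, that is, $\pi\circ U=f\circ\pi$; it has the form $$U=\frac{1}{\sqrt{|F_1|^2-\lambda|F_2|^2}}\begin{pmatrix}F_1&\lambda\bar F_2\\F_2&\bar F_1\end{pmatrix}$$ with smooth functions $F_1,F_2:\mathbb{H}^1_{\lambda_0}\to\mathbb{C}$ satisfying $|F_1|^2>\lambda|F_2|^2$;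 and $\Phi\sigma=U^*\tau$, $A=U^*\tau^0-\sigma^0$. -/

import Mathlib

open scoped Manifold ContDiff Topology ComplexConjugate TensorProduct
open Complex (I)

noncomputable section

namespace Vortex

/-! ## The groups `H¹_lam` -/

/-- The group manifold `H¹_lam = {(z₁, z₂) ∈ ℂ² : |z₁|² - lam |z₂|² = 1}`: `SU(2)` for `lam = -1`,
the (double cover of the) connected Euclidean group of the plane for `lam = 0`, and `SU(1,1)` for
`lam = 1`. -/
def HGroup (lam : ℝ) : Type :=
  {z : ℂ × ℂ // ‖z.1‖ ^ 2 - lam * ‖z.2‖ ^ 2 = 1}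

namespace HGroup

variable {lam : ℝ}

instance : TopologicalSpace (HGroup lam) := instTopologicalSpaceSubtype

/-- The first complex coordinate. -/
def z₁ (h : HGroup lam) : ℂ := h.1.1

/-- The second complex coordinate. -/
def z₂ (h : HGroup lam) : ℂ := h.1.2

theorem norm_rel (h : HGroup lam) : ‖h.z₁‖ ^ 2 - lam * ‖h.z₂‖ ^ 2 = 1 := h.2

theorem rel_re (h : HGroup lam) :
    h.z₁.re ^ 2 + h.z₁.im ^ 2 - lam * (h.z₂.re ^ 2 + h.z₂.im ^ 2) = 1 := by
  have := h.norm_rel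
  simp only [Complex.sq_norm, Complex.normSq_apply] at this
  linarith

theorem ext' {h k : HGroup lam} (e₁ : h.z₁ = k.z₁) (e₂ : h.z₂ = k.z₂) : h = k :=
  Subtype.ext (Prod.ext e₁ e₂)

theorem conj_rel (h : HGroup lam) :
    h.z₁ * conj h.z₁ - lam * (h.z₂ * conj h.z₂) = 1 := by
  have := h.rel_re
  rw [Complex.mul_conj, Complex.mul_conj, Complex.normSq_apply, Complex.normSq_apply]
  norm_cast
  linarith

/-- The point with coordinates `(a, b)`. -/
def mk (a b : ℂ) (h : ‖a‖ ^ 2 - lam * ‖b‖ ^ 2 = 1) : HGroup lam := ⟨(a, b), h⟩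

theorem mul_aux (p q : HGroup lam) :
    ‖p.z₁ * q.z₁ + lam * conj p.z₂ * q.z₂‖ ^ 2
      - lam * ‖p.z₂ * q.z₁ + conj p.z₁ * q.z₂‖ ^ 2 = 1 := by
  have hp := p.rel_re
  have hq := q.rel_re
  simp only [Complex.sq_norm, Complex.normSq_apply, Complex.add_re, Complex.add_im,
    Complex.mul_re, Complex.mul_im, Complex.ofReal_re, Complex.ofReal_im, Complex.conj_re,
    Complex.conj_im]
  linear_combination (q.z₁.re ^ 2 + q.z₁.im ^ 2 - lam * (q.z₂.re ^ 2 + q.z₂.im ^ 2)) * hp + hq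

/-- Multiplication of the matrices `mat`. -/
instance : Mul (HGroup lam) where
  mul p q := mk (p.z₁ * q.z₁ + lam * conj p.z₂ * q.z₂) (p.z₂ * q.z₁ + conj p.z₁ * q.z₂)
    (mul_aux p q)

instance : One (HGroup lam) where
  one := mk 1 0 (by simp)

instance : Inv (HGroup lam) where
  inv p := mk (conj p.z₁) (-p.z₂) (by simpa using p.norm_rel)

@[simp] theorem mul_z₁ (p q : HGroup lam) :
    (p * q).z₁ = p.z₁ * q.z₁ + lam * conj p.z₂ * q.z₂ := rfl
@[simp] theorem mul_z₂ (p q : HGroup lam) :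
    (p * q).z₂ = p.z₂ * q.z₁ + conj p.z₁ * q.z₂ := rfl
@[simp] theorem one_z₁ : (1 : HGroup lam).z₁ = 1 := rfl
@[simp] theorem one_z₂ : (1 : HGroup lam).z₂ = 0 := rfl
@[simp] theorem inv_z₁ (p : HGroup lam) : (p⁻¹).z₁ = conj p.z₁ := rfl
@[simp] theorem inv_z₂ (p : HGroup lam) : (p⁻¹).z₂ = -p.z₂ := rfl

instance : Group (HGroup lam) :=
  Group.ofLeftAxioms
    (fun a b c => ext' (by simp; ring) (by simp; ring))
    (fun a => ext' (by simp) (by simp))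
    (fun a => ext' (by simp only [mul_z₁, inv_z₁, inv_z₂, one_z₁, map_neg]
                       linear_combination a.conj_rel)
      (by simp only [mul_z₂, inv_z₁, inv_z₂, one_z₂, Complex.conj_conj]; ring))

/-- The matrix `!![z₁, lam z̄₂; z₂, z̄₁]` of a group element. -/
def mat (h : HGroup lam) : Matrix (Fin 2) (Fin 2) ℂ :=
  !![h.z₁, lam * conj h.z₂; h.z₂, conj h.z₁]

theorem mat_mul (p q : HGroup lam) : (p * q).mat = p.mat * q.mat := by
  ext i j
  fin_cases i <;> fin_cases j <;> simp [mat, Matrix.mul_apply, Fin.sum_univ_two] <;> ring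

theorem mat_one : (1 : HGroup lam).mat = 1 := by
  ext i j
  fin_cases i <;> fin_cases j <;> simp [mat]

theorem continuous_z₁ : Continuous (z₁ : HGroup lam → ℂ) :=
  continuous_fst.comp continuous_subtype_val
theorem continuous_z₂ : Continuous (z₂ : HGroup lam → ℂ) :=
  continuous_snd.comp continuous_subtype_val

theorem continuous_of_coords {X : Type*} [TopologicalSpace X] {s : Set X} {f : X → HGroup lam}
    (h₁ : ContinuousOn (fun x => (f x).z₁) s) (h₂ : ContinuousOn (fun x => (f x).z₂) s) :
    ContinuousOn f s := by
  have hi : Topology.IsInducing (fun h : HGroup lam => (h.z₁, h.z₂)) := ⟨rfl⟩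
  rw [hi.continuousOn_iff]
  exact h₁.prodMk h₂



/-- The quantity under the square root in the parametrisation below. -/
def disc (lam : ℝ) (x : ℝ × ℂ) : ℝ := 1 + lam * ‖x.2‖ ^ 2 / 4 - x.1 ^ 2 / 4

/-- The local parametrisation of the group near `1` that sends `(x₀, x₁ + i x₂)` to the element
with matrix `√(1 + lam (x₁² + x₂²)/4 - x₀²/4) • 1 + x₀ t₀ + x₁ t₁ + x₂ t₂`. -/
def param (x : ℝ × ℂ) : HGroup lam :=
  if hx : 0 ≤ disc lam x then
    mk ((Real.sqrt (disc lam x) : ℂ) - I / 2 * (x.1 : ℂ)) (-(I / 2) * x.2) (by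
      have h := Real.sq_sqrt hx
      have h2 : disc lam x = 1 + lam * (x.2.re ^ 2 + x.2.im ^ 2) / 4 - x.1 ^ 2 / 4 := by
        simp only [disc, Complex.sq_norm, Complex.normSq_apply]; ring
      simp only [Complex.sq_norm, Complex.normSq_apply]
      simp
      nlinarith)
  else 1

theorem disc_self (h : HGroup lam) :
    disc lam (-2 * h.z₁.im, 2 * I * h.z₂) = h.z₁.re ^ 2 := by
  have := h.norm_rel
  have h2 := h.rel_re
  simp only [disc, norm_mul, Complex.norm_I, Complex.norm_ofNat, mul_pow]
  simp only [Complex.sq_norm, Complex.normSq_apply]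
  linarith

theorem param_z₁ {x : ℝ × ℂ} (hx : 0 ≤ disc lam x) :
    (param x : HGroup lam).z₁ = (Real.sqrt (disc lam x) : ℂ) - I / 2 * (x.1 : ℂ) := by
  simp [param, hx, z₁, mk]

theorem param_z₂ {x : ℝ × ℂ} (hx : 0 ≤ disc lam x) :
    (param x : HGroup lam).z₂ = -(I / 2) * x.2 := by
  simp [param, hx, z₂, mk]

theorem continuous_disc : Continuous (disc lam) := by unfold disc; fun_prop

/-- The chart around `1` inverse to `param`, defined where `Re z₁ > 0`. -/
def chart₁ (lam : ℝ) : OpenPartialHomeomorph (HGroup lam) (ℝ × ℂ) where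
  toFun h := (-2 * h.z₁.im, 2 * I * h.z₂)
  invFun := param
  source := {h | 0 < h.z₁.re}
  target := {x | 0 < disc lam x}
  map_source' h hh := by
    have := disc_self h
    simp only [Set.mem_ofPred_eq] at *
    rw [this]; positivity
  map_target' x hx := by
    simp only [Set.mem_ofPred_eq] at *
    rw [param_z₁ hx.le]
    simpa using hx
  left_inv' h hh := by
    have e := disc_self h
    have hh' : 0 < h.z₁.re := hh
    have hd : 0 ≤ disc lam (-2 * h.z₁.im, 2 * I * h.z₂) := by rw [e]; positivity
    refine ext' ?_ ?_
    · rw [param_z₁ hd, e, Real.sqrt_sq hh'.le]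
      apply Complex.ext <;> simp
    · rw [param_z₂ hd]
      linear_combination (-h.z₂) * Complex.I_sq
  right_inv' x hx := by
    have hx' : 0 ≤ disc lam x := le_of_lt hx
    rw [param_z₁ hx', param_z₂ hx']
    refine Prod.ext ?_ ?_
    · simp
    · linear_combination (-x.2) * Complex.I_sq
  open_source := isOpen_lt continuous_const (Complex.continuous_re.comp continuous_z₁)
  open_target := isOpen_lt continuous_const continuous_disc
  continuousOn_toFun := by
    have := continuous_z₁ (lam := lam)
    have := continuous_z₂ (lam := lam)
    have : Continuous fun h : HGroup lam => (-2 * h.z₁.im, 2 * I * h.z₂) := by fun_prop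
    exact this.continuousOn
  continuousOn_invFun := by
    have hc := continuous_disc (lam := lam)
    refine continuous_of_coords ?_ ?_
    · have : ContinuousOn (fun x : ℝ × ℂ => (Real.sqrt (disc lam x) : ℂ) - I / 2 * (x.1 : ℂ))
        {x | 0 < disc lam x} := by fun_prop
      exact this.congr fun x hx => param_z₁ (le_of_lt hx)
    · have : ContinuousOn (fun x : ℝ × ℂ => -(I / 2) * x.2) {x | 0 < disc lam x} := by fun_prop
      exact this.congr fun x hx => param_z₂ (le_of_lt hx)

/-- Left translation by `p`. -/
def leftMul (p : HGroup lam) : HGroup lam ≃ₜ HGroup lam where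
  toEquiv := Equiv.mulLeft p
  continuous_toFun := by
    have := continuous_z₁ (lam := lam)
    have := continuous_z₂ (lam := lam)
    rw [← continuousOn_univ]
    refine continuous_of_coords (Continuous.continuousOn ?_) (Continuous.continuousOn ?_)
    · simp only [Equiv.toFun_as_coe, Equiv.coe_mulLeft, mul_z₁]; fun_prop
    · simp only [Equiv.toFun_as_coe, Equiv.coe_mulLeft, mul_z₂]; fun_prop
  continuous_invFun := by
    have := continuous_z₁ (lam := lam)
    have := continuous_z₂ (lam := lam)
    rw [← continuousOn_univ]
    refine continuous_of_coords (Continuous.continuousOn ?_) (Continuous.continuousOn ?_)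
    · simp only [Equiv.invFun_as_coe, Equiv.mulLeft_symm_apply, mul_z₁]; fun_prop
    · simp only [Equiv.invFun_as_coe, Equiv.mulLeft_symm_apply, mul_z₂]; fun_prop

/-- The chart around `p`: translate `p` to `1`, then use `chart₁`. -/
def chartOf (p : HGroup lam) : OpenPartialHomeomorph (HGroup lam) (ℝ × ℂ) :=
  (leftMul p⁻¹).toOpenPartialHomeomorph.trans (chart₁ lam)

/-- The smooth structure: `H¹_lam` as a 3-manifold modelled on `ℝ × ℂ`. -/
instance : ChartedSpace (ℝ × ℂ) (HGroup lam) where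
  atlas := Set.range chartOf
  chartAt := chartOf
  mem_chart_source p := by
    simp [chartOf, leftMul, chart₁, -mul_z₁]
  chart_mem_atlas p := ⟨p, rfl⟩

theorem chartOf_apply (p h : HGroup lam) :
    chartOf p h = (-2 * (p⁻¹ * h).z₁.im, 2 * I * (p⁻¹ * h).z₂) := rfl

theorem chartOf_symm_apply (p : HGroup lam) (x : ℝ × ℂ) :
    (chartOf p).symm x = p * param x := by
  simp [chartOf, leftMul, chart₁]

theorem contDiffOn_param_z₁ (n : ℕ∞ω) :
    ContDiffOn ℝ n (fun x => (param x : HGroup lam).z₁) {x | 0 < disc lam x} := by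
  have hd : ContDiff ℝ n (disc lam) := by
    have : ContDiff ℝ n (fun x : ℝ × ℂ => ‖x.2‖ ^ 2) := contDiff_snd.norm_sq ℝ
    unfold disc; fun_prop
  have hs : ContDiffOn ℝ n (fun x => Real.sqrt (disc lam x)) {x | 0 < disc lam x} :=
    hd.contDiffOn.sqrt fun x hx => ne_of_gt hx
  have ho : ContDiff ℝ n (fun r : ℝ => (r : ℂ)) := Complex.ofRealCLM.contDiff
  have : ContDiffOn ℝ n (fun x : ℝ × ℂ => (Real.sqrt (disc lam x) : ℂ) - I / 2 * (x.1 : ℂ))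
      {x | 0 < disc lam x} :=
    (ho.comp_contDiffOn hs).sub (contDiffOn_const.mul (ho.comp contDiff_fst).contDiffOn)
  exact this.congr fun x hx => param_z₁ (le_of_lt hx)

theorem contDiffOn_param_z₂ (n : ℕ∞ω) :
    ContDiffOn ℝ n (fun x => (param x : HGroup lam).z₂) {x | 0 < disc lam x} := by
  have : ContDiffOn ℝ n (fun x : ℝ × ℂ => -(I / 2) * x.2) {x | 0 < disc lam x} := by fun_prop
  exact this.congr fun x hx => param_z₂ (le_of_lt hx)

instance (n : ℕ∞ω) : IsManifold 𝓘(ℝ, ℝ × ℂ) n (HGroup lam) := by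
  apply isManifold_of_contDiffOn
  rintro _ _ ⟨p, rfl⟩ ⟨q, rfl⟩
  have h1 := contDiffOn_param_z₁ (lam := lam) n
  have h2 := contDiffOn_param_z₂ (lam := lam) n
  have hi : ContDiff ℝ n Complex.im := Complex.imCLM.contDiff
  have : ContDiffOn ℝ n (fun x : ℝ × ℂ =>
      (-2 * ((q⁻¹ * p) * param x).z₁.im, 2 * I * ((q⁻¹ * p) * param x).z₂))
      {x | 0 < disc lam x} := by
    simp only [mul_z₁ (q⁻¹ * p), mul_z₂ (q⁻¹ * p)]
    refine ContDiffOn.prodMk (contDiffOn_const.mul (hi.comp_contDiffOn ?_)) ?_ <;> fun_prop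
  refine (this.congr fun x _ => ?_).mono ?_
  · simp [chartOf_apply, chartOf_symm_apply, mul_assoc, -mul_z₁, -mul_z₂]
  · intro x hx
    simp [chartOf, chart₁] at hx
    exact hx.1


theorem param_zero : (param 0 : HGroup lam) = 1 := by
  have : (0:ℝ) ≤ disc lam 0 := by simp [disc]
  refine ext' ?_ ?_
  · rw [param_z₁ this]; simp [disc]
  · rw [param_z₂ this]; simp

theorem chartOf_self (p : HGroup lam) : chartOf p p = 0 := by
  rw [chartOf_apply, inv_mul_cancel]; simp

theorem hasFDerivAt_disc : HasFDerivAt (disc lam) (0 : ℝ × ℂ →L[ℝ] ℝ) 0 := by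
  have h1 : HasFDerivAt (fun x : ℝ × ℂ => ‖x.2‖ ^ 2) (0 : ℝ × ℂ →L[ℝ] ℝ) 0 := by
    have := (hasFDerivAt_snd (𝕜 := ℝ) (E := ℝ) (F := ℂ) (p := 0)).norm_sq
    refine this.congr_fderiv ?_
    ext <;> simp
  have h2 : HasFDerivAt (fun x : ℝ × ℂ => x.1 ^ 2) (0 : ℝ × ℂ →L[ℝ] ℝ) 0 := by
    have := (hasFDerivAt_fst (𝕜 := ℝ) (E := ℝ) (F := ℂ) (p := 0)).pow 2
    refine this.congr_fderiv ?_
    ext <;> simp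
  have := ((((h1.const_mul lam).mul_const (1/4)).const_add 1)).sub (h2.mul_const (1/4))
  refine (this.congr_of_eventuallyEq ?_).congr_fderiv ?_
  · exact Filter.Eventually.of_forall fun x => by simp [disc, div_eq_mul_inv]
  · simp

theorem eventually_disc_pos : ∀ᶠ x in 𝓝 (0 : ℝ × ℂ), 0 ≤ disc lam x := by
  have : (0:ℝ) < disc lam 0 := by simp [disc]
  exact (continuous_disc.continuousAt.eventually_const_lt this).mono fun _ h => le_of_lt h

/-- The derivative of `z₁ ∘ param` at `0`. -/
def e₁ : ℝ × ℂ →L[ℝ] ℂ := (-(I / 2)) • (Complex.ofRealCLM.comp (ContinuousLinearMap.fst ℝ ℝ ℂ))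
/-- The derivative of `z₂ ∘ param` at `0`. -/
def e₂ : ℝ × ℂ →L[ℝ] ℂ := (-(I / 2)) • (ContinuousLinearMap.snd ℝ ℝ ℂ)

theorem hasFDerivAt_param_z₁ :
    HasFDerivAt (fun x => (param x : HGroup lam).z₁) e₁ 0 := by
  have hd0 : disc lam 0 = 1 := by simp [disc]
  have hs : HasFDerivAt (fun x => Real.sqrt (disc lam x)) (0 : ℝ × ℂ →L[ℝ] ℝ) 0 := by
    have := (hasFDerivAt_disc (lam := lam)).sqrt (by rw [hd0]; norm_num)
    simpa using this
  have hs' := Complex.ofRealCLM.hasFDerivAt.comp (0 : ℝ × ℂ) hs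
  have hf := (Complex.ofRealCLM.hasFDerivAt.comp (0 : ℝ × ℂ)
    (hasFDerivAt_fst (𝕜 := ℝ) (E := ℝ) (F := ℂ) (p := 0))).const_mul (I / 2)
  refine ((hs'.sub hf).congr_of_eventuallyEq ?_).congr_fderiv ?_
  · filter_upwards [eventually_disc_pos (lam := lam)] with x hx
    rw [param_z₁ hx]; simp
  · ext <;> simp [e₁]

theorem hasFDerivAt_param_z₂ :
    HasFDerivAt (fun x => (param x : HGroup lam).z₂) e₂ 0 := by
  have hf := (hasFDerivAt_snd (𝕜 := ℝ) (E := ℝ) (F := ℂ) (p := 0)).const_mul (-(I / 2))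
  refine (hf.congr_of_eventuallyEq ?_).congr_fderiv ?_
  · filter_upwards [eventually_disc_pos (lam := lam)] with x hx
    rw [param_z₂ hx]
  · ext <;> simp [e₂]

theorem hasMFDerivAt_z₁ (p : HGroup lam) :
    HasMFDerivAt 𝓘(ℝ, ℝ × ℂ) 𝓘(ℝ, ℂ) z₁ p (p.z₁ • e₁ + (lam * conj p.z₂) • e₂) := by
  refine ⟨continuous_z₁.continuousAt, ?_⟩
  have h : HasFDerivAt (fun x => (p * param x : HGroup lam).z₁)
      (p.z₁ • e₁ + (lam * conj p.z₂) • e₂) 0 :=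
    (hasFDerivAt_param_z₁.const_mul p.z₁).add (hasFDerivAt_param_z₂.const_mul _)
  have e : writtenInExtChartAt 𝓘(ℝ, ℝ × ℂ) 𝓘(ℝ, ℂ) p z₁
      = fun x => (p * param x : HGroup lam).z₁ := by
    ext x
    simp only [writtenInExtChartAt, extChartAt, mfld_simps]
    exact congrArg z₁ (chartOf_symm_apply p x)
  have e0 : extChartAt 𝓘(ℝ, ℝ × ℂ) p p = 0 := by
    simp only [extChartAt, mfld_simps]
    exact chartOf_self p
  rw [e, e0]
  exact h.hasFDerivWithinAt

theorem hasMFDerivAt_z₂ (p : HGroup lam) :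
    HasMFDerivAt 𝓘(ℝ, ℝ × ℂ) 𝓘(ℝ, ℂ) z₂ p (p.z₂ • e₁ + (conj p.z₁) • e₂) := by
  refine ⟨continuous_z₂.continuousAt, ?_⟩
  have h : HasFDerivAt (fun x => (p * param x : HGroup lam).z₂)
      (p.z₂ • e₁ + (conj p.z₁) • e₂) 0 :=
    (hasFDerivAt_param_z₁.const_mul p.z₂).add (hasFDerivAt_param_z₂.const_mul _)
  have e : writtenInExtChartAt 𝓘(ℝ, ℝ × ℂ) 𝓘(ℝ, ℂ) p z₂
      = fun x => (p * param x : HGroup lam).z₂ := by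
    ext x
    simp only [writtenInExtChartAt, extChartAt, mfld_simps]
    exact congrArg z₂ (chartOf_symm_apply p x)
  have e0 : extChartAt 𝓘(ℝ, ℝ × ℂ) p p = 0 := by
    simp only [extChartAt, mfld_simps]
    exact chartOf_self p
  rw [e, e0]
  exact h.hasFDerivWithinAt

end HGroup

/-! ## The Lie algebra -/

/-- The generators `t₀, t₁, t₂` of `Lie(H¹_lam)`, as matrices. -/
def gen (lam : ℝ) : Fin 3 → Matrix (Fin 2) (Fin 2) ℂ
  | 0 => (-(I / 2)) • !![1, 0; 0, -1]
  | 1 => (-(I / 2)) • !![0, -(lam : ℂ); 1, 0]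
  | 2 => (1 / 2 : ℂ) • !![0, (lam : ℂ); 1, 0]

theorem gen_comm (lam : ℝ) :
    gen lam 0 * gen lam 1 - gen lam 1 * gen lam 0 = gen lam 2 ∧
    gen lam 0 * gen lam 2 - gen lam 2 * gen lam 0 = - gen lam 1 ∧
    gen lam 1 * gen lam 2 - gen lam 2 * gen lam 1 = (-lam) • gen lam 0 := by
  have hI : I * I = -1 := Complex.I_mul_I
  refine ⟨?_, ?_, ?_⟩ <;> ext i j <;> fin_cases i <;> fin_cases j <;>
    simp [gen] <;> ring_nf <;> simp <;> ring

/-- The real Lie algebra `Lie(H¹_lam)`: the real span of the generators. -/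
def lieH (lam : ℝ) : Submodule ℝ (Matrix (Fin 2) (Fin 2) ℂ) :=
  Submodule.span ℝ (Set.range (gen lam))

/-- The generators as elements of the Lie algebra. -/
def lieGen (lam : ℝ) (a : Fin 3) : lieH lam :=
  ⟨gen lam a, Submodule.subset_span ⟨a, rfl⟩⟩

/-- The complexified Lie algebra (for `lam = 0` the abstract complexification is not a space of
`2 × 2` matrices, since `t₁ + i t₂` is the zero matrix). -/
abbrev LieHC (lam : ℝ) : Type := ℂ ⊗[ℝ] lieH lam

/-- `t₀` in the complexified Lie algebra. -/
def tZero (lam : ℝ) : LieHC lam := (1 : ℂ) ⊗ₜ[ℝ] lieGen lam 0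

/-- `t₊ = t₁ + i t₂` in the complexified Lie algebra. -/
def tPlus (lam : ℝ) : LieHC lam := (1 : ℂ) ⊗ₜ[ℝ] lieGen lam 1 + I ⊗ₜ[ℝ] lieGen lam 2

/-- `t₋ = t₁ - i t₂` in the complexified Lie algebra. -/
def tMinus (lam : ℝ) : LieHC lam := (1 : ℂ) ⊗ₜ[ℝ] lieGen lam 1 - I ⊗ₜ[ℝ] lieGen lam 2

/-! ## Differential forms on `H¹_lam` -/

/-- The tangent space of `H¹_lam` at `p`. -/
abbrev TH {lam : ℝ} (p : HGroup lam) : Type := TangentSpace 𝓘(ℝ, ℝ × ℂ) p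

/-- (Not necessarily smooth) one-forms on `H¹_lam` with values in `V`. -/
abbrev OneForm (lam : ℝ) (V : Type) [TopologicalSpace V] [AddCommGroup V] [Module ℝ V] : Type :=
  (p : HGroup lam) → TH p →L[ℝ] V

/-- The differential of a complex function. -/
def dFun {lam : ℝ} (g : HGroup lam → ℂ) : OneForm lam ℂ :=
  fun p => mfderiv 𝓘(ℝ, ℝ × ℂ) 𝓘(ℝ, ℂ) g p

section ExteriorDerivative

variable {lam : ℝ} {V : Type} [NormedAddCommGroup V] [NormedSpace ℝ V]

/-- The coordinate expression of a one-form in the chart around `p`. -/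
def chartForm (θ : OneForm lam V) (p : HGroup lam) (x : ℝ × ℂ) : ℝ × ℂ →L[ℝ] V :=
  (θ ((chartAt (ℝ × ℂ) p).symm x)).comp
    (mfderiv 𝓘(ℝ, ℝ × ℂ) 𝓘(ℝ, ℝ × ℂ) (chartAt (ℝ × ℂ) p).symm x)

/-- The exterior derivative of a one-form, `dθ(u, v) = (∂_u θ)(v) - (∂_v θ)(u)` in the chart around
`p`, through which the tangent space at `p` is identified with `ℝ × ℂ`. -/
def extD (θ : OneForm lam V) (p : HGroup lam) (u v : TH p) : V :=
  fderiv ℝ (chartForm θ p) (chartAt (ℝ × ℂ) p p) u v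
    - fderiv ℝ (chartForm θ p) (chartAt (ℝ × ℂ) p p) v u

end ExteriorDerivative

/-- The wedge product of two complex one-forms. -/
def wedge {lam : ℝ} (θ η : OneForm lam ℂ) (p : HGroup lam) (u v : TH p) : ℂ :=
  θ p u * η p v - θ p v * η p u

/-! ## The left-invariant frame and coframe -/

/-- The matrix-valued one-form `U⁻¹ dU` of a map `U : H¹_lam₀ → H¹_lam`, entry by entry. -/
def invMulD {lam₀ lam : ℝ} (U : HGroup lam₀ → HGroup lam) (i j : Fin 2) : OneForm lam₀ ℂ :=
  fun p => ∑ k, (U p)⁻¹.mat i k • dFun (fun q => (U q).mat k j) p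

/-- The component `σ⁰` of the Maurer-Cartan form `h⁻¹ dh = σ⁰ t₀ + σ¹ t₁ + σ² t₂`. -/
def sigma₀ {lam : ℝ} : OneForm lam ℝ :=
  fun p => Complex.reCLM.comp ((2 * I) • invMulD id 0 0 p)

/-- The combination `σ = σ¹ + i σ²` of components of the Maurer-Cartan form. -/
def sigma {lam : ℝ} : OneForm lam ℂ := fun p => (2 * I) • invMulD id 1 0 p

/-- `σ̄`. -/
def sigmaBar {lam : ℝ} : OneForm lam ℂ :=
  fun p => (Complex.conjCLE : ℂ →L[ℝ] ℂ).comp (sigma p)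

/-- The left-invariant vector fields `X₀, X₁, X₂` that generate the right action `h ↦ h t_a`
(see `dMat_X`); in the chart around `p` they are at `p` the coordinate directions. -/
def X {lam : ℝ} (a : Fin 3) (p : HGroup lam) : TH p :=
  (![(1, 0), (0, 1), (0, I)] : Fin 3 → ℝ × ℂ) a

/-- The complex tangent vector `X₋ = X₁ - i X₂`. -/
def XMinus {lam : ℝ} (p : HGroup lam) : ℂ ⊗[ℝ] TH p :=
  (1 : ℂ) ⊗ₜ[ℝ] X 1 p - I ⊗ₜ[ℝ] X 2 p

theorem hasMFDerivAt_conj {lam : ℝ} {g : HGroup lam → ℂ} {p : HGroup lam} {L : ℝ × ℂ →L[ℝ] ℂ}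
    (h : HasMFDerivAt 𝓘(ℝ, ℝ × ℂ) 𝓘(ℝ, ℂ) g p L) :
    HasMFDerivAt 𝓘(ℝ, ℝ × ℂ) 𝓘(ℝ, ℂ) (fun q => conj (g q)) p
      ((Complex.conjCLE : ℂ →L[ℝ] ℂ).comp L) :=
  HasMFDerivAt.comp p (Complex.conjCLE : ℂ →L[ℝ] ℂ).hasMFDerivAt h

theorem hasMFDerivAt_const_mul {lam : ℝ} {g : HGroup lam → ℂ} {p : HGroup lam}
    {L : ℝ × ℂ →L[ℝ] ℂ} (c : ℂ) (h : HasMFDerivAt 𝓘(ℝ, ℝ × ℂ) 𝓘(ℝ, ℂ) g p L) :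
    HasMFDerivAt 𝓘(ℝ, ℝ × ℂ) 𝓘(ℝ, ℂ) (fun q => c * (g q)) p (c • L) := by
  have hc : HasMFDerivAt 𝓘(ℝ, ℂ) 𝓘(ℝ, ℂ) (fun w : ℂ => c * w) (g p)
      (c • ContinuousLinearMap.id ℝ ℂ) :=
    ((hasFDerivAt_id (𝕜 := ℝ) (g p)).const_mul c).hasMFDerivAt
  exact HasMFDerivAt.comp p hc h

/-- The differential of the matrix of `h` in coordinates. -/
theorem dMat_apply {lam : ℝ} (p : HGroup lam) (x : ℝ) (w : ℂ) (i j : Fin 2) :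
    dFun (fun q : HGroup lam => q.mat i j) p (x, w)
      = (p.mat * (x • gen lam 0 + w.re • gen lam 1 + w.im • gen lam 2)) i j := by
  have h1 := HGroup.hasMFDerivAt_z₁ p
  have h2 := HGroup.hasMFDerivAt_z₂ p
  have e1 : dFun (fun q : HGroup lam => q.mat 0 0) p (x, w)
      = p.z₁ * (-(I / 2) * x) + lam * conj p.z₂ * (-(I / 2) * w) :=
    DFunLike.congr_fun (show dFun (fun q : HGroup lam => q.mat 0 0) p = _ from h1.mfderiv) _
  have e2 : dFun (fun q : HGroup lam => q.mat 1 0) p (x, w)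
      = p.z₂ * (-(I / 2) * x) + conj p.z₁ * (-(I / 2) * w) :=
    DFunLike.congr_fun (show dFun (fun q : HGroup lam => q.mat 1 0) p = _ from h2.mfderiv) _
  have e3 : dFun (fun q : HGroup lam => q.mat 1 1) p (x, w)
      = conj (p.z₁ * (-(I / 2) * x) + lam * conj p.z₂ * (-(I / 2) * w)) :=
    DFunLike.congr_fun
      (show dFun (fun q : HGroup lam => q.mat 1 1) p = _ from (hasMFDerivAt_conj h1).mfderiv) _
  have e4 : dFun (fun q : HGroup lam => q.mat 0 1) p (x, w)
      = lam * conj (p.z₂ * (-(I / 2) * x) + conj p.z₁ * (-(I / 2) * w)) :=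
    DFunLike.congr_fun
      (show dFun (fun q : HGroup lam => q.mat 0 1) p = _ from
        (hasMFDerivAt_const_mul (lam : ℂ) (hasMFDerivAt_conj h2)).mfderiv) _
  have hw : w = w.re + w.im * I := (Complex.re_add_im w).symm
  have hw' : conj w = w.re - w.im * I := by
    apply Complex.ext <;> simp
  have c2 : conj (2 : ℂ) = 2 := map_ofNat (starRingEnd ℂ) 2
  fin_cases i <;> fin_cases j
  · refine e1.trans ?_
    simp [Matrix.mul_apply, HGroup.mat, gen]
    linear_combination (lam * conj p.z₂ * (-(I / 2))) * hw
      + (lam * conj p.z₂ * (-(1 / 2)) * w.im) * Complex.I_sq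
  · refine e4.trans ?_
    simp [Matrix.mul_apply, HGroup.mat, gen, c2]
    rw [hw']; ring_nf; simp; ring
  · refine e2.trans ?_
    simp [Matrix.mul_apply, HGroup.mat, gen]
    linear_combination (conj p.z₁ * (-(I / 2))) * hw
      + (conj p.z₁ * (-(1 / 2)) * w.im) * Complex.I_sq
  · refine e3.trans ?_
    simp [Matrix.mul_apply, HGroup.mat, gen, c2]
    rw [hw']; ring_nf; simp; ring

/-- The vector field `X_a` generates the right action `h ↦ h t_a`. -/
theorem dMat_X {lam : ℝ} (p : HGroup lam) (a : Fin 3) (i j : Fin 2) :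
    dFun (fun q : HGroup lam => q.mat i j) p (X a p) = (p.mat * gen lam a) i j := by
  fin_cases a
  · exact (dMat_apply p 1 0 i j).trans (by simp)
  · exact (dMat_apply p 0 1 i j).trans (by simp)
  · exact (dMat_apply p 0 I i j).trans (by simp)

theorem maurerCartan_coords {lam : ℝ} (p : HGroup lam) (x : ℝ) (w : ℂ) (i j : Fin 2) :
    invMulD id i j p (x, w) = (x • gen lam 0 + w.re • gen lam 1 + w.im • gen lam 2) i j := by
  have h : invMulD id i j p (x, w)
      = ∑ k, p⁻¹.mat i k * dFun (fun q : HGroup lam => q.mat k j) p (x, w) := by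
    simp [invMulD]; rfl
  rw [h]
  simp only [dMat_apply]
  rw [← Matrix.mul_apply, ← Matrix.mul_assoc, ← HGroup.mat_mul, inv_mul_cancel, HGroup.mat_one,
    Matrix.one_mul]

theorem sigma₀_coords {lam : ℝ} (p : HGroup lam) (x : ℝ) (w : ℂ) : sigma₀ p (x, w) = x := by
  have h : sigma₀ p (x, w) = (2 * I * invMulD id 0 0 p (x, w)).re := rfl
  rw [h, maurerCartan_coords]
  simp [gen]
  ring

theorem sigma_coords {lam : ℝ} (p : HGroup lam) (x : ℝ) (w : ℂ) : sigma p (x, w) = w := by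
  have h : sigma p (x, w) = 2 * I * invMulD id 1 0 p (x, w) := rfl
  rw [h, maurerCartan_coords]
  apply Complex.ext <;> simp [gen] <;> ring

/-- `h⁻¹ dh = σ⁰ t₀ + σ¹ t₁ + σ² t₂`. -/
theorem maurerCartan_eq {lam : ℝ} (p : HGroup lam) (v : TH p) (i j : Fin 2) :
    invMulD id i j p v
      = (sigma₀ p v • gen lam 0 + (sigma p v).re • gen lam 1 + (sigma p v).im • gen lam 2) i j := by
  obtain ⟨x, w⟩ : ℝ × ℂ := v
  exact (maurerCartan_coords p x w i j).trans (by rw [sigma₀_coords, sigma_coords])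

/-- A one-form is smooth if its components in the frame `X₀, X₁, X₂` are smooth. -/
def IsSmoothForm {lam : ℝ} {V : Type} [NormedAddCommGroup V] [NormedSpace ℝ V]
    (θ : OneForm lam V) : Prop :=
  ∀ a, ContMDiff 𝓘(ℝ, ℝ × ℂ) 𝓘(ℝ, V) ∞ fun p => θ p (X a p)

/-! ## Vortex configurations -/

/-- The pair `(Φ, A)` is smooth and satisfies the vortex equations `(dΦ + iAΦ) ∧ σ = 0` and
`dA = (i/2) (lam₀ - lam |Φ|²) σ̄ ∧ σ` on `H¹_lam₀`. -/
structure IsVortexConfiguration (lam₀ lam : ℝ) (Φ : HGroup lam₀ → ℂ) (A : OneForm lam₀ ℝ) :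
    Prop where
  smooth_Φ : ContMDiff 𝓘(ℝ, ℝ × ℂ) 𝓘(ℝ, ℂ) ∞ Φ
  smooth_A : IsSmoothForm A
  higgs : ∀ p u v,
    wedge (fun q => dFun Φ q + (I * Φ q) • Complex.ofRealCLM.comp (A q)) sigma p u v = 0
  curvature : ∀ p u v,
    ((extD A p u v : ℝ) : ℂ) = I / 2 * (lam₀ - lam * ‖Φ p‖ ^ 2 : ℝ) * wedge sigmaBar sigma p u v

/-! ## Flat connections -/

/-- Gauge potentials on `H¹_lam₀` with values in `Lie(H¹_lam)`. -/
abbrev Connection (lam₀ lam : ℝ) : Type := OneForm lam₀ (lieH lam)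

/-- A matrix entry as a functional on the Lie algebra. -/
def entryCLM (lam : ℝ) (i j : Fin 2) : lieH lam →L[ℝ] ℂ where
  toFun B := (B : Matrix (Fin 2) (Fin 2) ℂ) i j
  map_add' _ _ := rfl
  map_smul' _ _ := rfl
  cont := (continuous_apply_apply i j).comp continuous_subtype_val

/-- The matrix entries of a `Lie(H¹_lam)`-valued one-form. -/
def entry {lam₀ lam : ℝ} (𝒜 : Connection lam₀ lam) (i j : Fin 2) : OneForm lam₀ ℂ :=
  fun p => (entryCLM lam i j).comp (𝒜 p)

/-- Smooth and flat: `d𝒜 + 𝒜 ∧ 𝒜 = 0`, that is `d𝒜(u, v) + [𝒜(u), 𝒜(v)] = 0`. -/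
structure IsFlatConnection {lam₀ lam : ℝ} (𝒜 : Connection lam₀ lam) : Prop where
  smooth : ∀ i j, IsSmoothForm (entry 𝒜 i j)
  flat : ∀ p u v,
    (Matrix.of fun i j => extD (entry 𝒜 i j) p u v)
      + ((𝒜 p u).1 * (𝒜 p v).1 - (𝒜 p v).1 * (𝒜 p u).1) = 0

/-- The gauge potential `(A + σ⁰) t₀ + ½ Φ σ t₋ + ½ Φ̄ σ̄ t₊`, written as the real combination
`(A + σ⁰) t₀ + Re(Φ σ) t₁ + Im(Φ σ) t₂` of the generators (see `vortexPotential_eq`). -/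
def vortexPotential {lam₀ : ℝ} (lam : ℝ) (Φ : HGroup lam₀ → ℂ) (A : OneForm lam₀ ℝ) :
    Connection lam₀ lam := fun p =>
  (A p + sigma₀ p).smulRight (lieGen lam 0)
    + (Complex.reCLM.comp (Φ p • sigma p)).smulRight (lieGen lam 1)
    + (Complex.imCLM.comp (Φ p • sigma p)).smulRight (lieGen lam 2)

theorem vortexPotential_eq {lam₀ lam : ℝ} (Φ : HGroup lam₀ → ℂ) (A : OneForm lam₀ ℝ)
    (p : HGroup lam₀) (v : TH p) :
    (1 : ℂ) ⊗ₜ[ℝ] vortexPotential lam Φ A p v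
      = ((A p v + sigma₀ p v : ℝ) : ℂ) • tZero lam
        + (1 / 2 * Φ p * sigma p v) • tMinus lam
        + (1 / 2 * conj (Φ p) * sigmaBar p v) • tPlus lam := by
  have hb : sigmaBar p v = conj (sigma p v) := rfl
  have h : vortexPotential lam Φ A p v = (A p v + sigma₀ p v) • lieGen lam 0
      + (Φ p * sigma p v).re • lieGen lam 1 + (Φ p * sigma p v).im • lieGen lam 2 := rfl
  have hc : 1 / 2 * conj (Φ p) * conj (sigma p v) = 1 / 2 * conj (Φ p * sigma p v) := by
    rw [map_mul]; ring
  have ho : 1 / 2 * Φ p * sigma p v = 1 / 2 * (Φ p * sigma p v) := by ring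
  rw [h, hb, hc, ho]
  generalize Φ p * sigma p v = w
  have s (r : ℝ) (B : lieH lam) : (1 : ℂ) ⊗ₜ[ℝ] (r • B) = (r : ℂ) ⊗ₜ[ℝ] B := by
    rw [← TensorProduct.smul_tmul]; simp
  have k1 : 1 / 2 * w + 1 / 2 * conj w = (w.re : ℂ) := by
    refine Complex.ext (by simp; ring) (by simp; try ring)
  have k2 : -(1 / 2 * w * I) + 1 / 2 * conj w * I = (w.im : ℂ) := by
    refine Complex.ext (by simp; ring) (by simp; try ring)
  simp only [tZero, tMinus, tPlus, TensorProduct.tmul_add, s, smul_add, smul_sub,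
    TensorProduct.smul_tmul', smul_eq_mul, mul_one]
  rw [← k1, ← k2]
  simp only [TensorProduct.add_tmul, TensorProduct.neg_tmul]
  abel

/-- The complex-linear extension of the value of `𝒜` at a point to complex tangent vectors. -/
def complexify {lam₀ lam : ℝ} {p : HGroup lam₀} (φ : TH p →L[ℝ] lieH lam) :
    ℂ ⊗[ℝ] TH p →ₗ[ℂ] LieHC lam :=
  LinearMap.baseChange ℂ (φ : TH p →ₗ[ℝ] lieH lam)

/-- The closed curve `γ(φ) = exp(φ t₀)`, `0 ≤ φ ≤ 4π`, in `H¹_lam`. -/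
def gammaCurve (lam : ℝ) (φ : ℝ) : HGroup lam :=
  HGroup.mk (Complex.exp (-(I / 2) * φ)) 0 (by simp [Complex.norm_exp])

theorem gammaCurve_mat (lam φ : ℝ) :
    (gammaCurve lam φ).mat = NormedSpace.exp (φ • gen lam 0) := by
  have h : φ • gen lam 0 = Matrix.diagonal ![-(I / 2) * φ, I / 2 * φ] := by
    ext i j
    fin_cases i <;> fin_cases j <;> simp [gen] <;> ring
  rw [h, Matrix.exp_diagonal]
  have c2 : conj (2 : ℂ) = 2 := map_ofNat (starRingEnd ℂ) 2
  ext i j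
  fin_cases i <;> fin_cases j <;>
    simp [c2, neg_div, gammaCurve, HGroup.mat, HGroup.mk, HGroup.z₁, HGroup.z₂, Pi.coe_exp,
      ← Complex.exp_eq_exp_ℂ, ← Complex.exp_conj]

/-- The integral of a `Lie(H¹_lam)`-valued one-form along `γ`, as a matrix. -/
def integralGamma {lam₀ lam : ℝ} (𝒜 : Connection lam₀ lam) : Matrix (Fin 2) (Fin 2) ℂ :=
  Matrix.of fun i j => ∫ φ in (0 : ℝ)..(4 * Real.pi),
    entry 𝒜 i j (gammaCurve lam₀ φ)
      (mfderiv 𝓘(ℝ, ℝ) 𝓘(ℝ, ℝ × ℂ) (gammaCurve lam₀) φ (1 : ℝ))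

/-- `𝒜 = U⁻¹ dU`. -/
def Trivialises {lam₀ lam : ℝ} (U : HGroup lam₀ → HGroup lam) (𝒜 : Connection lam₀ lam) : Prop :=
  ∀ p v i j, entry 𝒜 i j p v = invMulD U i j p v

/-- The pullback of a one-form by a map between the groups. -/
def pullback {lam₀ lam : ℝ} {V : Type} [TopologicalSpace V] [AddCommGroup V] [Module ℝ V]
    (U : HGroup lam₀ → HGroup lam) (θ : OneForm lam V) : OneForm lam₀ V :=
  fun p => (θ (U p)).comp (mfderiv 𝓘(ℝ, ℝ × ℂ) 𝓘(ℝ, ℝ × ℂ) U p)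

/-! ## The Riemann sphere and the surfaces `M_lam` -/

/-- Inversion `z ↦ 1/z` of the Riemann sphere. -/
def sphereInv : OnePoint ℂ → OnePoint ℂ
  | none => ((0 : ℂ) : OnePoint ℂ)
  | some z => if z = 0 then OnePoint.infty else ((z⁻¹ : ℂ) : OnePoint ℂ)

theorem sphereInv_infty : sphereInv OnePoint.infty = ((0 : ℂ) : OnePoint ℂ) := rfl

theorem sphereInv_coe (z : ℂ) : sphereInv (z : OnePoint ℂ)
    = if z = 0 then OnePoint.infty else ((z⁻¹ : ℂ) : OnePoint ℂ) := rfl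

theorem sphereInv_sphereInv (x : OnePoint ℂ) : sphereInv (sphereInv x) = x := by
  induction x using OnePoint.rec with
  | infty => simp [sphereInv_infty, sphereInv_coe]
  | coe z =>
    by_cases hz : z = 0
    · simp [sphereInv_infty, sphereInv_coe, hz]
    · simp [sphereInv_coe, hz]

theorem continuous_sphereInv : Continuous sphereInv := by
  have hinf : Filter.Tendsto (fun z : ℂ => ((z⁻¹ : ℂ) : OnePoint ℂ)) (𝓝[≠] 0)
      (𝓝 OnePoint.infty) := by
    have h1 : Filter.Tendsto (fun z : ℂ => z⁻¹) (𝓝[≠] 0) (Bornology.cobounded ℂ) :=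
      Filter.tendsto_inv₀_nhdsNE_zero
    rw [Metric.cobounded_eq_cocompact, ← Filter.coclosedCompact_eq_cocompact] at h1
    exact OnePoint.tendsto_coe_infty.comp h1
  rw [continuous_iff_continuousAt]
  intro x
  induction x using OnePoint.rec with
  | infty =>
    rw [OnePoint.continuousAt_infty', sphereInv_infty, Filter.coclosedCompact_eq_cocompact,
      ← Metric.cobounded_eq_cocompact]
    have h1 : Filter.Tendsto (fun z : ℂ => ((z⁻¹ : ℂ) : OnePoint ℂ)) (Bornology.cobounded ℂ)
        (𝓝 ((0 : ℂ) : OnePoint ℂ)) :=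
      (OnePoint.continuous_coe.tendsto _).comp Filter.tendsto_inv₀_cobounded
    refine h1.congr' ?_
    filter_upwards [Bornology.eventually_ne_cobounded (0 : ℂ)] with z hz
    simp [sphereInv_coe, hz]
  | coe z =>
    rw [OnePoint.continuousAt_coe]
    by_cases hz : z = 0
    · subst hz
      rw [continuousAt_iff_punctured_nhds]
      have e : (sphereInv ∘ ((↑) : ℂ → OnePoint ℂ)) 0 = OnePoint.infty := by
        simp [sphereInv_coe]
      rw [e]
      refine hinf.congr' ?_
      filter_upwards [self_mem_nhdsWithin] with z hz
      have hz' : z ≠ 0 := hz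
      simp [sphereInv_coe, hz']
    · have h1 : ContinuousAt (fun z : ℂ => ((z⁻¹ : ℂ) : OnePoint ℂ)) z :=
        OnePoint.continuous_coe.continuousAt.comp (continuousAt_inv₀ hz)
      refine h1.congr ?_
      filter_upwards [eventually_ne_nhds hz] with w hw
      simp [sphereInv_coe, hw]

/-- Inversion as a homeomorphism. -/
def sphereInvHomeo : OnePoint ℂ ≃ₜ OnePoint ℂ where
  toFun := sphereInv
  invFun := sphereInv
  left_inv := sphereInv_sphereInv
  right_inv := sphereInv_sphereInv
  continuous_toFun := continuous_sphereInv
  continuous_invFun := continuous_sphereInv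

/-- The chart `z` on the complement of `∞`. -/
def sphereChart : OpenPartialHomeomorph (OnePoint ℂ) ℂ :=
  (OnePoint.isOpenEmbedding_coe.toOpenPartialHomeomorph ((↑) : ℂ → OnePoint ℂ)).symm

/-- The chart `1/z` on the complement of `0`. -/
def sphereChartInv : OpenPartialHomeomorph (OnePoint ℂ) ℂ :=
  sphereInvHomeo.toOpenPartialHomeomorph.trans sphereChart

theorem sphereChart_coe (z : ℂ) : sphereChart (z : OnePoint ℂ) = z :=
  (OnePoint.isOpenEmbedding_coe.toOpenPartialHomeomorph ((↑) : ℂ → OnePoint ℂ)).left_inv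
    (Set.mem_univ z)

theorem sphereChart_source : sphereChart.source = Set.range ((↑) : ℂ → OnePoint ℂ) := by
  simp [sphereChart]

open scoped Classical in
/-- The Riemann sphere as a complex curve, with the two charts `z` and `1/z`. -/
instance : ChartedSpace ℂ (OnePoint ℂ) where
  atlas := {sphereChart, sphereChartInv}
  chartAt x := if x = OnePoint.infty then sphereChartInv else sphereChart
  mem_chart_source x := by
    induction x using OnePoint.rec with
    | infty => simp [sphereChartInv, sphereChart_source, sphereInvHomeo, sphereInv_infty]
    | coe z => simp [sphereChart_source]
  chart_mem_atlas x := by split_ifs <;> simp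

theorem sphere_transition (z : ℂ) (hz : z ≠ 0) : sphereChart (sphereInv (z : OnePoint ℂ)) = z⁻¹ := by
  rw [sphereInv_coe, if_neg hz, sphereChart_coe]

instance (n : ℕ∞ω) : IsManifold 𝓘(ℂ) n (OnePoint ℂ) := by
  have hs (z : ℂ) : sphereChart.symm z = (z : OnePoint ℂ) := rfl
  have hinv : ContDiffOn ℂ n (fun z : ℂ => z⁻¹) {0}ᶜ := contDiffOn_inv ℂ
  apply isManifold_of_contDiffOn
  have key : ∀ z : ℂ, sphereInv (z : OnePoint ℂ) ∈ sphereChart.source → z ≠ 0 := by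
    rintro z hz rfl
    simp [sphereInv_coe, sphereChart_source] at hz
  rintro e e' (rfl | rfl) (rfl | rfl)
  · refine contDiffOn_id.congr fun z _ => ?_
    simp [hs, sphereChart_coe]
  · refine (hinv.congr fun z hz => ?_).mono ?_
    · exact sphere_transition z hz
    · intro z hz
      simp [sphereChartInv, sphereInvHomeo] at hz
      exact key z hz.2
  · refine (hinv.congr fun z hz => ?_).mono ?_
    · exact sphere_transition z hz
    · intro z hz
      simp [sphereChartInv, sphereInvHomeo] at hz
      exact key z hz.2
  · refine contDiffOn_id.congr fun z _ => ?_
    change sphereChart (sphereInv (sphereInv (z : OnePoint ℂ))) = z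
    rw [sphereInv_sphereInv, sphereChart_coe]

/-- The points of the surface `M_lam`. -/
def surfaceSet (lam : ℝ) : Set (OnePoint ℂ) :=
  {x | (x = OnePoint.infty → lam < 0) ∧ ∀ z : ℂ, x = (z : OnePoint ℂ) → 0 < 1 - lam * ‖z‖ ^ 2}

theorem isOpen_surfaceSet (lam : ℝ) : IsOpen (surfaceSet lam) := by
  by_cases h : lam < 0
  · have : surfaceSet lam = Set.univ := by
      refine Set.eq_univ_of_forall fun x => ⟨fun _ => h, fun z _ => ?_⟩
      nlinarith [sq_nonneg ‖z‖]
    rw [this]; exact isOpen_univ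
  · have : surfaceSet lam = ((↑) : ℂ → OnePoint ℂ) '' {z | 0 < 1 - lam * ‖z‖ ^ 2} := by
      ext x
      induction x using OnePoint.rec with
      | infty => simp [surfaceSet, h]
      | coe z => simp [surfaceSet]
    rw [this, OnePoint.isOpen_image_coe]
    exact isOpen_lt continuous_const (by fun_prop)

/-- The Riemann surface `M_lam` of constant Gauss curvature `-lam`, as a domain in the Riemann
sphere: the whole sphere for `lam = -1`, the plane for `lam = 0`, the unit disc for `lam = 1`. -/
def Surface (lam : ℝ) : TopologicalSpace.Opens (OnePoint ℂ) :=
  ⟨surfaceSet lam, isOpen_surfaceSet lam⟩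

/-- The bundle projection `π : H¹_lam → M_lam`, `h ↦ z₂ / z₁`. -/
def proj {lam : ℝ} (h : HGroup lam) : Surface lam :=
  ⟨if h.z₁ = 0 then OnePoint.infty else ((h.z₂ / h.z₁ : ℂ) : OnePoint ℂ), by
    have hr := h.norm_rel
    by_cases h0 : h.z₁ = 0
    · rw [if_pos h0]
      refine ⟨fun _ => ?_, fun z hz => absurd hz (OnePoint.infty_ne_coe z)⟩
      rw [h0] at hr
      by_contra hl
      have := mul_nonneg (not_lt.mp hl) (sq_nonneg ‖h.z₂‖)
      simp at hr
      linarith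
    · rw [if_neg h0]
      refine ⟨fun hz => absurd hz (OnePoint.coe_ne_infty _), fun z hz => ?_⟩
      have hz' : h.z₂ / h.z₁ = z := OnePoint.coe_injective hz
      have hp : 0 < ‖h.z₁‖ := norm_pos_iff.mpr h0
      rw [← hz', norm_div]
      have : 1 - lam * (‖h.z₂‖ / ‖h.z₁‖) ^ 2 = 1 / ‖h.z₁‖ ^ 2 := by
        field_simp
        linarith
      rw [this]
      positivity⟩

/-- Holomorphic maps `M_lam₀ → M_lam`. -/
def IsHolomorphic {lam₀ lam : ℝ} (f : Surface lam₀ → Surface lam) : Prop :=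
  MDifferentiable 𝓘(ℂ) 𝓘(ℂ) f

/-- `U` is a bundle map covering `f`. -/
def Covers {lam₀ lam : ℝ} (U : HGroup lam₀ → HGroup lam) (f : Surface lam₀ → Surface lam) : Prop :=
  ∀ h, proj (U h) = f (proj h)

/-- `U` has the form `(|F₁|² - lam |F₂|²)^(-1/2) !![F₁, lam F̄₂; F₂, F̄₁]`. -/
def HasForm {lam₀ lam : ℝ} (U : HGroup lam₀ → HGroup lam) (F₁ F₂ : HGroup lam₀ → ℂ) : Prop :=
  ∀ h, lam * ‖F₂ h‖ ^ 2 < ‖F₁ h‖ ^ 2 ∧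
    (U h).mat = ((1 / Real.sqrt (‖F₁ h‖ ^ 2 - lam * ‖F₂ h‖ ^ 2) : ℝ) : ℂ) •
      !![F₁ h, lam * conj (F₂ h); F₂ h, conj (F₁ h)]

end Vortex

end

open Vortex

/-!
Everything is computed in the left-invariant frame `X₀, X₁, X₂`, through which each tangent space of
`H¹_lam` becomes `ℝ × ℂ` and `Lie(H¹_lam)` becomes `ℝ × ℂ` with the bracket `Vortex.bracket`. In this
frame the exterior derivative is `dθ(u, v) = u(θ(v)) - v(θ(u)) - θ([u, v])` (`Vortex.extD_eq`), and
the connection `(A + σ⁰) t₀ + ½ Φ σ t₋ + ½ Φ̄ σ̄ t₊` is the function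
`v ↦ (A(v) + v.1, Φ v.2)` (`Vortex.potentialFrame`).

*Vortices and flat connections.* The `t₀` component of the curvature of this connection is the
equation for `dA`, and the remaining complex component is the equation `(dΦ + iAΦ) ∧ σ = 0`
(`Vortex.isFlatFrame_potentialFrame_iff`). Smoothness of `Φ` and `A` can be read off from the matrix
entries. For the converse, the values of a connection on `X₀` and `X₋` determine it up to its `t₀`
component, and that component is absorbed into `A` (`Vortex.eq_vortexPotential`).

*Trivialisation.* A flat connection pulled back to a vector space is an integrable linear system,
which is solved along rays from the origin (`exists_hasFDerivAt_of_flat`). The three-sphere is covered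
by two stereographic charts with connected intersection, on which two solutions differ by a constant
left translation (`Vortex.exists_isLocalSolution_sphere`). For `lam₀ ≥ 0` the universal covering of
the group is `ℝ × ℂ`, with deck transformations generated by `φ ↦ φ + 4π`. The solution on the
covering is periodic because its holonomy along `γ` is `exp(4πn t₀) = 1`
(`Vortex.exists_isLocalSolution_cylinder`).

*The holomorphic map.* The derivative of a trivialisation `U` in the frames is the connection itself,
which gives the formulas for `U^*τ` and `U^*τ⁰`. The fibres of `π` are the orbits `φ ↦ h γ(φ)`, and
along them both coordinates of `U` solve the same scalar equation, so that `π ∘ U` is constant on the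
fibres (`Vortex.proj_comp_eq`) and descends to a map `f`. On the source the differential of `z₂ / z₁`
is `-(i/2) σ / z₁²`, and that of `U₂ / U₁` is `-(i/2) Φ σ / U₁²`. The two are complex multiples of
each other, which is holomorphy of `f` (`Vortex.exists_hasDerivAt_ratio`); around `∞` the coordinate
`z₁ / z₂` takes the place of `z₂ / z₁`.
-/

/-! ### Linear differential equations and flat systems on vector spaces -/

section LinearODE

variable {E : Type*} [NormedAddCommGroup E] [NormedSpace ℝ E]

/-- On a time interval on which `‖a‖ * length ≤ 1 / 2`, the linear equation `u' = a u` can be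
solved on the whole interval. -/
theorem exists_linearODE_of_short [CompleteSpace E] {a : ℝ → E →L[ℝ] E} (ha : Continuous a) {K : ℝ}
    {s t : ℝ} (hst : s ≤ t) (hK : ∀ τ ∈ Set.Icc s t, ‖a τ‖ ≤ K) (hlen : K * (t - s) ≤ 1 / 2)
    (u₀ : E) :
    ∃ u : ℝ → E, u s = u₀ ∧ ∀ τ ∈ Set.Icc s t,
      HasDerivWithinAt u (a τ (u τ)) (Set.Icc s t) τ := by
  have hK0 : 0 ≤ K := (norm_nonneg _).trans (hK s ⟨le_rfl, hst⟩)
  -- on the ball of radius `‖u₀‖` about `u₀` the field is bounded by `2 K ‖u₀‖`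
  have hpl : IsPicardLindelof (fun τ u => a τ u) (tmin := s) (tmax := t) ⟨s, le_rfl, hst⟩ u₀
      ‖u₀‖₊ 0 (⟨K, hK0⟩ * (2 * ‖u₀‖₊)) ⟨K, hK0⟩ := by
    refine ⟨fun τ hτ => ?_, fun x _ => ?_, fun τ hτ x hx => ?_, ?_⟩
    · exact ((a τ).lipschitz.weaken (by exact_mod_cast hK τ hτ)).lipschitzOnWith
    · exact (ha.clm_apply continuous_const).continuousOn
    · have hx' : ‖x‖ ≤ 2 * ‖u₀‖ := by
        have h1 : ‖x - u₀‖ ≤ ‖u₀‖ := by simpa [dist_eq_norm] using hx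
        have h2 := norm_add_le (x - u₀) u₀
        rw [sub_add_cancel] at h2
        linarith
      exact ((a τ).le_opNorm x).trans
        (mul_le_mul (hK τ hτ) hx' (norm_nonneg _) hK0)
    · change K * (2 * ‖u₀‖) * max (t - s) (s - s) ≤ ‖u₀‖ - 0
      rw [sub_self, max_eq_left (sub_nonneg.2 hst)]
      nlinarith [norm_nonneg u₀]
  exact hpl.exists_eq_forall_mem_Icc_hasDerivWithinAt₀

/-- A solution on `[r, s]` and one on `[s, t]` with the same value at `s` can be joined. -/
theorem exists_linearODE_append {a : ℝ → E →L[ℝ] E} {r s t : ℝ} (hrs : r ≤ s) (hst : s ≤ t)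
    {u v : ℝ → E}
    (hu : ∀ τ ∈ Set.Icc r s, HasDerivWithinAt u (a τ (u τ)) (Set.Icc r s) τ)
    (hv : ∀ τ ∈ Set.Icc s t, HasDerivWithinAt v (a τ (v τ)) (Set.Icc s t) τ)
    (huv : v s = u s) :
    ∃ w : ℝ → E, w r = u r ∧ ∀ τ ∈ Set.Icc r t,
      HasDerivWithinAt w (a τ (w τ)) (Set.Icc r t) τ := by
  classical
  let w : ℝ → E := fun τ => if τ ≤ s then u τ else v τ
  have hwu : ∀ τ ∈ Set.Icc r s, w τ = u τ := fun τ hτ => if_pos hτ.2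
  have hwv : ∀ τ ∈ Set.Icc s t, w τ = v τ := fun τ hτ => by
    rcases hτ.1.eq_or_lt with rfl | h
    · simp [w, huv]
    · exact if_neg (not_le.2 h)
  refine ⟨w, hwu r ⟨le_rfl, hrs⟩, fun τ hτ => ?_⟩
  rw [← Set.Icc_union_Icc_eq_Icc hrs hst]
  have h1 : HasDerivWithinAt w (a τ (w τ)) (Set.Icc r s) τ := by
    by_cases h : τ ∈ Set.Icc r s
    · rw [hwu τ h]
      exact (hu τ h).congr hwu (hwu τ h)
    · exact HasFDerivWithinAt.of_notMem_closure (by rwa [closure_Icc])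
  have h2 : HasDerivWithinAt w (a τ (w τ)) (Set.Icc s t) τ := by
    by_cases h : τ ∈ Set.Icc s t
    · rw [hwv τ h]
      exact (hv τ h).congr hwv (hwv τ h)
    · exact HasFDerivWithinAt.of_notMem_closure (by rwa [closure_Icc])
  exact h1.union h2

/-- Linear differential equations with continuous coefficients have global solutions. -/
theorem exists_linearODE [CompleteSpace E] {a : ℝ → E →L[ℝ] E} (ha : Continuous a) (u₀ : E) :
    ∃ u : ℝ → E, u 0 = u₀ ∧ ∀ τ ∈ Set.Icc (0 : ℝ) 1,
      HasDerivWithinAt u (a τ (u τ)) (Set.Icc 0 1) τ := by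
  obtain ⟨K, hK⟩ := (isCompact_Icc (a := (0 : ℝ)) (b := 1)).exists_bound_of_continuousOn
    ha.continuousOn
  obtain ⟨n, hn⟩ := exists_nat_gt (2 * K)
  have hK0 : 0 ≤ K := (norm_nonneg _).trans (hK 0 (by simp))
  have hn0 : (0 : ℝ) < n := by linarith
  have key : ∀ k : ℕ, k ≤ n → ∃ u : ℝ → E, u 0 = u₀ ∧ ∀ τ ∈ Set.Icc (0 : ℝ) (k / n),
      HasDerivWithinAt u (a τ (u τ)) (Set.Icc 0 (k / n)) τ := by
    intro k
    induction k with
    | zero =>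
      intro _
      refine ⟨fun _ => u₀, rfl, fun τ _ => ?_⟩
      simp only [CharP.cast_eq_zero, zero_div, Set.Icc_self]
      exact HasFDerivWithinAt.of_subsingleton Set.subsingleton_singleton
    | succ k ih =>
      intro hk
      obtain ⟨u, hu0, hu⟩ := ih (by omega)
      have hk' : ((k + 1 : ℕ) : ℝ) ≤ n := by exact_mod_cast hk
      have h01 : (0 : ℝ) ≤ k / n := by positivity
      have h12 : (k : ℝ) / n ≤ ((k + 1 : ℕ) : ℝ) / n := by
        gcongr; simp
      have h23 : ((k + 1 : ℕ) : ℝ) / n ≤ 1 := (div_le_one hn0).2 hk'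
      obtain ⟨v, hv0, hv⟩ := exists_linearODE_of_short ha h12
        (K := K) (fun τ hτ => hK τ ⟨h01.trans hτ.1, hτ.2.trans h23⟩) (by
          rw [← sub_div, mul_div_assoc', div_le_iff₀ hn0]; push_cast; linarith) (u (k / n))
      obtain ⟨w, hw0, hw⟩ := exists_linearODE_append h01 h12 hu hv hv0
      exact ⟨w, hw0.trans hu0, hw⟩
  obtain ⟨u, hu0, hu⟩ := key n le_rfl
  rw [div_self hn0.ne'] at hu
  exact ⟨u, hu0, hu⟩

end LinearODE

/-- Solutions of the scalar equation `y' = a y` are exponentials of the integral of `a`. -/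
theorem eq_exp_integral_mul_of_hasDerivAt {a y : ℝ → ℂ} (ha : Continuous a)
    (hy : ∀ t, HasDerivAt y (a t * y t) t) (t : ℝ) :
    y t = Complex.exp (∫ s in (0 : ℝ)..t, a s) * y 0 := by
  have hI : ∀ t, HasDerivAt (fun t => ∫ s in (0 : ℝ)..t, a s) (a t) t := fun t =>
    intervalIntegral.integral_hasDerivAt_right (ha.intervalIntegrable _ _)
      (ha.stronglyMeasurableAtFilter _ _) ha.continuousAt
  -- the quotient of `y` by the exponential is constant
  have hc : ∀ t, HasDerivAt (fun t => Complex.exp (-∫ s in (0 : ℝ)..t, a s) * y t) 0 t := by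
    intro t
    refine (((hI t).neg.cexp).mul (hy t)).congr_deriv ?_
    ring
  have := is_const_of_deriv_eq_zero (fun t => (hc t).differentiableAt) (fun t => (hc t).deriv) t 0
  simp only [intervalIntegral.integral_same, neg_zero, Complex.exp_zero, one_mul] at this
  rw [← this, ← mul_assoc, ← Complex.exp_add, add_neg_cancel, Complex.exp_zero, one_mul]

section Flat

variable {V E : Type*} [NormedAddCommGroup V] [NormedSpace ℝ V] [FiniteDimensional ℝ V]
  [NormedAddCommGroup E] [NormedSpace ℝ E]

/-- Second order Taylor estimate, uniform on balls. -/
theorem exists_taylor_bound {F : Type*} [NormedAddCommGroup F] [NormedSpace ℝ F] {f : V → F}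
    (hf : ContDiff ℝ 2 f) (r : ℝ) :
    ∃ C : ℝ, 0 ≤ C ∧ (∀ y ∈ Metric.closedBall (0 : V) r, ‖f y‖ ≤ C ∧ ‖fderiv ℝ f y‖ ≤ C) ∧
      ∀ y ∈ Metric.closedBall (0 : V) r, ∀ z ∈ Metric.closedBall (0 : V) r,
        ‖f z - f y‖ ≤ C * ‖z - y‖ ∧ ‖f z - f y - fderiv ℝ f y (z - y)‖ ≤ C * ‖z - y‖ ^ 2 := by
  have hc := isCompact_closedBall (0 : V) r
  have hf' : ContDiff ℝ 1 (fderiv ℝ f) := hf.fderiv_right (by norm_num)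
  have hf'' : ContDiff ℝ 0 (fderiv ℝ (fderiv ℝ f)) := hf'.fderiv_right (by norm_num)
  obtain ⟨C₀, h₀⟩ := hc.exists_bound_of_continuousOn hf.continuous.continuousOn
  obtain ⟨C₁, h₁⟩ := hc.exists_bound_of_continuousOn hf'.continuous.continuousOn
  obtain ⟨C₂, h₂⟩ := hc.exists_bound_of_continuousOn (E := V →L[ℝ] V →L[ℝ] F)
    hf''.continuous.continuousOn
  have hd : Differentiable ℝ f := hf.differentiable (by norm_num)
  have hd' : Differentiable ℝ (fderiv ℝ f) := hf'.differentiable (by norm_num)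
  have hconv := convex_closedBall (0 : V) r
  refine ⟨max 0 (max C₀ (max C₁ C₂)), le_max_left _ _, fun y hy => ⟨?_, ?_⟩,
    fun y hy z hz => ⟨?_, ?_⟩⟩
  · exact (h₀ y hy).trans (by simp)
  · exact (h₁ y hy).trans (by simp)
  · exact hconv.norm_image_sub_le_of_norm_fderiv_le (fun w _ => hd w)
      (fun w hw => (h₁ w hw).trans (by simp)) hy hz
  · have hseg : segment ℝ y z ⊆ Metric.closedBall 0 r := hconv.segment_subset hy hz
    have hb : ∀ w ∈ segment ℝ y z, ‖fderiv ℝ f w - fderiv ℝ f y‖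
        ≤ max 0 (max C₀ (max C₁ C₂)) * ‖z - y‖ := by
      intro w hw
      refine (hconv.norm_image_sub_le_of_norm_fderiv_le (fun w _ => hd' w)
        (C := max 0 (max C₀ (max C₁ C₂)))
        (fun w hw => (h₂ w hw).trans (le_max_of_le_right (le_max_of_le_right (le_max_right _ _))))
        hy (hseg hw)).trans ?_
      gcongr
      obtain ⟨θ, hθ, rfl⟩ := (segment_eq_image' ℝ y z) ▸ hw
      rw [add_sub_cancel_left, norm_smul, Real.norm_of_nonneg hθ.1]
      exact mul_le_of_le_one_left (norm_nonneg _) hθ.2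
    have := (convex_segment y z).norm_image_sub_le_of_norm_hasFDerivWithin_le'
      (fun w _ => (hd w).hasFDerivAt.hasFDerivWithinAt) hb (left_mem_segment ℝ y z)
      (right_mem_segment ℝ y z)
    rwa [mul_assoc, ← pow_two] at this

/-- **Flat systems are integrable.** If the operator-valued one-form `B` satisfies
`dB(h, k) = B(h) B(k) - B(k) B(h)`, the system `du = B u` has a solution with any given value
at the origin. The solution is obtained by solving the linear equation along each ray; flatness
says that `t ↦ t B(t x)(h) u(t x)` solves the linearised equation along the ray through `x`, so
that it is the derivative of the solution in the direction `h`. -/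
theorem exists_hasFDerivAt_of_flat [CompleteSpace E] {B : V → V →L[ℝ] E →L[ℝ] E}
    (hB : ContDiff ℝ 2 B)
    (hflat : ∀ x h k, fderiv ℝ B x h k - fderiv ℝ B x k h
      = (B x h).comp (B x k) - (B x k).comp (B x h)) (u₀ : E) :
    ∃ u : V → E, u 0 = u₀ ∧ ∀ x, HasFDerivAt u ((B x).flip (u x)) x := by
  have hBc : Continuous B := hB.continuous
  have hBd : Differentiable ℝ B := hB.differentiable (by norm_num)
  have hsol : ∀ y : V, ∃ u : ℝ → E, u 0 = u₀ ∧ ∀ τ ∈ Set.Icc (0 : ℝ) 1,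
      HasDerivWithinAt u (B (τ • y) y (u τ)) (Set.Icc 0 1) τ := fun y =>
    exists_linearODE (a := fun τ => B (τ • y) y) (by fun_prop) u₀
  choose u hu0 hu using hsol
  refine ⟨fun y => u y 1, ?_, fun x => ?_⟩
  · -- the ray through the origin is constant
    have h0 : ∀ t ∈ Set.Icc (0 : ℝ) 1, u 0 t = u 0 0 := by
      refine constant_of_has_deriv_right_zero
        (fun t ht => (hu 0 t ht).continuousWithinAt) fun t ht => ?_
      have := hu 0 t (Set.Ico_subset_Icc_self ht)
      simp only [map_zero, _root_.zero_apply] at this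
      exact this.mono_of_mem_nhdsWithin (Icc_mem_nhdsGE_of_mem ht)
    exact (h0 1 (by simp)).trans (hu0 0)
  obtain ⟨C, hC0, hCb, hCt⟩ := exists_taylor_bound hB (‖x‖ + 1)
  obtain ⟨M, hM⟩ := (isCompact_Icc (a := (0 : ℝ)) (b := 1)).exists_bound_of_continuousOn
    (f := u x) fun t ht => (hu x t ht).continuousWithinAt
  have hM0 : 0 ≤ M := (norm_nonneg _).trans (hM 0 (by simp))
  set r : ℝ := ‖x‖ + 1 with hr
  have hr1 : 1 ≤ r := by have := norm_nonneg x; linarith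
  have hmem : ∀ z : V, ‖z‖ ≤ r → ∀ t ∈ Set.Icc (0 : ℝ) 1, t • z ∈ Metric.closedBall (0 : V) r := by
    intro z hz t ht
    rw [mem_closedBall_zero_iff, norm_smul, Real.norm_of_nonneg ht.1]
    exact (mul_le_of_le_one_left (norm_nonneg _) ht.2).trans hz
  have hxr : ‖x‖ ≤ r := by linarith
  set K : ℝ := C * r + 1 with hK
  set D : ℝ := (C * r + C + (C * r + C) * C) * M with hD
  have hK0 : 0 < K := by positivity
  have key : ∀ y : V, ‖y - x‖ < 1 →
      ‖u y 1 - u x 1 - B x (y - x) (u x 1)‖ ≤ (D / K * (Real.exp K - 1)) * ‖y - x‖ ^ 2 := by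
    intro y hy
    set h : V := y - x with hh
    have hyr : ‖y‖ ≤ r := by
      have := norm_add_le h x
      rw [hh, sub_add_cancel] at this
      linarith
    -- `e` is the error of the linear approximation along the rays; it solves the linear equation
    -- along the ray through `y` up to the remainder `R`, which is quadratic in `h`
    let e : ℝ → E := fun t => u y t - u x t - t • B (t • x) h (u x t)
    let R : ℝ → E →L[ℝ] E := fun t =>
      (B (t • y) - B (t • x) - fderiv ℝ B (t • x) (t • y - t • x)) y
        + t • fderiv ℝ B (t • x) h h + t • (B (t • y) y - B (t • x) x).comp (B (t • x) h)
    have he : ∀ t ∈ Set.Icc (0 : ℝ) 1,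
        HasDerivWithinAt e (B (t • y) y (e t) + R t (u x t)) (Set.Icc 0 1) t := by
      intro t ht
      have h1 : HasDerivWithinAt (fun t : ℝ => B (t • x)) (fderiv ℝ B (t • x) x)
          (Set.Icc 0 1) t := by
        have h2 : HasDerivAt (fun t : ℝ => t • x) x t := by
          simpa using (hasDerivAt_id t).smul_const x
        exact (HasFDerivAt.comp_hasDerivAt (E := V →L[ℝ] E →L[ℝ] E) (f := fun t : ℝ => t • x) t
          (hBd (t • x)).hasFDerivAt h2).hasDerivWithinAt
      have h3 := (h1.clm_apply (hasDerivWithinAt_const t _ h)).clm_apply (hu x t ht)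
      have h4 := ((hu y t ht).sub (hu x t ht)).sub ((hasDerivWithinAt_id t _).smul h3)
      refine h4.congr_deriv ?_
      have hf := DFunLike.congr_fun (hflat (t • x) x h) (u x t)
      have hs : t • y - t • x = t • h := by rw [hh, smul_sub]
      have hyx : y = x + h := by rw [hh]; abel
      simp only [_root_.sub_apply, ContinuousLinearMap.comp_apply] at hf
      have hf' := sub_eq_iff_eq_add.1 hf
      simp only [e, R, _root_.add_apply, _root_.sub_apply,
        _root_.smul_apply, ContinuousLinearMap.comp_apply, map_sub, map_smul,
        map_zero, id, add_zero, one_smul, smul_add, smul_sub, hf']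
      rw [hyx]
      simp only [_root_.add_apply, map_add, smul_add]
      abel
    have hR : ∀ t ∈ Set.Icc (0 : ℝ) 1, ‖R t (u x t)‖ ≤ D * ‖h‖ ^ 2 := by
      intro t ht
      obtain ⟨hb1, hb2⟩ := hCb _ (hmem x hxr t ht)
      obtain ⟨ht1, ht2⟩ := hCt _ (hmem x hxr t ht) _ (hmem y hyr t ht)
      have hth : ‖t • y - t • x‖ ≤ ‖h‖ := by
        rw [← smul_sub, ← hh, norm_smul, Real.norm_of_nonneg ht.1]
        exact mul_le_of_le_one_left (norm_nonneg _) ht.2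
      have p1 : ‖(B (t • y) - B (t • x) - fderiv ℝ B (t • x) (t • y - t • x)) y‖
          ≤ C * ‖h‖ ^ 2 * r :=
        (ContinuousLinearMap.le_opNorm _ _).trans (by gcongr; exact ht2.trans (by gcongr))
      have p2 : ‖fderiv ℝ B (t • x) h h‖ ≤ C * ‖h‖ * ‖h‖ :=
        (ContinuousLinearMap.le_opNorm₂ _ _ _).trans (by gcongr)
      have p3 : ‖B (t • x) h‖ ≤ C * ‖h‖ :=
        (ContinuousLinearMap.le_opNorm _ _).trans (by gcongr)
      have p4 : ‖B (t • y) y - B (t • x) x‖ ≤ C * ‖h‖ * r + C * ‖h‖ := by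
        have : B (t • y) y - B (t • x) x = (B (t • y) - B (t • x)) y + B (t • x) h := by
          rw [hh]; simp
        rw [this]
        refine (norm_add_le _ _).trans (add_le_add ?_ p3)
        exact (ContinuousLinearMap.le_opNorm _ _).trans (by gcongr; exact ht1.trans (by gcongr))
      have p5 : ‖(B (t • y) y - B (t • x) x).comp (B (t • x) h)‖
          ≤ (C * ‖h‖ * r + C * ‖h‖) * (C * ‖h‖) :=
        (ContinuousLinearMap.opNorm_comp_le _ _).trans (by gcongr)
      have q : ∀ (T : E →L[ℝ] E) (c : ℝ), ‖T‖ ≤ c → ‖t • T‖ ≤ c := fun T c hT => by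
        rw [norm_smul, Real.norm_of_nonneg ht.1]
        exact (mul_le_of_le_one_left (norm_nonneg _) ht.2).trans hT
      have hRn : ‖R t‖ ≤ C * ‖h‖ ^ 2 * r + C * ‖h‖ * ‖h‖
          + (C * ‖h‖ * r + C * ‖h‖) * (C * ‖h‖) :=
        (norm_add_le _ _).trans (add_le_add ((norm_add_le _ _).trans
          (add_le_add p1 (q _ _ p2))) (q _ _ p5))
      calc ‖R t (u x t)‖ ≤ ‖R t‖ * ‖u x t‖ := ContinuousLinearMap.le_opNorm _ _
        _ ≤ _ := mul_le_mul hRn (hM t ht) (norm_nonneg _) (by positivity)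
        _ = D * ‖h‖ ^ 2 := by rw [hD]; ring
    have hg := norm_le_gronwallBound_of_norm_deriv_right_le (f := e) (δ := 0) (K := K)
      (ε := D * ‖h‖ ^ 2) (fun t ht => (he t ht).continuousWithinAt)
      (fun t ht => (he t (Set.Ico_subset_Icc_self ht)).mono_of_mem_nhdsWithin
        (Icc_mem_nhdsGE_of_mem ht)) (by simp [e, hu0]) (fun t ht => by
        have ht' := Set.Ico_subset_Icc_self ht
        refine (norm_add_le _ _).trans (add_le_add ?_ (hR t ht'))
        refine (ContinuousLinearMap.le_opNorm _ _).trans ?_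
        gcongr
        refine (ContinuousLinearMap.le_opNorm _ _).trans ?_
        refine (mul_le_mul (hCb _ (hmem y hyr t ht')).1 hyr (norm_nonneg _) hC0).trans ?_
        rw [hK]; linarith) 1 (by simp)
    rw [gronwallBound_of_K_ne_0 hK0.ne'] at hg
    simp only [e, one_smul, zero_mul, zero_add, sub_zero, mul_one] at hg
    exact hg.trans (le_of_eq (by ring))
  have hO : HasFDerivAt (fun y => u y 1 - u x 1 - B x (y - x) (u x 1)) (0 : V →L[ℝ] E) x := by
    refine Asymptotics.IsBigO.hasFDerivAt (n := 2) ?_ one_lt_two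
    refine Asymptotics.IsBigO.of_bound (D / K * (Real.exp K - 1)) ?_
    filter_upwards [Metric.ball_mem_nhds x one_pos] with y hy
    rw [norm_pow, norm_norm]
    exact key y (by simpa [dist_eq_norm] using hy)
  have hL : HasFDerivAt (fun y => B x (y - x) (u x 1)) ((B x).flip (u x 1)) x := by
    have := ((B x).flip (u x 1)).hasFDerivAt.comp x ((hasFDerivAt_id x).sub_const x)
    exact this
  refine ((hO.add hL).add_const (u x 1)).congr_of_eventuallyEq ?_ |>.congr_fderiv (zero_add _)
  exact Filter.Eventually.of_forall fun y => by simp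

/-- Solutions of a smooth linear system are smooth. -/
theorem contDiff_of_hasFDerivAt_flip {B : V → V →L[ℝ] E →L[ℝ] E} (hB : ContDiff ℝ ∞ B)
    {u : V → E} (hu : ∀ x, HasFDerivAt u ((B x).flip (u x)) x) : ContDiff ℝ ∞ u := by
  have hd : fderiv ℝ u = fun x => (B x).flip (u x) := funext fun x => (hu x).fderiv
  rw [contDiff_infty]
  intro n
  induction n with
  | zero =>
    exact contDiff_zero.2 (continuous_iff_continuousAt.2 fun x => (hu x).continuousAt)
  | succ n ih =>
    push_cast
    rw [contDiff_succ_iff_fderiv]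
    refine ⟨fun x => (hu x).differentiableAt, by simp, ?_⟩
    rw [hd]
    have hBn : ContDiff ℝ n B := hB.of_le (by exact_mod_cast le_top)
    exact contDiff_clm_apply_iff.2 fun v => (hBn.clm_apply contDiff_const).clm_apply ih

end Flat

namespace Vortex

/-! ### Left-trivialised calculus on the groups -/

/-- The bracket of `Lie(H¹_lam)`, transported to `ℝ × ℂ` along
`(x, w) ↦ x t₀ + (Re w) t₁ + (Im w) t₂`. -/
noncomputable def bracket (lam : ℝ) (u v : ℝ × ℂ) : ℝ × ℂ :=
  (-lam * (conj u.2 * v.2).im, I * (u.1 * v.2 - v.1 * u.2))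

/-- The action `p ↦ p ξ` of `ξ ∈ Lie(H¹_lam)` by right multiplication of matrices of the form
`!![a, lam b̄; b, ā]`, such a matrix being recorded by its first column `(a, b)`. -/
noncomputable def rightMul (lam : ℝ) : ℝ × ℂ →L[ℝ] ℂ × ℂ →L[ℝ] ℂ × ℂ :=
  (LinearMap.mk₂ ℝ
    (fun (ξ : ℝ × ℂ) (p : ℂ × ℂ) =>
      ((-(I / 2) * (p.1 * ξ.1 + lam * conj p.2 * ξ.2),
        -(I / 2) * (p.2 * ξ.1 + conj p.1 * ξ.2)) : ℂ × ℂ))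
    (by intros; ext <;> simp <;> ring) (by intros; ext <;> simp <;> ring)
    (by intros; ext <;> simp <;> ring) (by intros; ext <;> simp <;> ring)).toContinuousBilinearMap

theorem rightMul_apply (lam : ℝ) (ξ : ℝ × ℂ) (p : ℂ × ℂ) :
    rightMul lam ξ p = (-(I / 2) * (p.1 * ξ.1 + lam * conj p.2 * ξ.2),
        -(I / 2) * (p.2 * ξ.1 + conj p.1 * ξ.2)) := rfl

/-- `leftDiv lam p η` represents the Lie algebra element `p⁻¹ η` for a tangent vector `η` at the
point of `H¹_lam` with coordinates `p`. -/
noncomputable def leftDiv (lam : ℝ) : ℂ × ℂ →L[ℝ] ℂ × ℂ →L[ℝ] ℝ × ℂ :=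
  (LinearMap.mk₂ ℝ
    (fun (p η : ℂ × ℂ) =>
      ((-2 * (conj p.1 * η.1 - lam * (conj p.2 * η.2)).im,
        2 * I * (p.1 * η.2 - p.2 * η.1)) : ℝ × ℂ))
    (by intros; ext <;> simp <;> ring) (by intros; ext <;> simp <;> ring)
    (by intros; ext <;> simp <;> ring) (by intros; ext <;> simp <;> ring)).toContinuousBilinearMap

theorem leftDiv_apply (lam : ℝ) (p η : ℂ × ℂ) :
    leftDiv lam p η = (-2 * (conj p.1 * η.1 - lam * (conj p.2 * η.2)).im,
        2 * I * (p.1 * η.2 - p.2 * η.1)) := rfl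

/-- The quadratic form whose unit level set is `H¹_lam`. -/
noncomputable def normForm (lam : ℝ) (p : ℂ × ℂ) : ℝ :=
  p.1.re ^ 2 + p.1.im ^ 2 - lam * (p.2.re ^ 2 + p.2.im ^ 2)

theorem normForm_eq (lam : ℝ) (p : ℂ × ℂ) : normForm lam p = ‖p.1‖ ^ 2 - lam * ‖p.2‖ ^ 2 := by
  simp only [Complex.sq_norm, Complex.normSq_apply, normForm]
  ring

/-- Right multiplication reverses products, so that it is an anti-representation of the bracket. -/
theorem rightMul_commutator (lam : ℝ) (ξ η : ℝ × ℂ) :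
    rightMul lam (bracket lam ξ η)
      = (rightMul lam η).comp (rightMul lam ξ) - (rightMul lam ξ).comp (rightMul lam η) := by
  have c2 : conj (2 : ℂ) = 2 := map_ofNat (starRingEnd ℂ) 2
  refine ContinuousLinearMap.ext fun p => ?_
  have him : (((conj ξ.2 * η.2).im : ℝ) : ℂ) = (conj ξ.2 * η.2 - ξ.2 * conj η.2) * (-(I / 2)) := by
    apply Complex.ext <;> simp <;> ring
  rw [sub_apply, ContinuousLinearMap.comp_apply, ContinuousLinearMap.comp_apply]
  simp only [rightMul_apply, bracket]
  ext1 <;>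
    simp only [Prod.fst_sub, Prod.snd_sub, map_mul, map_add, map_neg, map_div₀, Complex.conj_I, c2,
      Complex.conj_ofReal, Complex.conj_conj, Complex.ofReal_mul, Complex.ofReal_neg, him] <;>
    ring_nf

theorem leftDiv_rightMul {lam : ℝ} {p : ℂ × ℂ} (hp : normForm lam p = 1) (ξ : ℝ × ℂ) :
    leftDiv lam p (rightMul lam ξ p) = ξ := by
  simp only [normForm] at hp
  simp only [leftDiv_apply, rightMul_apply]
  ext1
  · simp
    linear_combination ξ.1 * hp
  · apply Complex.ext
    · simp
      linear_combination ξ.2.re * hp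
    · simp
      linear_combination ξ.2.im * hp

/-- The hypothesis on `η` says that it is tangent to the level set of `normForm` at `p`. -/
theorem rightMul_leftDiv {lam : ℝ} {p : ℂ × ℂ} (hp : normForm lam p = 1) {η : ℂ × ℂ}
    (hη : p.1.re * η.1.re + p.1.im * η.1.im - lam * (p.2.re * η.2.re + p.2.im * η.2.im) = 0) :
    rightMul lam (leftDiv lam p η) p = η := by
  simp only [normForm] at hp
  simp only [leftDiv_apply, rightMul_apply]
  ext1 <;> apply Complex.ext <;> simp
  · linear_combination η.1.re * hp - p.1.re * hη
  · linear_combination η.1.im * hp - p.1.im * hη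
  · linear_combination η.2.re * hp - p.2.re * hη
  · linear_combination η.2.im * hp - p.2.im * hη

/-- The coordinates of a group element, that is the first column of its matrix. -/
def coords {lam : ℝ} (h : HGroup lam) : ℂ × ℂ := (h.z₁, h.z₂)

theorem normForm_coords {lam : ℝ} (h : HGroup lam) : normForm lam (coords h) = 1 := h.rel_re

theorem isInducing_coords {lam : ℝ} : Topology.IsInducing (coords : HGroup lam → ℂ × ℂ) := ⟨rfl⟩

theorem chartOf_eq_leftDiv {lam : ℝ} (p h : HGroup lam) :
    HGroup.chartOf p h = leftDiv lam (coords p) (coords h) := by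
  rw [HGroup.chartOf_apply, leftDiv_apply]
  simp only [coords, HGroup.mul_z₁, HGroup.mul_z₂, HGroup.inv_z₁, HGroup.inv_z₂, map_neg,
    Complex.conj_conj]
  ext1
  · dsimp only; congr 2; ring
  · dsimp only; ring

theorem hasMFDerivAt_coords {lam : ℝ} (p : HGroup lam) :
    HasMFDerivAt 𝓘(ℝ, ℝ × ℂ) 𝓘(ℝ, ℂ × ℂ) (coords : HGroup lam → ℂ × ℂ) p
      ((rightMul lam).flip (coords p)) := by
  have h1 := HGroup.hasMFDerivAt_z₁ p
  have h2 := HGroup.hasMFDerivAt_z₂ p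
  have e : (rightMul lam).flip (coords p) = (p.z₁ • HGroup.e₁ + (lam * conj p.z₂) • HGroup.e₂).prod
      (p.z₂ • HGroup.e₁ + (conj p.z₁) • HGroup.e₂) := by
    ext <;> simp [rightMul_apply, coords, HGroup.e₁, HGroup.e₂] <;> ring
  rw [e]
  exact ⟨h1.1.prodMk h2.1, h1.2.prodMk h2.2⟩

section Maps

variable {F : Type*} [NormedAddCommGroup F] [NormedSpace ℝ F]
  {M : Type*} [TopologicalSpace M] [ChartedSpace F M] {lam : ℝ}

/-- A map into `H¹_lam` whose coordinates `p` satisfy `dp = p L` has derivative `L` in the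
left-invariant frame: the chart around `f x` is the restriction of a linear map of the coordinates
(`chartOf_eq_leftDiv`). -/
theorem hasMFDerivAt_of_coords {f : M → HGroup lam} {x : M} {L : F →L[ℝ] ℝ × ℂ}
    (h : HasMFDerivAt 𝓘(ℝ, F) 𝓘(ℝ, ℂ × ℂ) (fun y => coords (f y)) x
      (((rightMul lam).flip (coords (f x))).comp L)) :
    HasMFDerivAt 𝓘(ℝ, F) 𝓘(ℝ, ℝ × ℂ) f x L := by
  refine ⟨isInducing_coords.continuousAt_iff.2 h.1, ?_⟩
  have h2 := ((leftDiv lam (coords (f x))).hasFDerivAt).comp_hasFDerivWithinAt _ h.2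
  refine (h2.congr_fderiv ?_).congr_of_eventuallyEq ?_ ?_
  · refine ContinuousLinearMap.ext fun v => ?_
    exact leftDiv_rightMul (normForm_coords _) _
  · exact Filter.Eventually.of_forall fun y => chartOf_eq_leftDiv _ _
  · exact chartOf_eq_leftDiv _ _

theorem contMDiffAt_of_coords {n : ℕ∞ω} {f : M → HGroup lam} {x : M}
    (h : ContMDiffAt 𝓘(ℝ, F) 𝓘(ℝ, ℂ × ℂ) n (fun y => coords (f y)) x) :
    ContMDiffAt 𝓘(ℝ, F) 𝓘(ℝ, ℝ × ℂ) n f x := by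
  rw [contMDiffAt_iff] at h ⊢
  refine ⟨isInducing_coords.continuousAt_iff.2 h.1, ?_⟩
  have h2 := (leftDiv lam (coords (f x))).contDiff.comp_contDiffWithinAt h.2
  exact h2.congr (fun y _ => chartOf_eq_leftDiv _ _) (chartOf_eq_leftDiv _ _)

theorem contMDiff_coords {n : ℕ∞ω} :
    ContMDiff 𝓘(ℝ, ℝ × ℂ) 𝓘(ℝ, ℂ × ℂ) n (coords : HGroup lam → ℂ × ℂ) := by
  intro p
  rw [contMDiffAt_iff]
  refine ⟨isInducing_coords.continuous.continuousAt, ?_⟩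
  have hopen : IsOpen {x : ℝ × ℂ | 0 < HGroup.disc lam x} :=
    isOpen_lt continuous_const HGroup.continuous_disc
  have h0 : (0 : ℝ × ℂ) ∈ {x : ℝ × ℂ | 0 < HGroup.disc lam x} := by simp [HGroup.disc]
  have h1 := (HGroup.contDiffOn_param_z₁ (lam := lam) n).contDiffAt (hopen.mem_nhds h0)
  have h2 := (HGroup.contDiffOn_param_z₂ (lam := lam) n).contDiffAt (hopen.mem_nhds h0)
  have h : ContDiffAt ℝ n (fun x : ℝ × ℂ => coords (p * HGroup.param x)) 0 := by
    simp only [coords, HGroup.mul_z₁, HGroup.mul_z₂]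
    fun_prop
  have e0 : extChartAt 𝓘(ℝ, ℝ × ℂ) p p = 0 := by
    simp only [extChartAt, mfld_simps]
    exact HGroup.chartOf_self p
  rw [e0]
  refine h.contDiffWithinAt.congr_of_eventuallyEq (Filter.Eventually.of_forall fun x => ?_) ?_
  · exact congrArg coords (HGroup.chartOf_symm_apply p x)
  · exact congrArg coords (HGroup.chartOf_symm_apply p 0)

end Maps

/-- The real bilinear form polar to `normForm`. -/
noncomputable def polarForm (lam : ℝ) : ℂ × ℂ →L[ℝ] ℂ × ℂ →L[ℝ] ℝ :=
  (LinearMap.mk₂ ℝ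
    (fun (p η : ℂ × ℂ) =>
      p.1.re * η.1.re + p.1.im * η.1.im - lam * (p.2.re * η.2.re + p.2.im * η.2.im))
    (by intros; simp; ring) (by intros; simp; ring)
    (by intros; simp; ring) (by intros; simp; ring)).toContinuousBilinearMap

theorem polarForm_apply (lam : ℝ) (p η : ℂ × ℂ) : polarForm lam p η
    = p.1.re * η.1.re + p.1.im * η.1.im - lam * (p.2.re * η.2.re + p.2.im * η.2.im) := rfl

theorem polarForm_rightMul (lam : ℝ) (p : ℂ × ℂ) (ξ : ℝ × ℂ) :
    polarForm lam p (rightMul lam ξ p) = 0 := by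
  simp [polarForm_apply, rightMul_apply]
  ring

section Maps

variable {F : Type*} [NormedAddCommGroup F] [NormedSpace ℝ F] {lam : ℝ}

theorem hasFDerivAt_normForm {g : F → ℂ × ℂ} {g' : F →L[ℝ] ℂ × ℂ} {x : F}
    (hg : HasFDerivAt g g' x) :
    HasFDerivAt (fun y => normForm lam (g y)) ((2 : ℝ) • (polarForm lam (g x)).comp g') x := by
  have h := ((polarForm lam).hasFDerivAt.comp x hg).clm_apply hg
  refine (h.congr_fderiv ?_).congr_of_eventuallyEq (Filter.Eventually.of_forall fun y => ?_)
  · refine ContinuousLinearMap.ext fun v => ?_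
    simp [polarForm_apply]
    ring
  · simp [polarForm_apply, normForm]
    ring

/-- The left-trivialised derivative `ψ⁻¹ dψ` of a map `ψ` from a vector space to `H¹_lam`. -/
noncomputable def trivDeriv (ψ : F → HGroup lam) (x : F) : F →L[ℝ] ℝ × ℂ :=
  (leftDiv lam (coords (ψ x))).comp (fderiv ℝ (fun y => coords (ψ y)) x)

theorem hasFDerivAt_coords_comp {ψ : F → HGroup lam} {x : F}
    (h : DifferentiableAt ℝ (fun y => coords (ψ y)) x) :
    HasFDerivAt (fun y => coords (ψ y))
      (((rightMul lam).flip (coords (ψ x))).comp (trivDeriv ψ x)) x := by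
  refine h.hasFDerivAt.congr_fderiv (ContinuousLinearMap.ext fun v => ?_)
  refine (rightMul_leftDiv (normForm_coords _) ?_).symm
  have h1 := hasFDerivAt_normForm (lam := lam) h.hasFDerivAt
  have h2 : HasFDerivAt (fun y => normForm lam (coords (ψ y))) (0 : F →L[ℝ] ℝ) x := by
    simp only [normForm_coords]
    exact hasFDerivAt_const _ _
  have h3 := DFunLike.congr_fun (h1.unique h2) v
  simpa [polarForm_apply] using h3

theorem hasMFDerivAt_trivDeriv {ψ : F → HGroup lam} {x : F}
    (h : DifferentiableAt ℝ (fun y => coords (ψ y)) x) :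
    HasMFDerivAt 𝓘(ℝ, F) 𝓘(ℝ, ℝ × ℂ) ψ x (trivDeriv (F := F) ψ x) := by
  have h1 := hasFDerivAt_coords_comp h
  exact hasMFDerivAt_of_coords (L := trivDeriv ψ x) h1.hasMFDerivAt

theorem trivDeriv_eq_of_hasFDerivAt {ψ : F → HGroup lam} {x : F} {L : F →L[ℝ] ℝ × ℂ}
    (h : HasFDerivAt (fun y => coords (ψ y)) (((rightMul lam).flip (coords (ψ x))).comp L) x) :
    trivDeriv ψ x = L := by
  refine ContinuousLinearMap.ext fun v => ?_
  rw [trivDeriv, h.fderiv]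
  exact leftDiv_rightMul (normForm_coords _) _

theorem contDiffAt_trivDeriv {ψ : F → HGroup lam} {x : F} {m n : WithTop ℕ∞} (hmn : m + 1 ≤ n)
    (h : ContDiffAt ℝ n (fun y => coords (ψ y)) x) : ContDiffAt ℝ m (trivDeriv ψ) x := by
  have h1 : ContDiffAt ℝ m (fun y => leftDiv lam (coords (ψ y))) x :=
    (leftDiv lam).contDiff.contDiffAt.comp x (h.of_le (le_self_add.trans hmn))
  exact h1.clm_comp (h.fderiv_right hmn)

/-- The structure equation `dω + ω ∧ ω = 0` for `ω = ψ⁻¹ dψ`. -/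
theorem fderiv_trivDeriv_sub {ψ : F → HGroup lam} {x : F}
    (hψ : ContDiffAt ℝ 2 (fun y => coords (ψ y)) x) (h k : F) :
    fderiv ℝ (trivDeriv ψ) x h k - fderiv ℝ (trivDeriv ψ) x k h
      = -bracket lam (trivDeriv ψ x h) (trivDeriv ψ x k) := by
  set g : F → ℂ × ℂ := fun y => coords (ψ y) with hg
  have hM : DifferentiableAt ℝ (trivDeriv ψ) x :=
    (contDiffAt_trivDeriv (m := 1) (by norm_num) hψ).differentiableAt (by norm_num)
  have hgx : DifferentiableAt ℝ g x := hψ.differentiableAt (by norm_num)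
  have hnear : fderiv ℝ g =ᶠ[𝓝 x] fun y => ((rightMul lam).flip (g y)).comp (trivDeriv ψ y) := by
    filter_upwards [hψ.eventually (by simp)] with y hy
    exact (hasFDerivAt_coords_comp (hy.differentiableAt (by norm_num))).fderiv
  have hsnd (h k : F) : fderiv ℝ (fderiv ℝ g) x h k
      = rightMul lam (trivDeriv ψ x k) (rightMul lam (trivDeriv ψ x h) (g x))
        + rightMul lam (fderiv ℝ (trivDeriv ψ) x h k) (g x) := by
    have h1 := ((rightMul lam).flip.hasFDerivAt.comp x hgx.hasFDerivAt).clm_comp hM.hasFDerivAt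
    have h2 := DFunLike.congr_fun (DFunLike.congr_fun (h1.congr_of_eventuallyEq hnear).fderiv h) k
    rw [h2]
    have h3 : fderiv ℝ g x h = rightMul lam (trivDeriv ψ x h) (g x) :=
      DFunLike.congr_fun (hasFDerivAt_coords_comp hgx).fderiv h
    simp [h3]
    rw [add_comm]
  have hsymm := (hψ.isSymmSndFDerivAt (by simp)).eq h k
  rw [hsnd, hsnd] at hsymm
  have hc := DFunLike.congr_fun (rightMul_commutator lam (trivDeriv ψ x h) (trivDeriv ψ x k)) (g x)
  simp only [sub_apply, ContinuousLinearMap.comp_apply] at hc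
  have hp : normForm lam (g x) = 1 := normForm_coords _
  rw [← leftDiv_rightMul hp (fderiv ℝ (trivDeriv ψ) x h k - fderiv ℝ (trivDeriv ψ) x k h),
    ← leftDiv_rightMul hp (-bracket lam (trivDeriv ψ x h) (trivDeriv ψ x k))]
  congr 1
  rw [map_neg, neg_apply, hc, map_sub, sub_apply]
  linear_combination hsymm

end Maps

/-- A one-form on `H¹_lam`, regarded through the left-invariant frame as a function with values in
the linear forms on `ℝ × ℂ`. -/
def frame {lam : ℝ} {V : Type} [TopologicalSpace V] [AddCommGroup V] [Module ℝ V]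
    (θ : OneForm lam V) (p : HGroup lam) : ℝ × ℂ →L[ℝ] V := θ p

/-- The exterior derivative in the left-invariant frame:
`dθ(u, v) = u(θ(v)) - v(θ(u)) - θ([u, v])`. -/
theorem extD_eq {lam : ℝ} {V : Type} [NormedAddCommGroup V] [NormedSpace ℝ V] {θ : OneForm lam V}
    {p : HGroup lam} {L : ℝ × ℂ →L[ℝ] ℝ × ℂ →L[ℝ] V}
    (h : HasMFDerivAt 𝓘(ℝ, ℝ × ℂ) 𝓘(ℝ, ℝ × ℂ →L[ℝ] V) (frame θ) p L) (u v : ℝ × ℂ) :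
    extD θ p u v = L u v - L v u - frame θ p (bracket lam u v) := by
  set ψ : ℝ × ℂ → HGroup lam := ⇑(chartAt (ℝ × ℂ) p).symm with hψ
  have e0 : chartAt (ℝ × ℂ) p p = 0 := HGroup.chartOf_self p
  have hψx (x : ℝ × ℂ) : ψ x = p * HGroup.param x := HGroup.chartOf_symm_apply p x
  have hψ0 : ψ 0 = p := by rw [hψx, HGroup.param_zero, mul_one]
  have hopen : IsOpen {x : ℝ × ℂ | 0 < HGroup.disc lam x} :=
    isOpen_lt continuous_const HGroup.continuous_disc
  have h0 : (0 : ℝ × ℂ) ∈ {x : ℝ × ℂ | 0 < HGroup.disc lam x} := by simp [HGroup.disc]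
  have hsm : ContDiffAt ℝ 2 (fun x => coords (ψ x)) 0 := by
    have h1 := (HGroup.contDiffOn_param_z₁ (lam := lam) 2).contDiffAt (hopen.mem_nhds h0)
    have h2 := (HGroup.contDiffOn_param_z₂ (lam := lam) 2).contDiffAt (hopen.mem_nhds h0)
    simp only [hψx, coords, HGroup.mul_z₁, HGroup.mul_z₂]
    fun_prop
  have hM0 : trivDeriv ψ 0 = ContinuousLinearMap.id ℝ (ℝ × ℂ) := by
    have h1 : HasFDerivAt (fun x => leftDiv lam (coords p) (coords (ψ x))) (trivDeriv ψ 0) 0 := by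
      have := (leftDiv lam (coords p)).hasFDerivAt.comp (0 : ℝ × ℂ)
        (hsm.differentiableAt (by norm_num)).hasFDerivAt
      rw [trivDeriv, hψ0]
      exact this
    refine h1.unique ((hasFDerivAt_id (𝕜 := ℝ) (0 : ℝ × ℂ)).congr_of_eventuallyEq ?_)
    have ht : (chartAt (ℝ × ℂ) p).target ∈ 𝓝 (0 : ℝ × ℂ) := by
      rw [← e0]; exact chart_target_mem_nhds _ _
    filter_upwards [ht] with x hx
    rw [← chartOf_eq_leftDiv]
    exact (chartAt (ℝ × ℂ) p).right_inv hx
  have hnear : chartForm θ p =ᶠ[𝓝 0] fun x => (frame θ (ψ x)).comp (trivDeriv ψ x) := by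
    filter_upwards [hsm.eventually (by simp)] with x hx
    have := (hasMFDerivAt_trivDeriv (hx.differentiableAt (by norm_num))).mfderiv
    exact congrArg (fun T : ℝ × ℂ →L[ℝ] ℝ × ℂ => (frame θ (ψ x)).comp T) this
  have hM : DifferentiableAt ℝ (trivDeriv ψ) 0 :=
    (contDiffAt_trivDeriv (m := 1) (by norm_num) hsm).differentiableAt (by norm_num)
  have hθ : HasFDerivAt (fun x => frame θ (ψ x)) (L.comp (trivDeriv ψ 0)) 0 := by
    have h1 := hasMFDerivAt_trivDeriv (hsm.differentiableAt (by norm_num))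
    rw [← hψ0] at h
    exact (HasMFDerivAt.comp (0 : ℝ × ℂ) h h1).hasFDerivAt
  have hd := ((hθ.clm_comp hM.hasFDerivAt).congr_of_eventuallyEq hnear).fderiv
  have hs := fderiv_trivDeriv_sub hsm u v
  rw [hM0] at hs
  have hs' := congrArg (frame θ p) hs
  simp only [ContinuousLinearMap.id_apply, map_sub, map_neg] at hs'
  have hval (u v : ℝ × ℂ) : fderiv ℝ (chartForm θ p) 0 u v
      = frame θ p (fderiv ℝ (trivDeriv ψ) 0 u v) + L u v := by
    rw [hd, hM0, hψ0]
    simp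
  have : extD θ p u v = fderiv ℝ (chartForm θ p) 0 u v - fderiv ℝ (chartForm θ p) 0 v u := by
    change fderiv ℝ (chartForm θ p) (chartAt (ℝ × ℂ) p p) u v
      - fderiv ℝ (chartForm θ p) (chartAt (ℝ × ℂ) p p) v u = _
    rw [e0]
  rw [this, hval, hval]
  linear_combination (norm := module) hs'

/-! ### The Lie algebra in coordinates -/

/-- The matrix `x t₀ + (Re w) t₁ + (Im w) t₂` with coordinates `(x, w)`. -/
noncomputable def lieMat (lam : ℝ) : ℝ × ℂ →ₗ[ℝ] Matrix (Fin 2) (Fin 2) ℂ where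
  toFun ξ := ξ.1 • gen lam 0 + ξ.2.re • gen lam 1 + ξ.2.im • gen lam 2
  map_add' ξ η := by
    simp only [Prod.fst_add, Prod.snd_add, Complex.add_re, Complex.add_im, add_smul]
    abel
  map_smul' c ξ := by
    simp [mul_smul]

theorem lieMat_apply (lam : ℝ) (ξ : ℝ × ℂ) :
    lieMat lam ξ = ξ.1 • gen lam 0 + ξ.2.re • gen lam 1 + ξ.2.im • gen lam 2 := rfl

theorem lieMat_eq (lam : ℝ) (ξ : ℝ × ℂ) :
    lieMat lam ξ = !![-(I / 2) * ξ.1, lam * (I / 2 * conj ξ.2); -(I / 2) * ξ.2, I / 2 * ξ.1] := by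
  rw [lieMat_apply]
  ext i j
  fin_cases i <;> fin_cases j <;> apply Complex.ext <;> simp [gen] <;> ring

theorem lieMat_injective (lam : ℝ) : Function.Injective (lieMat lam) := by
  intro ξ η h
  rw [lieMat_eq, lieMat_eq] at h
  have h0 := congrFun (congrFun h 0) 0
  have h1 := congrFun (congrFun h 1) 0
  have hI : (-(I / 2)) ≠ 0 := by simp
  ext1
  · exact_mod_cast mul_left_cancel₀ hI h0
  · exact mul_left_cancel₀ hI h1

theorem lieMat_commutator (lam : ℝ) (ξ η : ℝ × ℂ) :
    lieMat lam ξ * lieMat lam η - lieMat lam η * lieMat lam ξ = lieMat lam (bracket lam ξ η) := by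
  obtain ⟨h1, h2, h3⟩ := gen_comm lam
  have e1 : (bracket lam ξ η).1 = (ξ.2.re * η.2.im - ξ.2.im * η.2.re) * (-lam) := by
    simp [bracket]; ring
  have e2 : (bracket lam ξ η).2.re = -(ξ.1 * η.2.im - η.1 * ξ.2.im) := by simp [bracket]
  have e3 : (bracket lam ξ η).2.im = ξ.1 * η.2.re - η.1 * ξ.2.re := by simp [bracket]
  rw [lieMat_apply lam (bracket lam ξ η), e1, e2, e3]
  simp only [lieMat_apply, add_mul, mul_add, smul_mul_smul_comm]
  linear_combination (norm := module) (ξ.1 * η.2.re - η.1 * ξ.2.re) • h1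
    + (ξ.1 * η.2.im - η.1 * ξ.2.im) • h2 + (ξ.2.re * η.2.im - ξ.2.im * η.2.re) • h3

/-- The matrix entry `(i, j)` as a functional of the coordinates in the Lie algebra. -/
noncomputable def lieEntry (lam : ℝ) (i j : Fin 2) : ℝ × ℂ →L[ℝ] ℂ :=
  LinearMap.toContinuousLinearMap
    ((Matrix.entryLinearMap ℝ ℂ i j).comp (lieMat lam))

theorem lieEntry_apply (lam : ℝ) (i j : Fin 2) (ξ : ℝ × ℂ) :
    lieEntry lam i j ξ = lieMat lam ξ i j := rfl

/-! ### Flatness in the left-invariant frame -/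

/-- Expansion of a linear map in the real basis `(1, 0), (0, 1), (0, i)`. -/
theorem map_eq_frame_sum {V : Type*} [AddCommGroup V] [Module ℝ V] (T : ℝ × ℂ →ₗ[ℝ] V)
    (v : ℝ × ℂ) : T v = v.1 • T (1, 0) + v.2.re • T (0, 1) + v.2.im • T (0, I) := by
  have hv : v = v.1 • ((1, 0) : ℝ × ℂ) + v.2.re • ((0, 1) : ℝ × ℂ) + v.2.im • ((0, I) : ℝ × ℂ) := by
    ext1
    · simp
    · apply Complex.ext <;> simp
  conv_lhs => rw [hv]
  simp only [map_add, map_smul]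

section Frame

variable {lam : ℝ} {V : Type} [NormedAddCommGroup V] [NormedSpace ℝ V]

theorem frame_eq (θ : OneForm lam V) (p : HGroup lam) :
    frame θ p = (ContinuousLinearMap.fst ℝ ℝ ℂ).smulRight (θ p (X 0 p))
      + (Complex.reCLM.comp (ContinuousLinearMap.snd ℝ ℝ ℂ)).smulRight (θ p (X 1 p))
      + (Complex.imCLM.comp (ContinuousLinearMap.snd ℝ ℝ ℂ)).smulRight (θ p (X 2 p)) :=
  ContinuousLinearMap.ext fun v => map_eq_frame_sum (frame θ p : ℝ × ℂ →ₗ[ℝ] V) v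

theorem isSmoothForm_iff {θ : OneForm lam V} :
    IsSmoothForm θ ↔ ContMDiff 𝓘(ℝ, ℝ × ℂ) 𝓘(ℝ, ℝ × ℂ →L[ℝ] V) ∞ (frame θ) := by
  constructor
  · intro h
    have hs (c : ℝ × ℂ →L[ℝ] ℝ) (a : Fin 3) : ContMDiff 𝓘(ℝ, ℝ × ℂ) 𝓘(ℝ, ℝ × ℂ →L[ℝ] V) ∞
        fun p => c.smulRight (θ p (X a p)) :=
      (ContinuousLinearMap.smulRightL ℝ (ℝ × ℂ) V c).contDiff.comp_contMDiff (h a)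
    exact (((hs _ 0).add (hs _ 1)).add (hs _ 2)).congr fun p => frame_eq θ p
  · intro h a
    exact (ContinuousLinearMap.apply ℝ V ((![(1, 0), (0, 1), (0, I)] : Fin 3 → ℝ × ℂ) a)
      ).contDiff.comp_contMDiff h

end Frame

section Potential

variable {lam₀ : ℝ}

/-- The connection `(A + σ⁰) t₀ + Re(Φ σ) t₁ + Im(Φ σ) t₂` in the left-invariant frame, with
values in the coordinates of the Lie algebra. -/
noncomputable def potentialFrame (Φ : HGroup lam₀ → ℂ) (A : OneForm lam₀ ℝ) (q : HGroup lam₀) :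
    ℝ × ℂ →L[ℝ] ℝ × ℂ :=
  (frame A q + ContinuousLinearMap.fst ℝ ℝ ℂ).prod (Φ q • ContinuousLinearMap.snd ℝ ℝ ℂ)

theorem potentialFrame_apply (Φ : HGroup lam₀ → ℂ) (A : OneForm lam₀ ℝ) (q : HGroup lam₀)
    (v : ℝ × ℂ) : potentialFrame Φ A q v = (frame A q v + v.1, Φ q * v.2) := rfl

theorem vortexPotential_coe (lam : ℝ) (Φ : HGroup lam₀ → ℂ) (A : OneForm lam₀ ℝ) (q : HGroup lam₀)
    (v : ℝ × ℂ) : (vortexPotential lam Φ A q v : Matrix (Fin 2) (Fin 2) ℂ)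
      = lieMat lam (potentialFrame Φ A q v) := by
  have h : (vortexPotential lam Φ A q v : Matrix (Fin 2) (Fin 2) ℂ)
      = (A q v + sigma₀ q v) • gen lam 0
      + (Φ q * sigma q v).re • gen lam 1 + (Φ q * sigma q v).im • gen lam 2 := rfl
  have h0 : sigma₀ q v = v.1 := sigma₀_coords q v.1 v.2
  have h1 : sigma q v = v.2 := sigma_coords q v.1 v.2
  rw [h, h0, h1]
  rfl

theorem frame_entry (lam : ℝ) (Φ : HGroup lam₀ → ℂ) (A : OneForm lam₀ ℝ) (i j : Fin 2)
    (q : HGroup lam₀) : frame (entry (vortexPotential lam Φ A) i j) q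
      = (lieEntry lam i j).comp (potentialFrame Φ A q) := by
  refine ContinuousLinearMap.ext fun v => ?_
  exact congrFun (congrFun (vortexPotential_coe lam Φ A q v) i) j

theorem contMDiff_potentialFrame {Φ : HGroup lam₀ → ℂ} {A : OneForm lam₀ ℝ}
    (hΦ : ContMDiff 𝓘(ℝ, ℝ × ℂ) 𝓘(ℝ, ℂ) ∞ Φ) (hA : IsSmoothForm A) :
    ContMDiff 𝓘(ℝ, ℝ × ℂ) 𝓘(ℝ, ℝ × ℂ →L[ℝ] ℝ × ℂ) ∞ (potentialFrame Φ A) := by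
  have hA' := isSmoothForm_iff.1 hA
  have h1 : ContMDiff 𝓘(ℝ, ℝ × ℂ) 𝓘(ℝ, ℝ × ℂ →L[ℝ] ℝ × ℂ) ∞ fun q =>
      (ContinuousLinearMap.inl ℝ ℝ ℂ).comp (frame A q) :=
    (ContinuousLinearMap.compL ℝ (ℝ × ℂ) ℝ (ℝ × ℂ) (ContinuousLinearMap.inl ℝ ℝ ℂ)
      ).contDiff.comp_contMDiff hA'
  let T : ℂ →L[ℝ] (ℝ × ℂ →L[ℝ] ℝ × ℂ) := IsBilinearMap.toContinuousBilinearMap (𝕜 := ℝ)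
    (f := fun (c : ℂ) (v : ℝ × ℂ) => ((0, c * v.2) : ℝ × ℂ))
    { add_left := by intros; ext1 <;> simp; ring
      smul_left := by intros; ext1 <;> simp; ring
      add_right := by intros; ext1 <;> simp; ring
      smul_right := by intros; ext1 <;> simp; ring }
  have h2 : ContMDiff 𝓘(ℝ, ℝ × ℂ) 𝓘(ℝ, ℝ × ℂ →L[ℝ] ℝ × ℂ) ∞ fun q => T (Φ q) :=
    T.contDiff.comp_contMDiff hΦ
  have h3 : ContMDiff 𝓘(ℝ, ℝ × ℂ) 𝓘(ℝ, ℝ × ℂ →L[ℝ] ℝ × ℂ) ∞ fun _ : HGroup lam₀ =>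
      (ContinuousLinearMap.inl ℝ ℝ ℂ).comp (ContinuousLinearMap.fst ℝ ℝ ℂ) := contMDiff_const
  refine ((h1.add h3).add h2).congr fun q => ContinuousLinearMap.ext fun v => ?_
  ext1
  · change frame A q v + v.1 = frame A q v + v.1 + 0
    ring
  · change Φ q * v.2 = 0 + 0 + Φ q * v.2
    ring

/-- `Φ` is `2i` times the lower left entry of the connection on `X₁`, and `A` is recovered from the
upper left entry. -/
theorem smooth_of_smooth_entries {lam : ℝ} {Φ : HGroup lam₀ → ℂ} {A : OneForm lam₀ ℝ}
    (h : ∀ i j, IsSmoothForm (entry (vortexPotential lam Φ A) i j)) :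
    ContMDiff 𝓘(ℝ, ℝ × ℂ) 𝓘(ℝ, ℂ) ∞ Φ ∧ IsSmoothForm A := by
  have he (i j : Fin 2) (v : ℝ × ℂ) : ContMDiff 𝓘(ℝ, ℝ × ℂ) 𝓘(ℝ, ℂ) ∞
      fun q => lieMat lam (potentialFrame Φ A q v) i j := by
    have h1 := (ContinuousLinearMap.apply ℝ ℂ v).contDiff.comp_contMDiff
      (isSmoothForm_iff.1 (h i j))
    exact h1.congr fun q => (DFunLike.congr_fun (frame_entry lam Φ A i j q) v).symm
  constructor
  · have h1 : ContDiff ℝ ∞ fun c : ℂ => 2 * I * c := by fun_prop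
    refine (h1.comp_contMDiff (he 1 0 (0, 1))).congr fun q => ?_
    simp [lieMat_eq, potentialFrame_apply]
    linear_combination Φ q * Complex.I_sq
  · intro a
    set v : ℝ × ℂ := (![(1, 0), (0, 1), (0, I)] : Fin 3 → ℝ × ℂ) a with hv
    have h1 : ContDiff ℝ ∞ fun c : ℂ => (2 * I * c).re - v.1 :=
      (Complex.reCLM.contDiff.comp (by fun_prop : ContDiff ℝ ∞ fun c : ℂ => 2 * I * c)).sub
        contDiff_const
    refine (h1.comp_contMDiff (he 0 0 v)).congr fun q => ?_
    change frame A q v = _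
    simp [lieMat_eq, potentialFrame_apply]

/-- Flatness `dΘ(u, v) + [Θ(u), Θ(v)] = 0` of a connection with components `Θ` in the left-invariant
frame. The derivative of `Θ` is quantified over, so that the condition is empty where `Θ` is not
differentiable; it is used for smooth `Θ` only. -/
def IsFlatFrame (lam₀ lam : ℝ) (Θ : HGroup lam₀ → ℝ × ℂ →L[ℝ] ℝ × ℂ) : Prop :=
  ∀ (p : HGroup lam₀) (L : ℝ × ℂ →L[ℝ] ℝ × ℂ →L[ℝ] ℝ × ℂ),
    HasMFDerivAt 𝓘(ℝ, ℝ × ℂ) 𝓘(ℝ, ℝ × ℂ →L[ℝ] ℝ × ℂ) Θ p L → ∀ u v,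
    L u v - L v u - Θ p (bracket lam₀ u v) + bracket lam (Θ p u) (Θ p v) = 0

theorem exists_hasMFDerivAt_of_contMDiff {W : Type*} [NormedAddCommGroup W] [NormedSpace ℝ W]
    {f : HGroup lam₀ → W} (hf : ContMDiff 𝓘(ℝ, ℝ × ℂ) 𝓘(ℝ, W) ∞ f) (p : HGroup lam₀) :
    ∃ L : ℝ × ℂ →L[ℝ] W, HasMFDerivAt 𝓘(ℝ, ℝ × ℂ) 𝓘(ℝ, W) f p L :=
  ⟨mfderiv 𝓘(ℝ, ℝ × ℂ) 𝓘(ℝ, W) f p, ((hf p).mdifferentiableAt (by simp)).hasMFDerivAt⟩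

theorem isFlatConnection_iff_isFlatFrame {lam : ℝ} {Φ : HGroup lam₀ → ℂ} {A : OneForm lam₀ ℝ}
    (hΦ : ContMDiff 𝓘(ℝ, ℝ × ℂ) 𝓘(ℝ, ℂ) ∞ Φ) (hA : IsSmoothForm A) :
    IsFlatConnection (vortexPotential lam Φ A) ↔ IsFlatFrame lam₀ lam (potentialFrame Φ A) := by
  have hpf := contMDiff_potentialFrame hΦ hA
  have key (p : HGroup lam₀) (L : ℝ × ℂ →L[ℝ] ℝ × ℂ →L[ℝ] ℝ × ℂ)
      (hL : HasMFDerivAt 𝓘(ℝ, ℝ × ℂ) 𝓘(ℝ, ℝ × ℂ →L[ℝ] ℝ × ℂ) (potentialFrame Φ A) p L)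
      (u v : ℝ × ℂ) :
      (Matrix.of fun i j => extD (entry (vortexPotential lam Φ A) i j) p u v)
        + ((vortexPotential lam Φ A p u).1 * (vortexPotential lam Φ A p v).1
          - (vortexPotential lam Φ A p v).1 * (vortexPotential lam Φ A p u).1)
      = lieMat lam (L u v - L v u - potentialFrame Φ A p (bracket lam₀ u v)
          + bracket lam (potentialFrame Φ A p u) (potentialFrame Φ A p v)) := by
    have hE (i j : Fin 2) : extD (entry (vortexPotential lam Φ A) i j) p u v
        = lieMat lam (L u v - L v u - potentialFrame Φ A p (bracket lam₀ u v)) i j := by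
      have h1 := HasMFDerivAt.comp p (ContinuousLinearMap.compL ℝ (ℝ × ℂ) (ℝ × ℂ) ℂ
        (lieEntry lam i j)).hasMFDerivAt hL
      have h2 : HasMFDerivAt 𝓘(ℝ, ℝ × ℂ) 𝓘(ℝ, ℝ × ℂ →L[ℝ] ℂ)
          (frame (entry (vortexPotential lam Φ A) i j)) p
          ((ContinuousLinearMap.compL ℝ (ℝ × ℂ) (ℝ × ℂ) ℂ (lieEntry lam i j)).comp L) :=
        h1.congr_of_eventuallyEq
          (Filter.Eventually.of_forall fun q => frame_entry lam Φ A i j q)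
      rw [extD_eq h2, frame_entry, ← lieEntry_apply, map_sub, map_sub]
      rfl
    have e1 : (Matrix.of fun i j => extD (entry (vortexPotential lam Φ A) i j) p u v)
        = lieMat lam (L u v - L v u - potentialFrame Φ A p (bracket lam₀ u v)) := by
      ext i j
      exact hE i j
    rw [e1, map_add, ← lieMat_commutator]
    congr 3 <;> exact vortexPotential_coe lam Φ A p _
  constructor
  · intro h p L hL u v
    apply lieMat_injective lam
    rw [← key p L hL, map_zero]
    exact h.flat p u v
  · intro h
    refine ⟨fun i j => ?_, fun p u v => ?_⟩
    · rw [isSmoothForm_iff]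
      refine ((ContinuousLinearMap.compL ℝ (ℝ × ℂ) (ℝ × ℂ) ℂ (lieEntry lam i j)
        ).contDiff.comp_contMDiff hpf).congr fun q => frame_entry lam Φ A i j q
    · obtain ⟨L, hL⟩ := exists_hasMFDerivAt_of_contMDiff hpf p
      refine (key p L hL u v).trans ?_
      rw [h p L hL u v, map_zero]

end Potential

/-! ### Vortex configurations and flat connections -/

section Correspondence

variable {lam₀ lam : ℝ}

theorem sigma_apply (q : HGroup lam₀) (v : ℝ × ℂ) : sigma q v = v.2 := sigma_coords q v.1 v.2

theorem sigma₀_apply (q : HGroup lam₀) (v : ℝ × ℂ) : sigma₀ q v = v.1 := sigma₀_coords q v.1 v.2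

/-- The derivative of the connection in the left-invariant frame, in terms of the derivatives of
its ingredients. -/
theorem hasMFDerivAt_potentialFrame_apply {Φ : HGroup lam₀ → ℂ} {A : OneForm lam₀ ℝ}
    {p : HGroup lam₀} {L : ℝ × ℂ →L[ℝ] ℝ × ℂ →L[ℝ] ℝ × ℂ} {LΦ : ℝ × ℂ →L[ℝ] ℂ}
    {LA : ℝ × ℂ →L[ℝ] ℝ × ℂ →L[ℝ] ℝ}
    (hL : HasMFDerivAt 𝓘(ℝ, ℝ × ℂ) 𝓘(ℝ, ℝ × ℂ →L[ℝ] ℝ × ℂ) (potentialFrame Φ A) p L)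
    (hΦ : HasMFDerivAt 𝓘(ℝ, ℝ × ℂ) 𝓘(ℝ, ℂ) Φ p LΦ)
    (hA : HasMFDerivAt 𝓘(ℝ, ℝ × ℂ) 𝓘(ℝ, ℝ × ℂ →L[ℝ] ℝ) (frame A) p LA) (u v : ℝ × ℂ) :
    L u v = (LA u v, LΦ u * v.2) := by
  have h1 : HasMFDerivAt 𝓘(ℝ, ℝ × ℂ) 𝓘(ℝ, ℝ × ℂ) (fun q => potentialFrame Φ A q v) p
      ((ContinuousLinearMap.apply ℝ (ℝ × ℂ) v).comp L) :=
    HasMFDerivAt.comp p (ContinuousLinearMap.apply ℝ (ℝ × ℂ) v).hasMFDerivAt hL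
  have h2 : HasFDerivAt (fun a : ℝ => a + v.1) (ContinuousLinearMap.id ℝ ℝ) (frame A p v) :=
    (hasFDerivAt_id _).add_const _
  have h3 : HasMFDerivAt 𝓘(ℝ, ℝ × ℂ) 𝓘(ℝ, ℝ) (fun q => frame A q v + v.1) p
      ((ContinuousLinearMap.id ℝ ℝ).comp ((ContinuousLinearMap.apply ℝ ℝ v).comp LA)) :=
    HasMFDerivAt.comp p h2.hasMFDerivAt
      (HasMFDerivAt.comp p (ContinuousLinearMap.apply ℝ ℝ v).hasMFDerivAt hA)
  have h4 : HasMFDerivAt 𝓘(ℝ, ℝ × ℂ) 𝓘(ℝ, ℂ) (fun q => Φ q * v.2) p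
      (((ContinuousLinearMap.mul ℝ ℂ).flip v.2).comp LΦ) :=
    HasMFDerivAt.comp p ((ContinuousLinearMap.mul ℝ ℂ).flip v.2).hasMFDerivAt hΦ
  have h5 : HasMFDerivAt 𝓘(ℝ, ℝ × ℂ) 𝓘(ℝ, ℝ × ℂ) (fun q => potentialFrame Φ A q v) p
      (((ContinuousLinearMap.id ℝ ℝ).comp ((ContinuousLinearMap.apply ℝ ℝ v).comp LA)).prod
        (((ContinuousLinearMap.mul ℝ ℂ).flip v.2).comp LΦ)) :=
    ⟨h3.1.prodMk h4.1, h3.2.prodMk h4.2⟩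
  exact DFunLike.congr_fun (hasMFDerivAt_unique h1 h5) u

/-- The two components of the curvature of the connection `(A + σ⁰) t₀ + …` are the two vortex
equations. -/
theorem isFlatFrame_potentialFrame_iff {Φ : HGroup lam₀ → ℂ} {A : OneForm lam₀ ℝ}
    (hΦ : ContMDiff 𝓘(ℝ, ℝ × ℂ) 𝓘(ℝ, ℂ) ∞ Φ) (hA : IsSmoothForm A) :
    IsFlatFrame lam₀ lam (potentialFrame Φ A) ↔ IsVortexConfiguration lam₀ lam Φ A := by
  have key (p : HGroup lam₀) (L : ℝ × ℂ →L[ℝ] ℝ × ℂ →L[ℝ] ℝ × ℂ)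
      (hL : HasMFDerivAt 𝓘(ℝ, ℝ × ℂ) 𝓘(ℝ, ℝ × ℂ →L[ℝ] ℝ × ℂ) (potentialFrame Φ A) p L)
      (u v : ℝ × ℂ) :
      (L u v - L v u - potentialFrame Φ A p (bracket lam₀ u v)
          + bracket lam (potentialFrame Φ A p u) (potentialFrame Φ A p v) = 0 ↔
        (wedge (fun q => dFun Φ q + (I * Φ q) • Complex.ofRealCLM.comp (A q)) sigma p u v = 0 ∧
        ((extD A p u v : ℝ) : ℂ)
          = I / 2 * (lam₀ - lam * ‖Φ p‖ ^ 2 : ℝ) * wedge sigmaBar sigma p u v)) := by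
    obtain ⟨LΦ, hLΦ⟩ := exists_hasMFDerivAt_of_contMDiff hΦ p
    obtain ⟨LA, hLA⟩ := exists_hasMFDerivAt_of_contMDiff (isSmoothForm_iff.1 hA) p
    have hd : dFun Φ p = LΦ := hLΦ.mfderiv
    have w1 : wedge (fun q => dFun Φ q + (I * Φ q) • Complex.ofRealCLM.comp (A q)) sigma p u v
        = (LΦ u + I * Φ p * frame A p u) * v.2 - (LΦ v + I * Φ p * frame A p v) * u.2 := by
      change (dFun Φ p u + I * Φ p * A p u) * sigma p v - (dFun Φ p v + I * Φ p * A p v) * sigma p u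
        = _
      rw [sigma_apply, sigma_apply, hd]
      rfl
    have w2 : wedge sigmaBar sigma p u v = 2 * I * (conj u.2 * v.2).im := by
      change conj (sigma p u) * sigma p v - conj (sigma p v) * sigma p u = _
      rw [sigma_apply, sigma_apply]
      apply Complex.ext <;> simp <;> ring
    have hn : (‖Φ p‖ : ℝ) ^ 2 = (Φ p).re ^ 2 + (Φ p).im ^ 2 := by
      rw [Complex.sq_norm, Complex.normSq_apply]; ring
    have w3 : I / 2 * (lam₀ - lam * ‖Φ p‖ ^ 2 : ℝ) * wedge sigmaBar sigma p u v
        = ((-(lam₀ - lam * ‖Φ p‖ ^ 2) * (conj u.2 * v.2).im : ℝ) : ℂ) := by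
      rw [w2]
      push_cast
      linear_combination (lam₀ - lam * (‖Φ p‖ : ℂ) ^ 2) * ((conj u.2 * v.2).im : ℂ) * Complex.I_sq
    rw [w1, w3, Complex.ofReal_inj, extD_eq hLA,
      hasMFDerivAt_potentialFrame_apply hL hLΦ hLA, hasMFDerivAt_potentialFrame_apply hL hLΦ hLA]
    simp only [potentialFrame_apply]
    rw [Prod.ext_iff, and_comm]
    refine and_congr ?_ ?_
    · refine Eq.congr ?_ rfl
      simp [bracket]
      ring
    · refine Iff.trans (Eq.congr ?_ rfl) sub_eq_zero
      simp [bracket, hn]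
      ring
  have hpf := contMDiff_potentialFrame hΦ hA
  constructor
  · intro h
    refine ⟨hΦ, hA, fun p u v => ?_, fun p u v => ?_⟩ <;>
      obtain ⟨L, hL⟩ := exists_hasMFDerivAt_of_contMDiff hpf p
    · exact ((key p L hL u v).1 (h p L hL u v)).1
    · exact ((key p L hL u v).1 (h p L hL u v)).2
  · intro h p L hL u v
    exact (key p L hL u v).2 ⟨h.higgs p u v, h.curvature p u v⟩

theorem isVortexConfiguration_iff_isFlatConnection (Φ : HGroup lam₀ → ℂ) (A : OneForm lam₀ ℝ) :
    IsVortexConfiguration lam₀ lam Φ A ↔ IsFlatConnection (vortexPotential lam Φ A) := by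
  constructor
  · intro h
    rw [isFlatConnection_iff_isFlatFrame h.smooth_Φ h.smooth_A,
      isFlatFrame_potentialFrame_iff h.smooth_Φ h.smooth_A]
    exact h
  · intro h
    obtain ⟨hΦ, hA⟩ := smooth_of_smooth_entries h.smooth
    rwa [isFlatConnection_iff_isFlatFrame hΦ hA, isFlatFrame_potentialFrame_iff hΦ hA] at h

/-- The real coordinate functionals of the Lie algebra dual to `t₀, t₁, t₂`. -/
noncomputable def lieCoord (lam : ℝ) : Fin 3 → lieH lam →L[ℝ] ℝ
  | 0 => Complex.reCLM.comp ((2 * I) • entryCLM lam 0 0)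
  | 1 => Complex.reCLM.comp ((2 * I) • entryCLM lam 1 0)
  | 2 => Complex.imCLM.comp ((2 * I) • entryCLM lam 1 0)

theorem lieCoord_lieGen (a b : Fin 3) : lieCoord lam a (lieGen lam b) = if a = b then 1 else 0 := by
  have e (i j : Fin 2) : entryCLM lam i j (lieGen lam b) = gen lam b i j := rfl
  fin_cases a <;> simp only [lieCoord, ContinuousLinearMap.comp_apply, smul_apply, e] <;>
    fin_cases b <;> simp [gen]

/-- The generators span the Lie algebra by definition, so `lieCoord` are the coordinates for them. -/
theorem sum_lieCoord (B : lieH lam) : B = ∑ a, lieCoord lam a B • lieGen lam a := by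
  have h : B ∈ (⊤ : Submodule ℝ (lieH lam)) := trivial
  have ht : (⊤ : Submodule ℝ (lieH lam)) = Submodule.span ℝ (Set.range (lieGen lam)) := by
    rw [eq_comm, ← Submodule.map_injective_of_injective (lieH lam).injective_subtype |>.eq_iff,
      Submodule.map_span, ← Set.range_comp, Submodule.map_top, Submodule.range_subtype]
    rfl
  rw [ht] at h
  induction h using Submodule.span_induction with
  | mem x hx =>
    obtain ⟨b, rfl⟩ := hx
    simp [lieCoord_lieGen]
  | zero => simp
  | add x y _ _ hx hy =>
    conv_lhs => rw [hx, hy]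
    simp only [map_add, add_smul, Finset.sum_add_distrib]
  | smul c x _ hx =>
    conv_lhs => rw [hx]
    simp only [map_smul, smul_assoc, Finset.smul_sum]

/-- The complex-linear extension of a real functional, as a real-linear map. -/
noncomputable def complexCoord (φ : lieH lam →ₗ[ℝ] ℝ) : LieHC lam →ₗ[ℝ] ℂ :=
  TensorProduct.lift (LinearMap.mk₂ ℝ (fun (z : ℂ) (B : lieH lam) => z * (φ B : ℂ))
    (by intros; ring) (by intros; simp; ring) (by intros; simp; ring) (by intros; simp; ring))

theorem complexCoord_tmul (φ : lieH lam →ₗ[ℝ] ℝ) (z : ℂ) (B : lieH lam) :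
    complexCoord φ (z ⊗ₜ[ℝ] B) = z * φ B := rfl

/-- A connection with `𝒜(X₀) = p t₀` and `𝒜(X₋) = α t₀ + Φ t₋` is determined by its `t₀` component:
comparing the real and imaginary parts of the `t₁` and `t₂` components of `𝒜(X₋)` gives the values
of the connection on `X₁` and `X₂`. -/
theorem eq_vortexPotential {𝒜 : Connection lam₀ lam} {p : HGroup lam₀ → ℝ} {α Φ : HGroup lam₀ → ℂ}
    (h0 : ∀ q, 𝒜 q (X 0 q) = p q • lieGen lam 0)
    (hm : ∀ q, complexify (𝒜 q) (XMinus q) = α q • tZero lam + Φ q • tMinus lam) :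
    𝒜 = vortexPotential lam Φ (fun q => (lieCoord lam 0).comp (𝒜 q) - sigma₀ q) := by
  funext q
  have c (a : Fin 3) : ((lieCoord lam a (𝒜 q (X 1 q)) : ℝ) : ℂ)
      - I * (lieCoord lam a (𝒜 q (X 2 q)) : ℝ)
      = α q * (lieCoord lam a (lieGen lam 0) : ℝ) + (Φ q * (lieCoord lam a (lieGen lam 1) : ℝ)
        - Φ q * I * (lieCoord lam a (lieGen lam 2) : ℝ)) := by
    have h1 := congrArg (complexCoord (lieCoord lam a : lieH lam →ₗ[ℝ] ℝ)) (hm q)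
    have h2 : complexify (𝒜 q) (XMinus q)
        = (1 : ℂ) ⊗ₜ[ℝ] 𝒜 q (X 1 q) - I ⊗ₜ[ℝ] 𝒜 q (X 2 q) := by
      simp [complexify, XMinus]
    rw [h2] at h1
    simpa [tZero, tMinus, smul_sub, TensorProduct.smul_tmul', complexCoord_tmul] using h1
  have c1 := c 1
  have c2 := c 2
  simp only [lieCoord_lieGen] at c1 c2
  have d1 := congrArg Complex.re c1
  have d2 := congrArg Complex.im c1
  have d3 := congrArg Complex.re c2
  have d4 := congrArg Complex.im c2
  simp at d1 d2 d3 d4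
  have hf (v : ℝ × ℂ) : 𝒜 q v
      = v.1 • 𝒜 q (X 0 q) + v.2.re • 𝒜 q (X 1 q) + v.2.im • 𝒜 q (X 2 q) :=
    map_eq_frame_sum (frame 𝒜 q : ℝ × ℂ →ₗ[ℝ] lieH lam) v
  refine ContinuousLinearMap.ext fun v => ?_
  have hv : vortexPotential lam Φ (fun q => (lieCoord lam 0).comp (𝒜 q) - sigma₀ q) q v
      = (lieCoord lam 0 (𝒜 q v) - sigma₀ q v + sigma₀ q v) • lieGen lam 0
      + (Φ q * sigma q v).re • lieGen lam 1 + (Φ q * sigma q v).im • lieGen lam 2 := rfl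
  have e1 : lieCoord lam 1 (𝒜 q v) = (Φ q * sigma q v).re := by
    rw [hf v, sigma_apply q v, h0]
    simp [lieCoord_lieGen, d1]
    linear_combination -v.2.im * d2
  have e2 : lieCoord lam 2 (𝒜 q v) = (Φ q * sigma q v).im := by
    rw [hf v, sigma_apply q v, h0]
    simp [lieCoord_lieGen, d3, d4]
    ring
  rw [hv, ← e1, ← e2, sub_add_cancel]
  conv_lhs => rw [sum_lieCoord (𝒜 q v), Fin.sum_univ_three]

theorem vortexPotential_injective {Φ : HGroup lam₀ → ℂ} {A B : OneForm lam₀ ℝ}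
    (h : vortexPotential lam Φ A = vortexPotential lam Φ B) : A = B := by
  funext q
  refine ContinuousLinearMap.ext (M₁ := ℝ × ℂ) fun v => ?_
  have h1 : lieMat lam (potentialFrame Φ A q v) = lieMat lam (potentialFrame Φ B q v) := by
    rw [← vortexPotential_coe, h, vortexPotential_coe]
  exact add_right_cancel (congrArg Prod.fst (lieMat_injective lam h1))

theorem existsUnique_vortexConfiguration {𝒜 : Connection lam₀ lam} (h𝒜 : IsFlatConnection 𝒜)
    {p : HGroup lam₀ → ℝ} {α Φ : HGroup lam₀ → ℂ}
    (h0 : ∀ q, 𝒜 q (X 0 q) = p q • lieGen lam 0)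
    (hm : ∀ q, complexify (𝒜 q) (XMinus q) = α q • tZero lam + Φ q • tMinus lam) :
    ∃! A : OneForm lam₀ ℝ, 𝒜 = vortexPotential lam Φ A ∧ IsVortexConfiguration lam₀ lam Φ A := by
  have h := eq_vortexPotential h0 hm
  refine ⟨_, ⟨h, ?_⟩, fun B hB => vortexPotential_injective (hB.1.symm.trans h)⟩
  rw [isVortexConfiguration_iff_isFlatConnection, ← h]
  exact h𝒜

end Correspondence

/-! ### Trivialising flat connections along maps from vector spaces -/

/-- Multiplication of matrices `!![a, lam b̄; b, ā]`, recorded by their first columns. -/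
noncomputable def colMul (lam : ℝ) : ℂ × ℂ →L[ℝ] ℂ × ℂ →L[ℝ] ℂ × ℂ :=
  (LinearMap.mk₂ ℝ
    (fun (p q : ℂ × ℂ) =>
      ((p.1 * q.1 + lam * conj p.2 * q.2, p.2 * q.1 + conj p.1 * q.2) : ℂ × ℂ))
    (by intros; ext <;> simp <;> ring) (by intros; ext <;> simp <;> ring)
    (by intros; ext <;> simp <;> ring) (by intros; ext <;> simp <;> ring)).toContinuousBilinearMap

theorem colMul_apply (lam : ℝ) (p q : ℂ × ℂ) : colMul lam p q
    = (p.1 * q.1 + lam * conj p.2 * q.2, p.2 * q.1 + conj p.1 * q.2) := rfl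

/-- The adjugate of a matrix `!![a, lam b̄; b, ā]`, recorded by its first column. -/
noncomputable def colAdj : ℂ × ℂ →L[ℝ] ℂ × ℂ :=
  ((Complex.conjCLE : ℂ →L[ℝ] ℂ).comp (ContinuousLinearMap.fst ℝ ℂ ℂ)).prod
    (-ContinuousLinearMap.snd ℝ ℂ ℂ)

theorem colAdj_apply (p : ℂ × ℂ) : colAdj p = (conj p.1, -p.2) := rfl

theorem rightMul_colMul (lam : ℝ) (ξ : ℝ × ℂ) (c p : ℂ × ℂ) :
    rightMul lam ξ (colMul lam c p) = colMul lam c (rightMul lam ξ p) := by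
  have c2 : conj (2 : ℂ) = 2 := map_ofNat (starRingEnd ℂ) 2
  simp only [rightMul_apply, colMul_apply]
  ext1 <;> simp <;> ring

theorem normForm_colMul (lam : ℝ) (c p : ℂ × ℂ) :
    normForm lam (colMul lam c p) = normForm lam c * normForm lam p := by
  simp [colMul_apply, normForm]
  ring

theorem normForm_colAdj (lam : ℝ) (p : ℂ × ℂ) : normForm lam (colAdj p) = normForm lam p := by
  simp [colAdj_apply, normForm]

theorem colMul_colMul_colAdj {lam : ℝ} {a : ℂ × ℂ} (ha : normForm lam a = 1) (b : ℂ × ℂ) :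
    colMul lam (colMul lam b (colAdj a)) a = b := by
  have h : a.1 * conj a.1 - lam * (a.2 * conj a.2) = 1 := by
    rw [Complex.mul_conj, Complex.mul_conj, Complex.normSq_apply, Complex.normSq_apply]
    simp only [normForm] at ha
    norm_cast
    linarith
  simp only [colMul_apply, colAdj_apply, map_add, map_mul, map_neg, Complex.conj_conj,
    Complex.conj_ofReal]
  ext1
  · linear_combination b.1 * h
  · linear_combination b.2 * h

/-- The derivative of `b a⁻¹` vanishes if `a` and `b` have the same logarithmic derivative `ξ`. -/
theorem colMul_rightMul_colAdj (lam : ℝ) (ξ : ℝ × ℂ) (b a : ℂ × ℂ) :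
    colMul lam (rightMul lam ξ b) (colAdj a) + colMul lam b (colAdj (rightMul lam ξ a)) = 0 := by
  have c2 : conj (2 : ℂ) = 2 := map_ofNat (starRingEnd ℂ) 2
  simp only [rightMul_apply, colMul_apply, colAdj_apply]
  ext1 <;> simp [c2] <;> ring

section Solutions

variable {F : Type*} [NormedAddCommGroup F] [NormedSpace ℝ F] {lam : ℝ}

/-- Two solutions of `du = u B` on a connected open set differ by a left translation. -/
theorem exists_colMul_eq {B : F → F →L[ℝ] ℝ × ℂ} {S : Set F} (hS : IsOpen S)
    (hS' : IsPreconnected S) (hne : S.Nonempty) {a b : F → ℂ × ℂ}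
    (ha : ∀ x ∈ S, HasFDerivAt a (((rightMul lam).flip (a x)).comp (B x)) x)
    (hb : ∀ x ∈ S, HasFDerivAt b (((rightMul lam).flip (b x)).comp (B x)) x)
    (ha1 : ∀ x ∈ S, normForm lam (a x) = 1) (hb1 : ∀ x ∈ S, normForm lam (b x) = 1) :
    ∃ c : ℂ × ℂ, normForm lam c = 1 ∧ ∀ x ∈ S, b x = colMul lam c (a x) := by
  have hd : ∀ x ∈ S, HasFDerivAt (fun x => colMul lam (b x) (colAdj (a x)))
      (0 : F →L[ℝ] ℂ × ℂ) x := by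
    intro x hx
    have h1 := ((colMul lam).hasFDerivAt.comp x (hb x hx)).clm_apply
      (colAdj.hasFDerivAt.comp x (ha x hx))
    refine h1.congr_fderiv (ContinuousLinearMap.ext fun v => ?_)
    have := colMul_rightMul_colAdj lam (B x v) (b x) (a x)
    rw [add_comm] at this
    exact this
  obtain ⟨c, hc⟩ := hS.exists_is_const_of_fderiv_eq_zero (𝕜 := ℝ) hS'
    (fun x hx => (hd x hx).differentiableAt.differentiableWithinAt) fun x hx => (hd x hx).fderiv
  refine ⟨c, ?_, fun x hx => ?_⟩
  · obtain ⟨x, hx⟩ := hne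
    rw [← hc x hx, normForm_colMul, normForm_colAdj, ha1 x hx, hb1 x hx, one_mul]
  · rw [← hc x hx, colMul_colMul_colAdj (ha1 x hx)]

variable [FiniteDimensional ℝ F] {lam₀ : ℝ}

/-- A flat connection pulled back to a vector space is trivial. -/
theorem exists_solution_along {Θ : HGroup lam₀ → ℝ × ℂ →L[ℝ] ℝ × ℂ}
    (hΘ : ContMDiff 𝓘(ℝ, ℝ × ℂ) 𝓘(ℝ, ℝ × ℂ →L[ℝ] ℝ × ℂ) ∞ Θ) (hflat : IsFlatFrame lam₀ lam Θ)
    {ψ : F → HGroup lam₀} (hψ : ContDiff ℝ ∞ fun x => coords (ψ x)) :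
    ∃ u : F → ℂ × ℂ, ContDiff ℝ ∞ u ∧ (∀ x, normForm lam (u x) = 1) ∧
      ∀ x, HasFDerivAt u (((rightMul lam).flip (u x)).comp ((Θ (ψ x)).comp (trivDeriv ψ x))) x := by
  set P : F → F →L[ℝ] ℝ × ℂ := fun x => (Θ (ψ x)).comp (trivDeriv ψ x) with hP
  have hψ2 : ContDiff ℝ 2 fun x => coords (ψ x) := by exact_mod_cast contDiff_infty.1 hψ 2
  have hψd (x : F) : DifferentiableAt ℝ (fun x => coords (ψ x)) x :=
    hψ.differentiable (by simp) x
  have hψm : ContMDiff 𝓘(ℝ, F) 𝓘(ℝ, ℝ × ℂ) ∞ ψ := fun x =>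
    contMDiffAt_of_coords hψ.contMDiff.contMDiffAt
  have hΘψ : ContDiff ℝ ∞ fun x => Θ (ψ x) := (hΘ.comp hψm).contDiff
  have hM : ContDiff ℝ ∞ (trivDeriv ψ) := contDiff_iff_contDiffAt.2 fun x =>
    contDiffAt_trivDeriv (n := ∞) (by simp) hψ.contDiffAt
  have hPs : ContDiff ℝ ∞ P := hΘψ.clm_comp hM
  have hPflat (x h k : F) :
      fderiv ℝ P x h k - fderiv ℝ P x k h = -bracket lam (P x h) (P x k) := by
    obtain ⟨L, hL⟩ := exists_hasMFDerivAt_of_contMDiff hΘ (ψ x)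
    have h1 : HasFDerivAt (fun y => Θ (ψ y)) (L.comp (trivDeriv ψ x)) x :=
      (HasMFDerivAt.comp x hL (hasMFDerivAt_trivDeriv (hψd x))).hasFDerivAt
    have h2 := (h1.clm_comp (hM.differentiable (by simp) x).hasFDerivAt).fderiv
    have h3 (h k : F) : fderiv ℝ P x h k
        = Θ (ψ x) (fderiv ℝ (trivDeriv ψ) x h k) + L (trivDeriv ψ x h) (trivDeriv ψ x k) := by
      rw [h2]
      simp
    have h4 := hflat (ψ x) L hL (trivDeriv ψ x h) (trivDeriv ψ x k)
    have h5 := congrArg (Θ (ψ x)) (fderiv_trivDeriv_sub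
      (hψ2.contDiffAt (x := x)) h k)
    rw [map_sub, map_neg] at h5
    rw [h3, h3]
    have e (v : F) : P x v = Θ (ψ x) (trivDeriv ψ x v) := rfl
    rw [e, e]
    linear_combination (norm := module) h4 + h5
  have hBs : ContDiff ℝ ∞ fun x => (rightMul lam).comp (P x) := contDiff_const.clm_comp hPs
  obtain ⟨u, hu0, hu⟩ := exists_hasFDerivAt_of_flat (B := fun x => (rightMul lam).comp (P x))
    (by exact_mod_cast contDiff_infty.1 hBs 2) (fun x h k => by
      have h1 : HasFDerivAt (fun x => (rightMul lam).comp (P x)) _ x :=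
        (hasFDerivAt_const (rightMul lam) x).clm_comp (hPs.differentiable (by simp) x).hasFDerivAt
      have h2 (h k : F) : fderiv ℝ (fun x => (rightMul lam).comp (P x)) x h k
          = rightMul lam (fderiv ℝ P x h k) := by
        rw [h1.fderiv]
        simp
      rw [h2, h2, ← map_sub, hPflat, map_neg, rightMul_commutator, neg_sub]
      rfl) ((1, 0) : ℂ × ℂ)
  refine ⟨u, contDiff_of_hasFDerivAt_flip hBs hu, fun x => ?_, fun x => hu x⟩
  -- right multiplication is tangent to the level sets of the norm form, so the norm form is constant
  have hN (x : F) : HasFDerivAt (fun y => normForm lam (u y)) (0 : F →L[ℝ] ℝ) x := by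
    refine (hasFDerivAt_normForm (lam := lam) (hu x)).congr_fderiv
      (ContinuousLinearMap.ext fun v => ?_)
    have := polarForm_rightMul lam (u x) (P x v)
    simp only [smul_apply, zero_apply, smul_eq_mul, mul_eq_zero]
    exact Or.inr this
  rw [is_const_of_fderiv_eq_zero (𝕜 := ℝ) (fun x => (hN x).differentiableAt)
    (fun x => (hN x).fderiv) x 0, hu0]
  simp [normForm]

end Solutions

section Descent

variable {F : Type*} [NormedAddCommGroup F] [NormedSpace ℝ F] {lam₀ lam : ℝ}
  {Θ : HGroup lam₀ → ℝ × ℂ →L[ℝ] ℝ × ℂ}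

/-- A solution along `ψ` composed with a local section `s` of `ψ` is a solution on the group. -/
theorem hasMFDerivAt_of_section {ψ : F → HGroup lam₀} {u : F → ℂ × ℂ} {W : HGroup lam₀ → ℂ × ℂ}
    {s : HGroup lam₀ → F} {q : HGroup lam₀}
    (hψ : DifferentiableAt ℝ (fun x => coords (ψ x)) (s q))
    (hu : HasFDerivAt u
      (((rightMul lam).flip (u (s q))).comp ((Θ (ψ (s q))).comp (trivDeriv ψ (s q)))) (s q))
    (hs : MDifferentiableAt 𝓘(ℝ, ℝ × ℂ) 𝓘(ℝ, F) s q)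
    (hψs : ∀ᶠ y in 𝓝 q, ψ (s y) = y) (hW : ∀ᶠ y in 𝓝 q, W y = u (s y)) :
    HasMFDerivAt 𝓘(ℝ, ℝ × ℂ) 𝓘(ℝ, ℂ × ℂ) W q (((rightMul lam).flip (W q)).comp (Θ q)) := by
  let S : ℝ × ℂ →L[ℝ] F := mfderiv 𝓘(ℝ, ℝ × ℂ) 𝓘(ℝ, F) s q
  have hS : HasMFDerivAt 𝓘(ℝ, ℝ × ℂ) 𝓘(ℝ, F) s q S := hs.hasMFDerivAt
  have h1 := HasMFDerivAt.comp q (hasMFDerivAt_trivDeriv hψ) hS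
  have h2 := (hasMFDerivAt_id (I := 𝓘(ℝ, ℝ × ℂ)) q).congr_of_eventuallyEq hψs
  have h3 : (trivDeriv ψ (s q)).comp S = ContinuousLinearMap.id ℝ (ℝ × ℂ) :=
    hasMFDerivAt_unique h1 h2
  have h4 := (HasMFDerivAt.comp q hu.hasMFDerivAt hS).congr_of_eventuallyEq
    (f₁ := W) hW
  have h5 : ((rightMul lam).flip (W q)).comp (Θ q) = ((((rightMul lam).flip (u (s q))).comp
      ((Θ (ψ (s q))).comp (trivDeriv ψ (s q))))).comp S := by
    rw [ContinuousLinearMap.comp_assoc, ContinuousLinearMap.comp_assoc, h3, hψs.self_of_nhds,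
      hW.self_of_nhds, ContinuousLinearMap.comp_id]
  exact h4.congr_mfderiv h5.symm

/-- A solution on the group composed with `ψ` is a solution along `ψ`. -/
theorem hasFDerivAt_comp_of_hasMFDerivAt {ψ : F → HGroup lam₀} {W : HGroup lam₀ → ℂ × ℂ} {x : F}
    (hψ : DifferentiableAt ℝ (fun x => coords (ψ x)) x)
    (hW : HasMFDerivAt 𝓘(ℝ, ℝ × ℂ) 𝓘(ℝ, ℂ × ℂ) W (ψ x)
      (((rightMul lam).flip (W (ψ x))).comp (Θ (ψ x)))) :
    HasFDerivAt (fun y => W (ψ y))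
      (((rightMul lam).flip (W (ψ x))).comp ((Θ (ψ x)).comp (trivDeriv ψ x))) x :=
  (HasMFDerivAt.comp x hW (hasMFDerivAt_trivDeriv hψ)).hasFDerivAt

end Descent

section Trivialisation

variable {lam₀ lam : ℝ}

theorem contMDiff_mat (i j : Fin 2) :
    ContMDiff 𝓘(ℝ, ℝ × ℂ) 𝓘(ℝ, ℂ) ∞ fun h : HGroup lam => h.mat i j := by
  have h1 : ContMDiff 𝓘(ℝ, ℝ × ℂ) 𝓘(ℝ, ℂ) ∞ fun h : HGroup lam => h.z₁ :=
    contDiff_fst.comp_contMDiff contMDiff_coords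
  have h2 : ContMDiff 𝓘(ℝ, ℝ × ℂ) 𝓘(ℝ, ℂ) ∞ fun h : HGroup lam => h.z₂ :=
    contDiff_snd.comp_contMDiff contMDiff_coords
  have hc : ContDiff ℝ ∞ fun w : ℂ => conj w := Complex.conjCLE.contDiff
  fin_cases i <;> fin_cases j
  · exact h1
  · exact (contDiff_const.mul hc : ContDiff ℝ ∞ fun w : ℂ => (lam : ℂ) * conj w).comp_contMDiff h2
  · exact h2
  · exact hc.comp_contMDiff h1

/-- The matrix-valued form `U⁻¹ dU` is the derivative of `U` in the left-invariant frames. -/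
theorem invMulD_eq {U : HGroup lam₀ → HGroup lam} {p : HGroup lam₀} {L : ℝ × ℂ →L[ℝ] ℝ × ℂ}
    (hU : HasMFDerivAt 𝓘(ℝ, ℝ × ℂ) 𝓘(ℝ, ℝ × ℂ) U p L) (i j : Fin 2) (v : ℝ × ℂ) :
    invMulD U i j p v = lieMat lam (L v) i j := by
  have hd (k : Fin 2) : dFun (fun q => (U q).mat k j) p v
      = dFun (fun h : HGroup lam => h.mat k j) (U p) (L v) := by
    have h1 := ((contMDiff_mat (lam := lam) k j (U p)).mdifferentiableAt (by simp)).hasMFDerivAt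
    have h2 := (HasMFDerivAt.comp p h1 hU).mfderiv
    exact DFunLike.congr_fun h2 v
  have h3 : invMulD U i j p v = invMulD id i j (U p) (L v) := by
    have e1 : invMulD U i j p v
        = ∑ k, (U p)⁻¹.mat i k * dFun (fun q => (U q).mat k j) p v := by
      simp [invMulD]; rfl
    have e2 : invMulD id i j (U p) (L v)
        = ∑ k, (U p)⁻¹.mat i k * dFun (fun h : HGroup lam => h.mat k j) (U p) (L v) := by
      simp [invMulD]; rfl
    rw [e1, e2]
    exact Finset.sum_congr rfl fun k _ => by rw [hd k]
  rw [h3]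
  exact maurerCartan_coords (U p) (L v).1 (L v).2 i j

/-- `U⁻¹ dU = 𝒜` says that the derivative of `U` in the left-invariant frames is `𝒜`. -/
theorem trivialises_iff {U : HGroup lam₀ → HGroup lam}
    (hU : MDifferentiable 𝓘(ℝ, ℝ × ℂ) 𝓘(ℝ, ℝ × ℂ) U) {Φ : HGroup lam₀ → ℂ} {A : OneForm lam₀ ℝ} :
    Trivialises U (vortexPotential lam Φ A) ↔
      ∀ q, HasMFDerivAt 𝓘(ℝ, ℝ × ℂ) 𝓘(ℝ, ℝ × ℂ) U q (potentialFrame Φ A q) := by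
  have he (q : HGroup lam₀) (v : ℝ × ℂ) (i j : Fin 2) : entry (vortexPotential lam Φ A) i j q v
      = lieMat lam (potentialFrame Φ A q v) i j :=
    DFunLike.congr_fun (frame_entry lam Φ A i j q) v
  constructor
  · intro h q
    let L : ℝ × ℂ →L[ℝ] ℝ × ℂ := mfderiv 𝓘(ℝ, ℝ × ℂ) 𝓘(ℝ, ℝ × ℂ) U q
    have hL : HasMFDerivAt 𝓘(ℝ, ℝ × ℂ) 𝓘(ℝ, ℝ × ℂ) U q L := (hU q).hasMFDerivAt
    have : L = potentialFrame Φ A q := by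
      refine ContinuousLinearMap.ext fun v => lieMat_injective lam ?_
      ext i j
      rw [← he, ← invMulD_eq hL]
      exact (h q v i j).symm
    rw [← this]
    exact hL
  · intro h q v i j
    exact (he q v i j).trans (invMulD_eq (h q) i j v).symm

/-- A solution of `dW = W 𝒜` with values in the unit level set of the norm form is a smooth
trivialisation of the connection. -/
theorem exists_trivialisation {Φ : HGroup lam₀ → ℂ} {A : OneForm lam₀ ℝ} {W : HGroup lam₀ → ℂ × ℂ}
    (hW : ContMDiff 𝓘(ℝ, ℝ × ℂ) 𝓘(ℝ, ℂ × ℂ) ∞ W) (hN : ∀ q, normForm lam (W q) = 1)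
    (hd : ∀ q, HasMFDerivAt 𝓘(ℝ, ℝ × ℂ) 𝓘(ℝ, ℂ × ℂ) W q
      (((rightMul lam).flip (W q)).comp (potentialFrame Φ A q))) :
    ∃ U : HGroup lam₀ → HGroup lam,
      ContMDiff 𝓘(ℝ, ℝ × ℂ) 𝓘(ℝ, ℝ × ℂ) ∞ U ∧ Trivialises U (vortexPotential lam Φ A) := by
  let U : HGroup lam₀ → HGroup lam := fun q =>
    HGroup.mk (W q).1 (W q).2 (by rw [← normForm_eq]; exact hN q)
  have hU : ContMDiff 𝓘(ℝ, ℝ × ℂ) 𝓘(ℝ, ℝ × ℂ) ∞ U := fun q => contMDiffAt_of_coords (hW q)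
  refine ⟨U, hU, (trivialises_iff (hU.mdifferentiable (by simp))).2 fun q => ?_⟩
  exact hasMFDerivAt_of_coords (hd q)

end Trivialisation

section Local

variable {lam₀ lam : ℝ} {Θ : HGroup lam₀ → ℝ × ℂ →L[ℝ] ℝ × ℂ}

/-- `u` is a solution of `du = u Θ` along `ψ` with values in the unit level set of the norm form. -/
structure IsSolutionAlong (lam : ℝ) (Θ : HGroup lam₀ → ℝ × ℂ →L[ℝ] ℝ × ℂ)
    (ψ : ℝ × ℂ → HGroup lam₀) (u : ℝ × ℂ → ℂ × ℂ) : Prop where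
  smooth_map : ContDiff ℝ ∞ fun x => coords (ψ x)
  smooth : ContDiff ℝ ∞ u
  norm : ∀ x, normForm lam (u x) = 1
  deriv : ∀ x, HasFDerivAt u
    (((rightMul lam).flip (u x)).comp ((Θ (ψ x)).comp (trivDeriv ψ x))) x

theorem IsSolutionAlong.colMul {ψ : ℝ × ℂ → HGroup lam₀} {u : ℝ × ℂ → ℂ × ℂ}
    (h : IsSolutionAlong lam Θ ψ u) {c : ℂ × ℂ} (hc : normForm lam c = 1) :
    IsSolutionAlong lam Θ ψ fun x => colMul lam c (u x) where
  smooth_map := h.smooth_map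
  smooth := (Vortex.colMul lam c).contDiff.comp h.smooth
  norm x := by rw [normForm_colMul, hc, h.norm, one_mul]
  deriv x := by
    refine ((Vortex.colMul lam c).hasFDerivAt.comp x (h.deriv x)).congr_fderiv
      (ContinuousLinearMap.ext fun v => ?_)
    exact (rightMul_colMul lam _ c (u x)).symm

theorem exists_isSolutionAlong (hΘ : ContMDiff 𝓘(ℝ, ℝ × ℂ) 𝓘(ℝ, ℝ × ℂ →L[ℝ] ℝ × ℂ) ∞ Θ)
    (hflat : IsFlatFrame lam₀ lam Θ) {ψ : ℝ × ℂ → HGroup lam₀}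
    (hψ : ContDiff ℝ ∞ fun x => coords (ψ x)) : ∃ u, IsSolutionAlong lam Θ ψ u := by
  obtain ⟨u, h1, h2, h3⟩ := exists_solution_along hΘ hflat hψ
  exact ⟨u, hψ, h1, h2, h3⟩

/-- `W` is, near `q`, the composition of a solution along a map with a local section of it. -/
def IsLocalSolution (lam : ℝ) (Θ : HGroup lam₀ → ℝ × ℂ →L[ℝ] ℝ × ℂ) (W : HGroup lam₀ → ℂ × ℂ)
    (q : HGroup lam₀) : Prop :=
  ∃ (ψ : ℝ × ℂ → HGroup lam₀) (u : ℝ × ℂ → ℂ × ℂ) (s : HGroup lam₀ → ℝ × ℂ),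
    IsSolutionAlong lam Θ ψ u ∧ ContMDiffAt 𝓘(ℝ, ℝ × ℂ) 𝓘(ℝ, ℝ × ℂ) ∞ s q ∧
    ∀ᶠ y in 𝓝 q, ψ (s y) = y ∧ W y = u (s y)

theorem IsLocalSolution.contMDiffAt {W : HGroup lam₀ → ℂ × ℂ} {q : HGroup lam₀}
    (h : IsLocalSolution lam Θ W q) : ContMDiffAt 𝓘(ℝ, ℝ × ℂ) 𝓘(ℝ, ℂ × ℂ) ∞ W q := by
  obtain ⟨ψ, u, s, hu, hs, he⟩ := h
  exact (hu.smooth.comp_contMDiffAt hs).congr_of_eventuallyEq (he.mono fun _ h => h.2)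

theorem IsLocalSolution.normForm_eq {W : HGroup lam₀ → ℂ × ℂ} {q : HGroup lam₀}
    (h : IsLocalSolution lam Θ W q) : normForm lam (W q) = 1 := by
  obtain ⟨ψ, u, s, hu, hs, he⟩ := h
  rw [he.self_of_nhds.2, hu.norm]

theorem IsLocalSolution.hasMFDerivAt {W : HGroup lam₀ → ℂ × ℂ} {q : HGroup lam₀}
    (h : IsLocalSolution lam Θ W q) :
    HasMFDerivAt 𝓘(ℝ, ℝ × ℂ) 𝓘(ℝ, ℂ × ℂ) W q (((rightMul lam).flip (W q)).comp (Θ q)) := by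
  obtain ⟨ψ, u, s, hu, hs, he⟩ := h
  exact hasMFDerivAt_of_section (hu.smooth_map.differentiable (by simp) _) (hu.deriv _)
    (hs.mdifferentiableAt (by simp)) (he.mono fun _ h => h.1) (he.mono fun _ h => h.2)

end Local

/-! ### The three-sphere -/

/-- The squared Euclidean length of `(t, w)`. -/
noncomputable def sqLength (x : ℝ × ℂ) : ℝ := x.1 ^ 2 + (x.2.re ^ 2 + x.2.im ^ 2)

theorem sqLength_nonneg (x : ℝ × ℂ) : 0 ≤ sqLength x := by unfold sqLength; positivity

theorem contDiff_sqLength : ContDiff ℝ ∞ sqLength := by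
  have h1 : ContDiff ℝ ∞ fun x : ℝ × ℂ => x.2.re := Complex.reCLM.contDiff.comp contDiff_snd
  have h2 : ContDiff ℝ ∞ fun x : ℝ × ℂ => x.2.im := Complex.imCLM.contDiff.comp contDiff_snd
  unfold sqLength
  fun_prop

theorem sqLength_eq_zero {x : ℝ × ℂ} (h : sqLength x = 0) : x = 0 := by
  unfold sqLength at h
  have h1 : x.1 = 0 := by nlinarith [sq_nonneg x.1, sq_nonneg x.2.re, sq_nonneg x.2.im]
  have h2 : x.2.re = 0 := by nlinarith [sq_nonneg x.1, sq_nonneg x.2.re, sq_nonneg x.2.im]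
  have h3 : x.2.im = 0 := by nlinarith [sq_nonneg x.1, sq_nonneg x.2.re, sq_nonneg x.2.im]
  exact Prod.ext h1 (Complex.ext h2 h3)

/-- The inverse stereographic projection onto the three-sphere without the point `-ε`, where
`ε = ±1`. -/
noncomputable def stereo (ε : ℝ) (hε : ε ^ 2 = 1) (x : ℝ × ℂ) : HGroup (-1) :=
  HGroup.mk (⟨ε * ((1 - sqLength x) * (1 + sqLength x)⁻¹), ε * (2 * x.1 * (1 + sqLength x)⁻¹)⟩ : ℂ)
    (((ε * (2 * (1 + sqLength x)⁻¹) : ℝ) : ℂ) * x.2) (by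
      have h : 1 + sqLength x ≠ 0 := by linarith [sqLength_nonneg x]
      rw [← normForm_eq (-1) (_, _)]
      simp only [normForm, Complex.re_ofReal_mul, Complex.im_ofReal_mul]
      field_simp
      rw [hε]
      simp only [sqLength]
      ring)

/-- The stereographic projection from `-ε`. -/
noncomputable def stereoInv (ε : ℝ) (q : HGroup (-1)) : ℝ × ℂ :=
  (ε * q.z₁.im * (1 + ε * q.z₁.re)⁻¹, ((ε * (1 + ε * q.z₁.re)⁻¹ : ℝ) : ℂ) * q.z₂)

theorem contDiff_coords_stereo (ε : ℝ) (hε : ε ^ 2 = 1) :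
    ContDiff ℝ ∞ fun x => coords (stereo ε hε x) := by
  have h0 := contDiff_sqLength
  have h1 : ContDiff ℝ ∞ fun x : ℝ × ℂ => (1 + sqLength x)⁻¹ :=
    (contDiff_const.add h0).inv fun x => by linarith [sqLength_nonneg x]
  have ho : ContDiff ℝ ∞ fun r : ℝ => (r : ℂ) := Complex.ofRealCLM.contDiff
  have e : (fun x => coords (stereo ε hε x)) = fun x : ℝ × ℂ =>
      (((ε * ((1 - sqLength x) * (1 + sqLength x)⁻¹) : ℝ) : ℂ)
        + ((ε * (2 * x.1 * (1 + sqLength x)⁻¹) : ℝ) : ℂ) * I,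
        ((ε * (2 * (1 + sqLength x)⁻¹) : ℝ) : ℂ) * x.2) := by
    funext x
    refine Prod.ext ?_ rfl
    exact Complex.mk_eq_add_mul_I _ _
  rw [e]
  exact ((ho.comp (by fun_prop)).add ((ho.comp (by fun_prop)).mul contDiff_const)).prodMk
    ((ho.comp (by fun_prop)).mul contDiff_snd)

theorem stereo_stereoInv (ε : ℝ) (hε : ε ^ 2 = 1) {q : HGroup (-1)} (hq : 1 + ε * q.z₁.re ≠ 0) :
    stereo ε hε (stereoInv ε q) = q := by
  have hr := q.rel_re
  have hs : 1 + sqLength (stereoInv ε q) = 2 * (1 + ε * q.z₁.re)⁻¹ := by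
    simp only [sqLength, stereoInv, Complex.re_ofReal_mul, Complex.im_ofReal_mul]
    field_simp
    linear_combination ε ^ 2 * hr + hε
  have hs' : sqLength (stereoInv ε q) = 2 * (1 + ε * q.z₁.re)⁻¹ - 1 := by linarith
  have hi : (1 + sqLength (stereoInv ε q))⁻¹ = (1 + ε * q.z₁.re) / 2 := by
    rw [hs, mul_inv, inv_inv]; ring
  refine HGroup.ext' (Complex.ext ?_ ?_) ?_
  · change ε * ((1 - sqLength (stereoInv ε q)) * (1 + sqLength (stereoInv ε q))⁻¹) = q.z₁.re
    rw [hi, hs']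
    field_simp
    linear_combination 2 * q.z₁.re * hε
  · change ε * (2 * (stereoInv ε q).1 * (1 + sqLength (stereoInv ε q))⁻¹) = q.z₁.im
    rw [hi]
    simp only [stereoInv]
    field_simp
    linear_combination q.z₁.im * hε
  · change ((ε * (2 * (1 + sqLength (stereoInv ε q))⁻¹) : ℝ) : ℂ) * (stereoInv ε q).2 = q.z₂
    rw [hi]
    simp only [stereoInv]
    rw [← mul_assoc, ← Complex.ofReal_mul]
    have : ε * (2 * ((1 + ε * q.z₁.re) / 2)) * (ε * (1 + ε * q.z₁.re)⁻¹) = 1 := by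
      field_simp
      linear_combination hε
    rw [this, Complex.ofReal_one, one_mul]

theorem contMDiffAt_stereoInv (ε : ℝ) {q : HGroup (-1)} (hq : 1 + ε * q.z₁.re ≠ 0) :
    ContMDiffAt 𝓘(ℝ, ℝ × ℂ) 𝓘(ℝ, ℝ × ℂ) ∞ (stereoInv ε) q := by
  have hre : ContDiff ℝ ∞ fun p : ℂ × ℂ => p.1.re := Complex.reCLM.contDiff.comp contDiff_fst
  have him : ContDiff ℝ ∞ fun p : ℂ × ℂ => p.1.im := Complex.imCLM.contDiff.comp contDiff_fst
  have ho : ContDiff ℝ ∞ fun r : ℝ => (r : ℂ) := Complex.ofRealCLM.contDiff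
  have hinv : ContDiffAt ℝ ∞ (fun p : ℂ × ℂ => (1 + ε * p.1.re)⁻¹) (coords q) :=
    (contDiff_const.add (contDiff_const.mul hre)).contDiffAt.inv hq
  have h : ContDiffAt ℝ ∞ (fun p : ℂ × ℂ => ((ε * p.1.im * (1 + ε * p.1.re)⁻¹,
      ((ε * (1 + ε * p.1.re)⁻¹ : ℝ) : ℂ) * p.2) : ℝ × ℂ)) (coords q) :=
    (((contDiff_const.mul him).contDiffAt).mul hinv).prodMk
      ((ho.contDiffAt.comp _ (contDiffAt_const.mul hinv)).mul contDiffAt_snd)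
  exact h.comp_contMDiffAt contMDiff_coords.contMDiffAt

theorem stereo_re (ε : ℝ) (hε : ε ^ 2 = 1) (x : ℝ × ℂ) :
    (stereo ε hε x).z₁.re = ε * ((1 - sqLength x) * (1 + sqLength x)⁻¹) := rfl

/-- On `H¹₋₁ = SU(2)` every flat connection is trivial: the sphere is covered by two stereographic
charts with connected intersection, so the two solutions can be matched by a left translation. -/
theorem exists_isLocalSolution_sphere {lam : ℝ} {Θ : HGroup (-1) → ℝ × ℂ →L[ℝ] ℝ × ℂ}
    (hΘ : ContMDiff 𝓘(ℝ, ℝ × ℂ) 𝓘(ℝ, ℝ × ℂ →L[ℝ] ℝ × ℂ) ∞ Θ) (hflat : IsFlatFrame (-1) lam Θ) :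
    ∃ W : HGroup (-1) → ℂ × ℂ, ∀ q, IsLocalSolution lam Θ W q := by
  classical
  have e1 : (1 : ℝ) ^ 2 = 1 := by norm_num
  have e2 : (-1 : ℝ) ^ 2 = 1 := by norm_num
  obtain ⟨u, hu⟩ := exists_isSolutionAlong hΘ hflat (contDiff_coords_stereo 1 e1)
  obtain ⟨v, hv⟩ := exists_isSolutionAlong hΘ hflat (contDiff_coords_stereo (-1) e2)
  have hcont : Continuous fun q : HGroup (-1) => q.z₁.re :=
    Complex.continuous_re.comp HGroup.continuous_z₁
  have hopen (ε : ℝ) : IsOpen {q : HGroup (-1) | 1 + ε * q.z₁.re ≠ 0} :=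
    isOpen_ne_fun (by fun_prop) continuous_const
  have hnear (ε : ℝ) {q : HGroup (-1)} (hq : 1 + ε * q.z₁.re ≠ 0) :
      ∀ᶠ y in 𝓝 q, 1 + ε * y.z₁.re ≠ 0 := (hopen ε).mem_nhds hq
  have hloc {ε : ℝ} (hε : ε ^ 2 = 1) {w : ℝ × ℂ → ℂ × ℂ}
      (hw : IsSolutionAlong lam Θ (stereo ε hε) w) {W : HGroup (-1) → ℂ × ℂ} {q : HGroup (-1)}
      (hq : 1 + ε * q.z₁.re ≠ 0) (hW : ∀ᶠ y in 𝓝 q, W y = w (stereoInv ε y)) :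
      IsLocalSolution lam Θ W q :=
    ⟨stereo ε hε, w, stereoInv ε, hw, contMDiffAt_stereoInv ε hq,
      (hnear ε hq).mp (hW.mono fun y h1 h2 => ⟨stereo_stereoInv ε hε h2, h1⟩)⟩
  -- the image of the punctured space under the first chart lies in both charts
  have hmem : ∀ x ∈ ({0}ᶜ : Set (ℝ × ℂ)), 1 + 1 * (stereo 1 e1 x).z₁.re ≠ 0 ∧
      1 + (-1) * (stereo 1 e1 x).z₁.re ≠ 0 := by
    intro x hx
    have h1 : 1 + sqLength x ≠ 0 := by linarith [sqLength_nonneg x]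
    have h2 : sqLength x ≠ 0 := fun h => hx (sqLength_eq_zero h)
    rw [stereo_re]
    constructor
    · have : 1 + 1 * (1 * ((1 - sqLength x) * (1 + sqLength x)⁻¹)) = 2 * (1 + sqLength x)⁻¹ := by
        field_simp; ring
      rw [this]
      positivity
    · have : 1 + (-1) * (1 * ((1 - sqLength x) * (1 + sqLength x)⁻¹))
          = 2 * sqLength x * (1 + sqLength x)⁻¹ := by
        field_simp; ring
      rw [this]
      exact mul_ne_zero (mul_ne_zero two_ne_zero h2) (inv_ne_zero h1)
  have hconn : IsPreconnected ({0}ᶜ : Set (ℝ × ℂ)) := by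
    refine (isConnected_compl_singleton_of_one_lt_rank ?_ 0).isPreconnected
    rw [← Module.finrank_eq_rank]
    simp
  have hne : ({0}ᶜ : Set (ℝ × ℂ)).Nonempty := ⟨(1, 0), by simp⟩
  have hdiff (x : ℝ × ℂ) : DifferentiableAt ℝ (fun x => coords (stereo 1 e1 x)) x :=
    (contDiff_coords_stereo 1 e1).differentiable (by simp) x
  have hWu {q : HGroup (-1)} (hq : 1 + 1 * q.z₁.re ≠ 0) :
      IsLocalSolution lam Θ (fun q => u (stereoInv 1 q)) q :=
    hloc e1 hu hq (Filter.Eventually.of_forall fun _ => rfl)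
  have hWv {q : HGroup (-1)} (hq : 1 + (-1) * q.z₁.re ≠ 0) :
      IsLocalSolution lam Θ (fun q => v (stereoInv (-1) q)) q :=
    hloc e2 hv hq (Filter.Eventually.of_forall fun _ => rfl)
  obtain ⟨c, hc, hcuv⟩ := exists_colMul_eq (lam := lam)
    (B := fun x => (Θ (stereo 1 e1 x)).comp (trivDeriv (stereo 1 e1) x))
    isOpen_compl_singleton hconn hne
    (fun x hx => hasFDerivAt_comp_of_hasMFDerivAt (hdiff x) (hWv (hmem x hx).2).hasMFDerivAt)
    (fun x hx => hasFDerivAt_comp_of_hasMFDerivAt (hdiff x) (hWu (hmem x hx).1).hasMFDerivAt)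
    (fun x hx => (hWv (hmem x hx).2).normForm_eq) (fun x hx => (hWu (hmem x hx).1).normForm_eq)
  have hglue {q : HGroup (-1)} (h1 : 1 + 1 * q.z₁.re ≠ 0) (h2 : 1 + (-1) * q.z₁.re ≠ 0) :
      u (stereoInv 1 q) = colMul lam c (v (stereoInv (-1) q)) := by
    have h3 := stereo_stereoInv 1 e1 h1
    have h4 : stereoInv 1 q ∈ ({0}ᶜ : Set (ℝ × ℂ)) := by
      intro h
      rw [Set.mem_singleton_iff] at h
      apply h2
      rw [← h3, h, stereo_re]
      simp [sqLength]
    have h5 := hcuv _ h4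
    rwa [h3] at h5
  refine ⟨fun q => if 1 + 1 * q.z₁.re ≠ 0 then u (stereoInv 1 q)
    else colMul lam c (v (stereoInv (-1) q)), fun q => ?_⟩
  by_cases hq : 1 + 1 * q.z₁.re ≠ 0
  · exact hloc e1 hu hq ((hnear 1 hq).mono fun y hy => if_pos hy)
  · have hq' : 1 + (-1) * q.z₁.re ≠ 0 := by
      intro h
      apply hq
      intro h'
      linarith
    refine hloc e2 (hv.colMul hc) hq' ((hnear (-1) hq').mono fun y hy => ?_)
    by_cases hy1 : 1 + 1 * y.z₁.re ≠ 0
    · rw [if_pos hy1, hglue hy1 hy]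
    · rw [if_neg hy1]

/-! ### The Euclidean and the hyperbolic group -/

section Cylinder

variable {lam₀ lam : ℝ}

/-- The squared length of the first coordinate of a group element with second coordinate `w`. -/
noncomputable def radiusSq (lam₀ : ℝ) (w : ℂ) : ℝ := 1 + lam₀ * (w.re ^ 2 + w.im ^ 2)

theorem radiusSq_pos (h : 0 ≤ lam₀) (w : ℂ) : 0 < radiusSq lam₀ w := by
  unfold radiusSq; positivity

theorem norm_z₁_sq (q : HGroup lam₀) : ‖q.z₁‖ ^ 2 = radiusSq lam₀ q.z₂ := by
  have := q.rel_re
  rw [Complex.sq_norm, Complex.normSq_apply, radiusSq]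
  linarith

theorem z₁_ne_zero (h : 0 ≤ lam₀) (q : HGroup lam₀) : q.z₁ ≠ 0 := by
  intro h0
  have h1 := norm_z₁_sq q
  have h2 := radiusSq_pos h q.z₂
  rw [h0] at h1
  simp at h1
  linarith

/-- The universal covering `(φ, w) ↦ (√(1 + lam₀ |w|²) e^{-iφ/2}, w)` of `H¹_lam₀` for `lam₀ ≥ 0`. -/
noncomputable def cover (h : 0 ≤ lam₀) (x : ℝ × ℂ) : HGroup lam₀ :=
  HGroup.mk ((Real.sqrt (radiusSq lam₀ x.2) : ℂ) * Complex.exp (-(I / 2) * x.1)) x.2 (by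
    have h1 : ‖Complex.exp (-(I / 2) * x.1)‖ = 1 := by simp [Complex.norm_exp]
    rw [norm_mul, h1, mul_one, Complex.norm_real, Real.norm_eq_abs, sq_abs,
      Real.sq_sqrt (radiusSq_pos h _).le, Complex.sq_norm, Complex.normSq_apply, radiusSq]
    ring)

theorem contDiff_coords_cover (h : 0 ≤ lam₀) : ContDiff ℝ ∞ fun x => coords (cover h x) := by
  have h1 : ContDiff ℝ ∞ fun x : ℝ × ℂ => x.2.re := Complex.reCLM.contDiff.comp contDiff_snd
  have h2 : ContDiff ℝ ∞ fun x : ℝ × ℂ => x.2.im := Complex.imCLM.contDiff.comp contDiff_snd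
  have h3 : ContDiff ℝ ∞ fun x : ℝ × ℂ => radiusSq lam₀ x.2 := by unfold radiusSq; fun_prop
  have h4 : ContDiff ℝ ∞ fun x : ℝ × ℂ => Real.sqrt (radiusSq lam₀ x.2) :=
    h3.sqrt fun x => (radiusSq_pos h x.2).ne'
  have ho : ContDiff ℝ ∞ fun r : ℝ => (r : ℂ) := Complex.ofRealCLM.contDiff
  have h5 : ContDiff ℝ ∞ fun x : ℝ × ℂ => Complex.exp (-(I / 2) * x.1) :=
    (contDiff_const.mul (ho.comp contDiff_fst)).cexp
  exact ((ho.comp h4).mul h5).prodMk contDiff_snd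

theorem cover_add (h : 0 ≤ lam₀) (x : ℝ × ℂ) :
    cover h (x + (4 * Real.pi, 0)) = cover h x := by
  refine HGroup.ext' ?_ ?_
  · change (Real.sqrt (radiusSq lam₀ (x.2 + 0)) : ℂ)
      * Complex.exp (-(I / 2) * ((x.1 + 4 * Real.pi : ℝ) : ℂ))
      = (Real.sqrt (radiusSq lam₀ x.2) : ℂ) * Complex.exp (-(I / 2) * x.1)
    rw [add_zero]
    have e : -(I / 2) * ((x.1 + 4 * Real.pi : ℝ) : ℂ)
        = -(I / 2) * x.1 - 2 * Real.pi * I := by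
      push_cast
      ring
    rw [e, Complex.exp_periodic.sub_eq]
  · change x.2 + 0 = x.2
    rw [add_zero]

/-- A section of the covering that is smooth near `q₀`: the argument of `z₁` is measured from that of
`q₀`, which keeps the branch cut away. -/
noncomputable def coverInv (q₀ q : HGroup lam₀) : ℝ × ℂ :=
  (-2 * ((Complex.log (q.z₁ / q₀.z₁)).im + Complex.arg q₀.z₁), q.z₂)

theorem cover_eq (h : 0 ≤ lam₀) {q : HGroup lam₀} {φ : ℝ}
    (hφ : Complex.exp (-(I / 2) * φ) = q.z₁ / ‖q.z₁‖) : cover h (φ, q.z₂) = q := by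
  have hn : (‖q.z₁‖ : ℂ) ≠ 0 := by
    rw [Complex.ofReal_ne_zero, norm_ne_zero_iff]; exact z₁_ne_zero h q
  refine HGroup.ext' ?_ rfl
  change (Real.sqrt (radiusSq lam₀ q.z₂) : ℂ) * Complex.exp (-(I / 2) * φ) = q.z₁
  rw [hφ, ← norm_z₁_sq, Real.sqrt_sq (norm_nonneg _), mul_div_cancel₀ _ hn]

theorem exp_arg_mul_I (z : ℂ) (hz : z ≠ 0) : Complex.exp (Complex.arg z * I) = z / ‖z‖ := by
  have hn : (‖z‖ : ℂ) ≠ 0 := by rwa [Complex.ofReal_ne_zero, norm_ne_zero_iff]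
  rw [eq_div_iff hn, mul_comm]
  exact Complex.norm_mul_exp_arg_mul_I z

theorem exp_coverInv (h : 0 ≤ lam₀) (q₀ q : HGroup lam₀) :
    Complex.exp (-(I / 2) * (coverInv q₀ q).1) = q.z₁ / ‖q.z₁‖ := by
  have h0 := z₁_ne_zero h q₀
  have h1 := z₁_ne_zero h q
  have hn : (‖q.z₁‖ : ℂ) ≠ 0 := by rwa [Complex.ofReal_ne_zero, norm_ne_zero_iff]
  have hn0 : (‖q₀.z₁‖ : ℂ) ≠ 0 := by rwa [Complex.ofReal_ne_zero, norm_ne_zero_iff]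
  have e : -(I / 2) * ((coverInv q₀ q).1 : ℂ)
      = Complex.arg (q.z₁ / q₀.z₁) * I + Complex.arg q₀.z₁ * I := by
    simp only [coverInv, Complex.log_im]
    push_cast
    ring
  rw [e, Complex.exp_add, exp_arg_mul_I _ (div_ne_zero h1 h0), exp_arg_mul_I _ h0, norm_div]
  push_cast
  field_simp

theorem contMDiffAt_coverInv (h : 0 ≤ lam₀) (q : HGroup lam₀) :
    ContMDiffAt 𝓘(ℝ, ℝ × ℂ) 𝓘(ℝ, ℝ × ℂ) ∞ (coverInv q) q := by
  have h0 := z₁_ne_zero h q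
  have hlog : ContDiffAt ℝ ∞ Complex.log (q.z₁ / q.z₁) := by
    rw [div_self h0]
    exact (Complex.contDiffAt_log (by simp)).restrict_scalars ℝ
  have hdiv : ContDiffAt ℝ ∞ (fun p : ℂ × ℂ => p.1 / q.z₁) (coords q) :=
    (contDiff_fst.div_const _).contDiffAt
  have h1 : ContDiffAt ℝ ∞ (fun p : ℂ × ℂ => Complex.log (p.1 / q.z₁)) (coords q) :=
    ContDiffAt.comp (g := Complex.log) (f := fun p : ℂ × ℂ => p.1 / q.z₁) (coords q) hlog hdiv
  have h2 : ContDiffAt ℝ ∞ (fun p : ℂ × ℂ => (Complex.log (p.1 / q.z₁)).im) (coords q) :=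
    Complex.imCLM.contDiff.contDiffAt.comp _ h1
  have h3 : ContDiffAt ℝ ∞ (fun p : ℂ × ℂ =>
      ((-2 * ((Complex.log (p.1 / q.z₁)).im + Complex.arg q.z₁), p.2) : ℝ × ℂ)) (coords q) :=
    (contDiffAt_const.mul (h2.add contDiffAt_const)).prodMk contDiffAt_snd
  exact h3.comp_contMDiffAt contMDiff_coords.contMDiffAt

theorem coords_gammaCurve (φ : ℝ) :
    coords (gammaCurve lam₀ φ) = (Complex.exp (-(I / 2) * φ), 0) := rfl

theorem cover_zero (h : 0 ≤ lam₀) (φ : ℝ) : cover h (φ, 0) = gammaCurve lam₀ φ := by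
  refine HGroup.ext' ?_ rfl
  change (Real.sqrt (radiusSq lam₀ 0) : ℂ) * Complex.exp (-(I / 2) * φ)
    = Complex.exp (-(I / 2) * φ)
  simp [radiusSq]

theorem hasDerivAt_coords_gammaCurve (φ : ℝ) : HasDerivAt (fun φ => coords (gammaCurve lam₀ φ))
    (rightMul lam₀ (1, 0) (coords (gammaCurve lam₀ φ))) φ := by
  have h1 : HasDerivAt (fun φ : ℝ => -(I / 2) * (φ : ℂ)) (-(I / 2)) φ := by
    simpa using (Complex.ofRealCLM.hasDerivAt (x := φ)).const_mul (-(I / 2))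
  have h2 := h1.cexp.prodMk (hasDerivAt_const φ (0 : ℂ))
  refine h2.congr_deriv ?_
  rw [rightMul_apply, coords_gammaCurve]
  ext1
  · simp; ring
  · simp

/-- The curve `γ` is an integral curve of `X₀`. -/
theorem hasMFDerivAt_gammaCurve (φ : ℝ) : HasMFDerivAt 𝓘(ℝ, ℝ) 𝓘(ℝ, ℝ × ℂ) (gammaCurve lam₀) φ
    (ContinuousLinearMap.toSpanSingleton ℝ ((1, 0) : ℝ × ℂ)) := by
  refine hasMFDerivAt_of_coords (L := ContinuousLinearMap.toSpanSingleton ℝ ((1, 0) : ℝ × ℂ)) ?_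
  refine HasFDerivAt.hasMFDerivAt ?_
  refine (hasDerivAt_coords_gammaCurve φ).hasFDerivAt.congr_fderiv ?_
  ext1
  change _ = rightMul lam₀ ((1 : ℝ) • ((1, 0) : ℝ × ℂ)) _
  rw [one_smul]
  simp

theorem trivDeriv_cover (h : 0 ≤ lam₀) (φ : ℝ) : trivDeriv (cover h) (φ, 0) (1, 0) = (1, 0) := by
  have h1 : HasDerivAt (fun t : ℝ => ((t, 0) : ℝ × ℂ)) (1, 0) φ :=
    (hasDerivAt_id φ).prodMk (hasDerivAt_const φ (0 : ℂ))
  have h2 := ((contDiff_coords_cover h).differentiable (by simp) (φ, 0)).hasFDerivAt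
  have h3 := HasFDerivAt.comp_hasDerivAt φ h2 h1
  have h4 := hasDerivAt_coords_gammaCurve (lam₀ := lam₀) φ
  have e : ((fun x => coords (cover h x)) ∘ fun t : ℝ => ((t, 0) : ℝ × ℂ))
      = fun φ => coords (gammaCurve lam₀ φ) := funext fun φ => congrArg coords (cover_zero h φ)
  rw [e] at h3
  rw [trivDeriv, ContinuousLinearMap.comp_apply, h3.unique h4, cover_zero,
    leftDiv_rightMul (normForm_coords _)]

/-- The solution along the universal covering is invariant under deck transformations as soon as
the holonomy along `γ` is trivial. -/
theorem IsSolutionAlong.periodic (h : 0 ≤ lam₀) {Θ : HGroup lam₀ → ℝ × ℂ →L[ℝ] ℝ × ℂ}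
    {u : ℝ × ℂ → ℂ × ℂ} (hu : IsSolutionAlong lam Θ (cover h) u)
    (h0 : u (4 * Real.pi, 0) = u (0, 0)) (x : ℝ × ℂ) : u (x + (4 * Real.pi, 0)) = u x := by
  have hshift (x : ℝ × ℂ) : HasFDerivAt (fun x : ℝ × ℂ => x + (4 * Real.pi, 0))
      (ContinuousLinearMap.id ℝ (ℝ × ℂ)) x := (hasFDerivAt_id x).add_const _
  have htriv (x : ℝ × ℂ) :
      trivDeriv (cover h) (x + (4 * Real.pi, 0)) = trivDeriv (cover h) x := by
    have h1 := hasFDerivAt_coords_comp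
      ((contDiff_coords_cover h).differentiable (by simp) (x + (4 * Real.pi, 0)))
    have h2 := h1.comp x (hshift x)
    have e : ((fun x => coords (cover h x)) ∘ fun x : ℝ × ℂ => x + (4 * Real.pi, 0))
        = fun x => coords (cover h x) := funext fun x => congrArg coords (cover_add h x)
    rw [e, cover_add, ContinuousLinearMap.comp_id] at h2
    exact (trivDeriv_eq_of_hasFDerivAt h2).symm
  obtain ⟨c, hc, hcu⟩ := exists_colMul_eq (lam := lam)
    (B := fun x => (Θ (cover h x)).comp (trivDeriv (cover h) x)) isOpen_univ isPreconnected_univ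
    Set.univ_nonempty (a := u) (b := fun x => u (x + (4 * Real.pi, 0)))
    (fun x _ => hu.deriv x) (fun x _ => by
      have h1 := (hu.deriv (x + (4 * Real.pi, 0))).comp x (hshift x)
      rw [htriv, cover_add, ContinuousLinearMap.comp_id] at h1
      exact h1) (fun x _ => hu.norm x) (fun x _ => hu.norm _)
  -- the constant is determined by its value at the origin
  have hc1 : c = (1, 0) := by
    have h1 := hcu (0, 0) trivial
    simp only [Prod.mk_add_mk, zero_add, h0] at h1
    have h2 := colMul_colMul_colAdj (lam := lam) (a := colAdj (u (0, 0)))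
      (by rw [normForm_colAdj, hu.norm]) c
    have h3 : colAdj (colAdj (u (0, 0))) = u (0, 0) := by simp [colAdj_apply]
    rw [h3, ← h1] at h2
    rw [← h2]
    have h4 := hu.norm (0, 0)
    generalize u (0, 0) = p at h4
    simp only [normForm] at h4
    simp only [colMul_apply, colAdj_apply]
    ext1 <;> apply Complex.ext <;> simp
    · linarith
    · ring
    · ring
    · ring
  have h1 := hcu x trivial
  rw [h1, hc1, colMul_apply]
  simp

/-- For `lam₀ ≥ 0` a solution along the universal covering with trivial holonomy along `γ` descends
to the group. Its value does not depend on the choice of the angle, so that the angle may be chosen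
globally by `Complex.arg` and locally by the smooth section `coverInv`. -/
theorem exists_isLocalSolution_cylinder (h : 0 ≤ lam₀) {Θ : HGroup lam₀ → ℝ × ℂ →L[ℝ] ℝ × ℂ}
    {u : ℝ × ℂ → ℂ × ℂ} (hu : IsSolutionAlong lam Θ (cover h) u)
    (h0 : u (4 * Real.pi, 0) = u (0, 0)) :
    ∃ W : HGroup lam₀ → ℂ × ℂ, ∀ q, IsLocalSolution lam Θ W q := by
  have hper (w : ℂ) : Function.Periodic (fun φ => u (φ, w)) (4 * Real.pi) := fun φ => by
    have := hu.periodic h h0 (φ, w)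
    simpa using this
  have heq {φ φ' : ℝ} (w : ℂ)
      (he : Complex.exp (-(I / 2) * φ) = Complex.exp (-(I / 2) * φ')) : u (φ, w) = u (φ', w) := by
    obtain ⟨n, hn⟩ := Complex.exp_eq_exp_iff_exists_int.1 he
    have h1 : φ = φ' - n * (4 * Real.pi) := by
      have := congrArg Complex.im hn
      simp at this
      linarith
    rw [h1]
    exact (hper w).sub_int_mul_eq n
  refine ⟨fun q => u (-2 * Complex.arg q.z₁, q.z₂), fun q => ⟨cover h, u, coverInv q, hu,
    contMDiffAt_coverInv h q, Filter.Eventually.of_forall fun y => ⟨?_, ?_⟩⟩⟩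
  · exact cover_eq h (exp_coverInv h q y)
  · refine heq y.z₂ ?_
    refine Eq.trans ?_ (exp_coverInv h q y).symm
    rw [← exp_arg_mul_I _ (z₁_ne_zero h y)]
    congr 1
    push_cast
    ring

end Cylinder

/-! ### Existence of trivialisations -/

section Existence

variable {lam₀ lam : ℝ} {Φ : HGroup lam₀ → ℂ} {A : OneForm lam₀ ℝ}

/-- The upper left entry of the integral along `γ`; the frame vector of `γ` is `X₀`. -/
theorem integralGamma_vortexPotential : integralGamma (vortexPotential lam Φ A) 0 0
    = ∫ φ in (0 : ℝ)..(4 * Real.pi), -(I / 2) * (frame A (gammaCurve lam₀ φ) (1, 0) + 1 : ℝ) := by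
  rw [integralGamma, Matrix.of_apply]
  refine intervalIntegral.integral_congr fun φ _ => ?_
  have h1 : mfderiv 𝓘(ℝ, ℝ) 𝓘(ℝ, ℝ × ℂ) (gammaCurve lam₀) φ (1 : ℝ) = ((1, 0) : ℝ × ℂ) := by
    refine (DFunLike.congr_fun (hasMFDerivAt_gammaCurve φ).mfderiv (1 : ℝ)).trans ?_
    exact one_smul ℝ ((1, 0) : ℝ × ℂ)
  have h2 := DFunLike.congr_fun (frame_entry lam Φ A 0 0 (gammaCurve lam₀ φ)) ((1, 0) : ℝ × ℂ)
  refine Eq.trans ?_ (h2.trans ?_)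
  · exact congrArg (fun v : ℝ × ℂ => frame (entry (vortexPotential lam Φ A) 0 0)
      (gammaCurve lam₀ φ) v) h1
  · simp [lieEntry_apply, lieMat_eq, potentialFrame_apply]

/-- Along `γ` the connection takes values in the multiples of `t₀`, so the holonomy is the exponential
of its integral, `exp(4πn t₀) = 1`. -/
theorem holonomy_eq (h : 0 ≤ lam₀) (hA : IsSmoothForm A) {u : ℝ × ℂ → ℂ × ℂ}
    (hu : IsSolutionAlong lam (potentialFrame Φ A) (cover h) u) {n : ℤ}
    (hn : integralGamma (vortexPotential lam Φ A) = (4 * Real.pi * n) • gen lam 0) :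
    u (4 * Real.pi, 0) = u (0, 0) := by
  set a : ℝ → ℂ := fun φ => -(I / 2) * (frame A (gammaCurve lam₀ φ) (1, 0) + 1 : ℝ) with ha
  have hint : ∫ φ in (0 : ℝ)..(4 * Real.pi), a φ = -(n * (2 * Real.pi * I)) := by
    rw [ha, ← integralGamma_vortexPotential (lam := lam) (Φ := Φ), hn]
    simp [gen]
    ring
  have hac : Continuous a := by
    have h1 : Continuous (frame A) := (isSmoothForm_iff.1 hA).continuous
    have h2 : Continuous (gammaCurve lam₀) := continuous_iff_continuousAt.2 fun φ =>
      (hasMFDerivAt_gammaCurve φ).1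
    have h3 : Continuous fun φ => frame A (gammaCurve lam₀ φ) (1, 0) :=
      (h1.comp h2).clm_apply continuous_const
    exact continuous_const.mul (Complex.continuous_ofReal.comp (h3.add continuous_const))
  have hd (φ : ℝ) : HasDerivAt (fun t : ℝ => u (t, 0)) (a φ • u (φ, 0)) φ := by
    have h1 : HasDerivAt (fun t : ℝ => ((t, 0) : ℝ × ℂ)) (1, 0) φ :=
      (hasDerivAt_id φ).prodMk (hasDerivAt_const φ (0 : ℂ))
    refine (HasFDerivAt.comp_hasDerivAt φ (hu.deriv (φ, 0)) h1).congr_deriv ?_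
    have h2 : potentialFrame Φ A (cover h (φ, 0)) (trivDeriv (cover h) (φ, 0) (1, 0))
        = (frame A (gammaCurve lam₀ φ) (1, 0) + 1, 0) := by
      rw [trivDeriv_cover, cover_zero, potentialFrame_apply]
      simp
    change rightMul lam (potentialFrame Φ A (cover h (φ, 0))
      (trivDeriv (cover h) (φ, 0) (1, 0))) (u (φ, 0)) = _
    rw [h2, rightMul_apply, ha]
    ext1 <;> simp <;> ring
  have h1 := eq_exp_integral_mul_of_hasDerivAt (y := fun t => (u (t, 0)).1) hac
    (fun φ => (hasFDerivAt_fst.comp_hasDerivAt φ (hd φ) :)) (4 * Real.pi)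
  have h2 := eq_exp_integral_mul_of_hasDerivAt (y := fun t => (u (t, 0)).2) hac
    (fun φ => (hasFDerivAt_snd.comp_hasDerivAt φ (hd φ) :)) (4 * Real.pi)
  have he : Complex.exp (-(n * (2 * Real.pi * I))) = 1 := by
    rw [Complex.exp_neg, Complex.exp_int_mul_two_pi_mul_I, inv_one]
  rw [hint, he, one_mul] at h1 h2
  exact Prod.ext h1 h2

/-- The integrality condition is needed only for `lam₀ ≥ 0`, where the group is not simply
connected. -/
theorem exists_trivialisation_of_flat (h₀ : lam₀ = -1 ∨ lam₀ = 0 ∨ lam₀ = 1)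
    (hflat : IsFlatConnection (vortexPotential lam Φ A))
    (hint : ∃ n : ℤ, integralGamma (vortexPotential lam Φ A) = (4 * Real.pi * n) • gen lam 0) :
    ∃ U : HGroup lam₀ → HGroup lam,
      ContMDiff 𝓘(ℝ, ℝ × ℂ) 𝓘(ℝ, ℝ × ℂ) ∞ U ∧ Trivialises U (vortexPotential lam Φ A) := by
  obtain ⟨hΦ, hA⟩ := smooth_of_smooth_entries hflat.smooth
  have hΘ := contMDiff_potentialFrame hΦ hA
  have hf := (isFlatConnection_iff_isFlatFrame hΦ hA).1 hflat
  obtain ⟨W, hW⟩ : ∃ W : HGroup lam₀ → ℂ × ℂ, ∀ q,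
      IsLocalSolution lam (potentialFrame Φ A) W q := by
    by_cases h : 0 ≤ lam₀
    · obtain ⟨n, hn⟩ := hint
      obtain ⟨u, hu⟩ := exists_isSolutionAlong hΘ hf (contDiff_coords_cover h)
      exact exists_isLocalSolution_cylinder h hu (holonomy_eq h hA hu hn)
    · obtain rfl : lam₀ = -1 := by
        rcases h₀ with h0 | h0 | h0
        · exact h0
        · exact absurd h0.ge h
        · exact absurd (by rw [h0]; exact zero_le_one) h
      exact exists_isLocalSolution_sphere hΘ hf
  exact exists_trivialisation (fun q => (hW q).contMDiffAt) (fun q => (hW q).normForm_eq)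
    fun q => (hW q).hasMFDerivAt

end Existence

/-! ### The fibres of the projection -/

section Fibres

variable {lam₀ lam : ℝ}

theorem z₂_ne_zero_of_z₁_eq_zero {h : HGroup lam} (h1 : h.z₁ = 0) : h.z₂ ≠ 0 := by
  intro h2
  have := h.norm_rel
  simp [h1, h2] at this

theorem proj_eq_proj_iff {h k : HGroup lam} : proj h = proj k ↔ h.z₁ * k.z₂ = h.z₂ * k.z₁ := by
  rw [proj, proj, Subtype.mk.injEq]
  by_cases h1 : h.z₁ = 0 <;> by_cases k1 : k.z₁ = 0
  · simp [h1, k1]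
  · have h2 := z₂_ne_zero_of_z₁_eq_zero h1
    simp [h1, h2, k1]
  · have k2 := z₂_ne_zero_of_z₁_eq_zero k1
    simp [h1, k2, k1]
  · rw [if_neg h1, if_neg k1, OnePoint.coe_eq_coe, div_eq_div_iff h1 k1]
    constructor <;> intro e <;> linear_combination -e

/-- The fibres of the projection are the orbits of right multiplication by `γ`. -/
theorem exists_mul_gammaCurve_eq {h k : HGroup lam} (e : proj h = proj k) :
    ∃ φ : ℝ, h * gammaCurve lam φ = k := by
  rw [proj_eq_proj_iff] at e
  have e2 : (h⁻¹ * k).z₂ = 0 := by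
    simp only [HGroup.mul_z₂, HGroup.inv_z₁, HGroup.inv_z₂, Complex.conj_conj]
    linear_combination e
  have e1 : ‖(h⁻¹ * k).z₁‖ = 1 := by
    have := (h⁻¹ * k).norm_rel
    rw [e2] at this
    refine (sq_eq_sq₀ (norm_nonneg _) zero_le_one).1 ?_
    simpa [-HGroup.mul_z₁] using this
  refine ⟨-2 * Complex.arg (h⁻¹ * k).z₁, mul_eq_of_eq_inv_mul (HGroup.ext' ?_ e2.symm)⟩
  have := Complex.norm_mul_exp_arg_mul_I (h⁻¹ * k).z₁
  rw [e1, Complex.ofReal_one, one_mul] at this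
  refine Eq.trans ?_ this
  change Complex.exp _ = _
  congr 1
  push_cast
  ring

theorem coords_mul (h k : HGroup lam) : coords (h * k) = colMul lam (coords h) (coords k) := rfl

/-- The curves `φ ↦ h γ(φ)` are integral curves of `X₀`. -/
theorem hasFDerivAt_coords_mul_gammaCurve (h : HGroup lam) (φ : ℝ) :
    HasFDerivAt (fun φ => coords (h * gammaCurve lam φ))
      (((rightMul lam).flip (coords (h * gammaCurve lam φ))).comp
        (ContinuousLinearMap.toSpanSingleton ℝ ((1, 0) : ℝ × ℂ))) φ := by
  have h1 : HasFDerivAt (fun φ => colMul lam (coords h) (coords (gammaCurve lam φ))) _ φ :=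
    (colMul lam (coords h)).hasFDerivAt.comp φ (hasDerivAt_coords_gammaCurve φ).hasFDerivAt
  refine h1.congr_fderiv (ContinuousLinearMap.ext_ring ?_)
  change colMul lam (coords h) ((1 : ℝ) • rightMul lam (1, 0) (coords (gammaCurve lam φ)))
    = rightMul lam ((1 : ℝ) • ((1, 0) : ℝ × ℂ)) (coords (h * gammaCurve lam φ))
  rw [one_smul, one_smul, coords_mul, rightMul_colMul]

/-- A map that trivialises a connection of the given form maps fibres to fibres: along a fibre both
coordinates of `U` solve the same scalar linear equation. -/
theorem proj_comp_eq {Φ : HGroup lam₀ → ℂ} {A : OneForm lam₀ ℝ} (hA : IsSmoothForm A)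
    {U : HGroup lam₀ → HGroup lam}
    (hU : ∀ q, HasMFDerivAt 𝓘(ℝ, ℝ × ℂ) 𝓘(ℝ, ℝ × ℂ) U q (potentialFrame Φ A q))
    {h k : HGroup lam₀} (e : proj h = proj k) : proj (U h) = proj (U k) := by
  obtain ⟨φ, rfl⟩ := exists_mul_gammaCurve_eq e
  set c : ℝ → HGroup lam₀ := fun φ => h * gammaCurve lam₀ φ with hc
  have hcd (t : ℝ) := hasFDerivAt_coords_mul_gammaCurve h t
  have hW (q : HGroup lam₀) : HasMFDerivAt 𝓘(ℝ, ℝ × ℂ) 𝓘(ℝ, ℂ × ℂ) (fun q => coords (U q)) q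
      (((rightMul lam).flip (coords (U q))).comp (potentialFrame Φ A q)) :=
    HasMFDerivAt.comp q (hasMFDerivAt_coords (U q)) (hU q)
  have hd (t : ℝ) : HasDerivAt (fun t => coords (U (c t)))
      (rightMul lam (frame A (c t) (1, 0) + 1, 0) (coords (U (c t)))) t := by
    have h1 := hasFDerivAt_comp_of_hasMFDerivAt (hcd t).differentiableAt (hW (c t))
    rw [trivDeriv_eq_of_hasFDerivAt (hcd t)] at h1
    refine h1.hasDerivAt.congr_deriv ?_
    change rightMul lam (potentialFrame Φ A (c t) ((1 : ℝ) • ((1, 0) : ℝ × ℂ)))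
      (coords (U (c t))) = _
    rw [one_smul, potentialFrame_apply]
    simp
  set a : ℝ → ℂ := fun t => -(I / 2) * (frame A (c t) (1, 0) + 1 : ℝ) with ha
  have hac : Continuous a := by
    have h1 : Continuous (frame A) := (isSmoothForm_iff.1 hA).continuous
    have h2 : Continuous c := isInducing_coords.continuous_iff.2
      (continuous_iff_continuousAt.2 fun t => (hcd t).continuousAt)
    have h3 : Continuous fun t => frame A (c t) (1, 0) :=
      (h1.comp h2).clm_apply continuous_const
    exact continuous_const.mul (Complex.continuous_ofReal.comp (h3.add continuous_const))
  have h1 (t : ℝ) : HasDerivAt (fun t => (U (c t)).z₁) (a t * (U (c t)).z₁) t := by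
    refine (hasFDerivAt_fst.comp_hasDerivAt t (hd t) :).congr_deriv ?_
    simp [rightMul_apply, ha, coords]; ring
  have h2 (t : ℝ) : HasDerivAt (fun t => (U (c t)).z₂) (a t * (U (c t)).z₂) t := by
    refine (hasFDerivAt_snd.comp_hasDerivAt t (hd t) :).congr_deriv ?_
    simp [rightMul_apply, ha, coords]; ring
  have h3 := eq_exp_integral_mul_of_hasDerivAt hac h1 φ
  have h4 := eq_exp_integral_mul_of_hasDerivAt hac h2 φ
  have hc0 : c 0 = h := by
    have : gammaCurve lam₀ 0 = 1 := HGroup.ext' (by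
      change Complex.exp _ = 1
      simp) rfl
    rw [hc]
    simp only [this, mul_one]
  rw [hc0] at h3 h4
  rw [proj_eq_proj_iff]
  change (U h).z₁ * (U (c φ)).z₂ = (U h).z₂ * (U (c φ)).z₁
  rw [h3, h4]
  ring

end Fibres

/-! ### Holomorphic coordinates on the surfaces -/

section Charts

variable {lam₀ lam : ℝ}

/-- The denominator and the numerator of the affine coordinate `z₂ / z₁` of the Riemann sphere, or,
if the flag is set, of the coordinate `z₁ / z₂` around `∞`. -/
def homog : Bool → ℂ × ℂ → ℂ × ℂ
  | false, p => p
  | true, p => (p.2, p.1)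

theorem homog_homog (c : Bool) (p : ℂ × ℂ) : homog c (homog c p) = p := by cases c <;> rfl

theorem homog_smul (c : Bool) (a : ℂ) (p : ℂ × ℂ) : homog c (a • p) = a • homog c p := by
  cases c <;> rfl

theorem contDiff_homog (c : Bool) {n : ℕ∞ω} : ContDiff ℝ n (homog c) := by
  cases c
  · exact contDiff_id
  · exact contDiff_snd.prodMk contDiff_fst

/-- The chart `z` or `1/z` of the Riemann sphere. -/
noncomputable def sphereCoord : Bool → OpenPartialHomeomorph (OnePoint ℂ) ℂ
  | false => sphereChart
  | true => sphereChartInv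

/-- The affine coordinate of a point given in homogeneous coordinates. -/
noncomputable def ratio (c : Bool) (p : ℂ × ℂ) : ℂ := (homog c p).2 / (homog c p).1

theorem coe_proj (h : HGroup lam) : (proj h : OnePoint ℂ)
    = if h.z₁ = 0 then OnePoint.infty else ((h.z₂ / h.z₁ : ℂ) : OnePoint ℂ) := rfl

theorem sphereInv_proj {h : HGroup lam} (h2 : h.z₂ ≠ 0) :
    sphereInv (proj h : OnePoint ℂ) = ((h.z₁ / h.z₂ : ℂ) : OnePoint ℂ) := by
  rw [coe_proj]
  by_cases h1 : h.z₁ = 0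
  · simp [h1, sphereInv_infty]
  · rw [if_neg h1, sphereInv_coe, if_neg (div_ne_zero h2 h1), inv_div]

theorem proj_mem_source {c : Bool} {h : HGroup lam} (hc : (homog c (coords h)).1 ≠ 0) :
    (proj h : OnePoint ℂ) ∈ (sphereCoord c).source := by
  cases c
  · have hc' : h.z₁ ≠ 0 := hc
    simp [sphereCoord, sphereChart_source, coe_proj, hc']
  · have hc' : h.z₂ ≠ 0 := hc
    simp [sphereCoord, sphereChartInv, sphereChart_source, sphereInvHomeo, sphereInv_proj hc']

theorem sphereCoord_proj {c : Bool} {h : HGroup lam} (hc : (homog c (coords h)).1 ≠ 0) :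
    sphereCoord c (proj h : OnePoint ℂ) = ratio c (coords h) := by
  cases c
  · have hc' : h.z₁ ≠ 0 := hc
    change sphereChart (proj h : OnePoint ℂ) = h.z₂ / h.z₁
    rw [coe_proj, if_neg hc', sphereChart_coe]
  · have hc' : h.z₂ ≠ 0 := hc
    change sphereChart (sphereInv (proj h : OnePoint ℂ)) = h.z₁ / h.z₂
    rw [sphereInv_proj hc', sphereChart_coe]

/-- The preferred chart at `π(h)` is one whose denominator does not vanish at `h`. -/
theorem exists_chartAt_eq (h : HGroup lam) : ∃ c, (homog c (coords h)).1 ≠ 0 ∧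
    chartAt ℂ (proj h : OnePoint ℂ) = sphereCoord c := by
  by_cases h1 : h.z₁ = 0
  · have h2 : h.z₂ ≠ 0 := z₂_ne_zero_of_z₁_eq_zero h1
    exact ⟨true, h2, if_pos (by rw [coe_proj, if_pos h1])⟩
  · refine ⟨false, h1, if_neg ?_⟩
    rw [coe_proj, if_neg h1]
    exact OnePoint.coe_ne_infty _

theorem normForm_smul (a : ℂ) (p : ℂ × ℂ) : normForm lam (a • p) = ‖a‖ ^ 2 * normForm lam p := by
  simp only [normForm_eq, Prod.smul_fst, Prod.smul_snd, smul_eq_mul, norm_mul]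
  ring

/-- A local section of the projection over the domain of a chart of the sphere: the homogeneous
coordinates with affine coordinate `w` and denominator `1`, normalised. The value `1` where they
cannot be normalised is immaterial. -/
noncomputable def localSection (lam : ℝ) (c : Bool) (w : ℂ) : HGroup lam :=
  if hw : 0 < normForm lam (homog c (1, w)) then
    HGroup.mk ((1 / Real.sqrt (normForm lam (homog c (1, w))) : ℝ) * (homog c (1, w)).1)
      ((1 / Real.sqrt (normForm lam (homog c (1, w))) : ℝ) * (homog c (1, w)).2) (by
        have h1 := normForm_smul (lam := lam)
          ((1 / Real.sqrt (normForm lam (homog c (1, w))) : ℝ) : ℂ) (homog c (1, w))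
        rw [normForm_eq, Complex.norm_real, Real.norm_eq_abs, sq_abs, div_pow, one_pow,
          Real.sq_sqrt hw.le, one_div_mul_cancel hw.ne'] at h1
        exact h1)
  else 1

theorem coords_localSection {c : Bool} {w : ℂ} (hw : 0 < normForm lam (homog c (1, w))) :
    coords (localSection lam c w)
      = ((1 / Real.sqrt (normForm lam (homog c (1, w))) : ℝ) : ℂ) • homog c (1, w) := by
  rw [localSection, dif_pos hw]
  rfl

theorem homog_coords_localSection {c : Bool} {w : ℂ} (hw : 0 < normForm lam (homog c (1, w))) :
    (homog c (coords (localSection lam c w))).1 ≠ 0 ∧ ratio c (coords (localSection lam c w)) = w := by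
  have hs : ((1 / Real.sqrt (normForm lam (homog c (1, w))) : ℝ) : ℂ) ≠ 0 :=
    Complex.ofReal_ne_zero.2 (one_div_pos.2 (Real.sqrt_pos.2 hw)).ne'
  rw [ratio, coords_localSection hw, homog_smul, homog_homog]
  generalize ((1 / Real.sqrt (normForm lam (homog c (1, w))) : ℝ) : ℂ) = s at hs
  constructor
  · simpa using hs
  · simp [hs]

theorem contDiff_normForm_homog (c : Bool) :
    ContDiff ℝ ∞ fun w : ℂ => normForm lam (homog c (1, w)) := by
  have h1 : ContDiff ℝ ∞ fun w : ℂ => homog c (1, w) :=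
    (contDiff_homog c).comp (contDiff_const.prodMk contDiff_id)
  have h2 : ContDiff ℝ ∞ (normForm lam) := by
    have hr : ContDiff ℝ ∞ Complex.re := Complex.reCLM.contDiff
    have hi : ContDiff ℝ ∞ Complex.im := Complex.imCLM.contDiff
    unfold normForm
    fun_prop
  exact h2.comp h1

theorem eventually_normForm_pos {c : Bool} {w : ℂ} (hw : 0 < normForm lam (homog c (1, w))) :
    ∀ᶠ v in 𝓝 w, 0 < normForm lam (homog c (1, v)) :=
  (contDiff_normForm_homog c).continuous.continuousAt.eventually_const_lt hw

theorem differentiableAt_coords_localSection {c : Bool} {w : ℂ}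
    (hw : 0 < normForm lam (homog c (1, w))) :
    DifferentiableAt ℝ (fun v => coords (localSection lam c v)) w := by
  have h1 : ContDiff ℝ ∞ fun w : ℂ => homog c (1, w) :=
    (contDiff_homog c).comp (contDiff_const.prodMk contDiff_id)
  have h2 : DifferentiableAt ℝ (fun v => normForm lam (homog c (1, v))) w :=
    (contDiff_normForm_homog c).differentiable (by simp) w
  have h3 : DifferentiableAt ℝ (fun v => 1 / Real.sqrt (normForm lam (homog c (1, v)))) w := by
    have h5 := h2.sqrt hw.ne'
    simp only [one_div]
    exact h5.fun_inv (Real.sqrt_pos.2 hw).ne'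
  have h4 : DifferentiableAt ℝ
      (fun v => ((1 / Real.sqrt (normForm lam (homog c (1, v))) : ℝ) : ℂ)) w :=
    Complex.ofRealCLM.differentiableAt.comp w h3
  refine (h4.smul (h1.differentiable (by simp) w)).congr_of_eventuallyEq ?_
  filter_upwards [eventually_normForm_pos hw] with v hv using coords_localSection hv

theorem normForm_homog_pos {c : Bool} {h : HGroup lam} (hc : (homog c (coords h)).1 ≠ 0) :
    0 < normForm lam (homog c (1, ratio c (coords h))) := by
  have e : homog c (1, ratio c (coords h)) = (homog c (coords h)).1⁻¹ • coords h := by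
    conv_rhs => rw [← homog_homog c (coords h), ← homog_smul, homog_homog]
    congr 1
    ext1
    · simp [hc]
    · simp [ratio, div_eq_inv_mul]
  rw [e, normForm_smul, normForm_coords, mul_one]
  have := norm_pos_iff.2 (inv_ne_zero hc)
  positivity

/-- `localSection` lifts every point `x` of the surface with coordinate `w`. -/
theorem proj_localSection {c : Bool} {w : ℂ} (hw : 0 < normForm lam (homog c (1, w)))
    {x : Surface lam} (hx : (x : OnePoint ℂ) ∈ (sphereCoord c).source)
    (hxw : sphereCoord c (x : OnePoint ℂ) = w) : proj (localSection lam c w) = x := by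
  obtain ⟨h1, h2⟩ := homog_coords_localSection hw
  refine Subtype.ext ((sphereCoord c).injOn (proj_mem_source h1) hx ?_)
  rw [sphereCoord_proj h1, h2, hxw]

theorem surjective_proj : Function.Surjective (proj : HGroup lam → Surface lam) := by
  rintro ⟨x, hx⟩
  induction x using OnePoint.rec with
  | infty =>
    have hl := hx.1 rfl
    refine ⟨localSection lam true 0, proj_localSection ?_ ?_ ?_⟩
    · simpa [homog, normForm] using hl
    · simp [sphereCoord, sphereChartInv, sphereChart_source, sphereInvHomeo, sphereInv_infty]
    · exact sphereChart_coe 0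
  | coe z =>
    have hl := hx.2 z rfl
    refine ⟨localSection lam false z, proj_localSection ?_ ?_ (sphereChart_coe z)⟩
    · rw [normForm_eq]
      simpa [homog] using hl
    · simp [sphereCoord, sphereChart_source]

theorem continuousAt_ratio {c : Bool} {p : ℂ × ℂ} (hc : (homog c p).1 ≠ 0) :
    ContinuousAt (ratio c) p := by
  have h1 : Continuous (homog c) := (contDiff_homog (n := 0) c).continuous
  exact (continuous_snd.comp h1).continuousAt.div (continuous_fst.comp h1).continuousAt hc

theorem eventually_homog_ne {X : Type*} [TopologicalSpace X] {g : X → HGroup lam} {x : X}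
    (hg : ContinuousAt g x) {c : Bool} (hc : (homog c (coords (g x))).1 ≠ 0) :
    ∀ᶠ y in 𝓝 x, (homog c (coords (g y))).1 ≠ 0 := by
  have h1 : Continuous (homog c) := (contDiff_homog (n := 0) c).continuous
  have h2 : Continuous fun h : HGroup lam => (homog c (coords h)).1 :=
    continuous_fst.comp (h1.comp isInducing_coords.continuous)
  exact (h2.continuousAt.comp hg).eventually_ne hc

theorem continuous_proj : Continuous (proj : HGroup lam → Surface lam) := by
  refine continuous_induced_rng.2 (continuous_iff_continuousAt.2 fun h => ?_)
  obtain ⟨c, hc, -⟩ := exists_chartAt_eq h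
  have h1 : ContinuousAt (fun k : HGroup lam => ratio c (coords k)) h :=
    ContinuousAt.comp (continuousAt_ratio hc) isInducing_coords.continuous.continuousAt
  have h2 : ContinuousAt (sphereCoord c).symm (ratio c (coords h)) := by
    rw [← sphereCoord_proj hc]
    exact (sphereCoord c).continuousAt_symm ((sphereCoord c).map_source (proj_mem_source hc))
  refine (ContinuousAt.comp (f := fun k : HGroup lam => ratio c (coords k)) h2 h1).congr ?_
  filter_upwards [eventually_homog_ne continuousAt_id hc] with k hk
  have hk' : (homog c (coords k)).1 ≠ 0 := hk
  change (sphereCoord c).symm (ratio c (coords k)) = _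
  rw [← sphereCoord_proj hk', (sphereCoord c).left_inv (proj_mem_source hk')]
  rfl

/-- The sign by which the differentials of the two coordinates differ. -/
def coordSign : Bool → ℂ
  | false => 1
  | true => -1

theorem hasFDerivAt_div {f g : ℂ → ℂ} {f' g' : ℂ →L[ℝ] ℂ} {w : ℂ} (hf : HasFDerivAt f f' w)
    (hg : HasFDerivAt g g' w) (h0 : g w ≠ 0) :
    HasFDerivAt (fun v => f v / g v) ((1 / g w ^ 2) • (g w • f' - f w • g')) w := by
  have h1 : HasFDerivAt (fun v => (g v)⁻¹) _ w := (hasDerivAt_inv h0).comp_hasFDerivAt w hg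
  have h2 : HasFDerivAt (fun v => f v * (g v)⁻¹) _ w := hf.mul h1
  refine h2.congr_fderiv (ContinuousLinearMap.ext fun v => ?_)
  simp
  field_simp
  ring

/-- The differential of `z₂ / z₁` on the group is `-(i/2) σ / z₁²`, that of `z₁ / z₂` is
`(i/2) σ / z₂²`. In particular both are multiples of `σ`. -/
theorem hasFDerivAt_ratio {g : ℂ → ℂ × ℂ} {w : ℂ} {L : ℂ →L[ℝ] ℝ × ℂ}
    (hg : HasFDerivAt g (((rightMul lam).flip (g w)).comp L) w) (hn : normForm lam (g w) = 1)
    {c : Bool} (hc : (homog c (g w)).1 ≠ 0) :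
    HasFDerivAt (fun v => ratio c (g v))
      ((coordSign c * -(I / 2) / (homog c (g w)).1 ^ 2)
        • (ContinuousLinearMap.snd ℝ ℝ ℂ).comp L) w := by
  have h1 : HasFDerivAt (fun v => (g v).1) _ w := hasFDerivAt_fst.comp w hg
  have h2 : HasFDerivAt (fun v => (g v).2) _ w := hasFDerivAt_snd.comp w hg
  have hn' : (g w).1 * conj (g w).1 - lam * ((g w).2 * conj (g w).2) = 1 := by
    rw [Complex.mul_conj, Complex.mul_conj, Complex.normSq_apply, Complex.normSq_apply]
    rw [normForm] at hn
    norm_cast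
    linarith
  cases c
  · have hc' : (g w).1 ≠ 0 := hc
    refine (hasFDerivAt_div h2 h1 hc').congr_fderiv (ContinuousLinearMap.ext fun v => ?_)
    simp [homog, coordSign, rightMul_apply]
    field_simp
    linear_combination (-(L v).2) * hn'
  · have hc' : (g w).2 ≠ 0 := hc
    refine (hasFDerivAt_div h1 h2 hc').congr_fderiv (ContinuousLinearMap.ext fun v => ?_)
    simp [homog, coordSign, rightMul_apply]
    field_simp
    linear_combination ((L v).2) * hn'

end Charts

/-! ### Trivialisations are bundle maps over holomorphic maps -/

section Covering

variable {lam₀ lam : ℝ} {Φ : HGroup lam₀ → ℂ} {A : OneForm lam₀ ℝ} {U : HGroup lam₀ → HGroup lam}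

theorem extChartAt_surface_apply (x y : Surface lam) :
    extChartAt 𝓘(ℂ) x y = chartAt ℂ (x : OnePoint ℂ) (y : OnePoint ℂ) := by
  simp only [mfld_simps]
  rfl

theorem mem_extChartAt_surface_source {x y : Surface lam}
    (h : (y : OnePoint ℂ) ∈ (chartAt ℂ (x : OnePoint ℂ)).source) :
    y ∈ (extChartAt 𝓘(ℂ) x).source := by
  rw [extChartAt_source]
  change y ∈ ((chartAt ℂ (x : OnePoint ℂ)).subtypeRestr ⟨x⟩).source
  rw [OpenPartialHomeomorph.subtypeRestr_source]
  exact h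

/-- In holomorphic coordinates a trivialisation `U` covers a map with complex-linear differential:
both `d(π ∘ U)` and `dπ` are multiples of `σ`. -/
theorem exists_hasDerivAt_ratio
    (hU : ∀ q, HasMFDerivAt 𝓘(ℝ, ℝ × ℂ) 𝓘(ℝ, ℝ × ℂ) U q (potentialFrame Φ A q)) {c c' : Bool}
    {w : ℂ} (hw : 0 < normForm lam₀ (homog c (1, w)))
    (hc' : (homog c' (coords (U (localSection lam₀ c w)))).1 ≠ 0) :
    ∃ κ : ℂ, HasDerivAt (fun v => ratio c' (coords (U (localSection lam₀ c v)))) κ w := by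
  set s := localSection lam₀ c with hs
  have hsd : DifferentiableAt ℝ (fun v => coords (s v)) w := differentiableAt_coords_localSection hw
  have hc : (homog c (coords (s w))).1 ≠ 0 := (homog_coords_localSection hw).1
  have hW (q : HGroup lam₀) : HasMFDerivAt 𝓘(ℝ, ℝ × ℂ) 𝓘(ℝ, ℂ × ℂ) (fun q => coords (U q)) q
      (((rightMul lam).flip (coords (U q))).comp (potentialFrame Φ A q)) :=
    HasMFDerivAt.comp q (hasMFDerivAt_coords (U q)) (hU q)
  have h1 := hasFDerivAt_ratio (hasFDerivAt_coords_comp hsd) (normForm_coords _) hc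
  have h2 := hasFDerivAt_ratio (hasFDerivAt_comp_of_hasMFDerivAt hsd (hW (s w)))
    (normForm_coords _) hc'
  have h3 : HasFDerivAt (fun v => ratio c (coords (s v))) (ContinuousLinearMap.id ℝ ℂ) w := by
    refine (hasFDerivAt_id w).congr_of_eventuallyEq ?_
    filter_upwards [eventually_normForm_pos hw] with v hv using (homog_coords_localSection hv).2
  have h4 (v : ℂ) : coordSign c * -(I / 2) / (homog c (coords (s w))).1 ^ 2
      * (trivDeriv s w v).2 = v := DFunLike.congr_fun (h1.unique h3) v
  have hσ : coordSign c * coordSign c = 1 := by cases c <;> simp [coordSign]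
  refine ⟨coordSign c' * coordSign c * Φ (s w) * (homog c (coords (s w))).1 ^ 2
    / (homog c' (coords (U (s w)))).1 ^ 2, ?_⟩
  refine hasFDerivAt_of_restrictScalars ℝ h2 (ContinuousLinearMap.ext fun v => ?_)
  change v * _ = coordSign c' * -(I / 2) / (homog c' (coords (U (s w)))).1 ^ 2
    * (Φ (s w) * (trivDeriv s w v).2)
  conv_lhs => rw [← h4 v]
  generalize (trivDeriv s w v).2 = y
  field_simp
  linear_combination (-coordSign c' * y * Φ (s w)) * hσ

/-- Near a point of the surface, `f` is `π ∘ U` composed with a local section of `π`; this gives both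
continuity and the expression of `f` in the charts. -/
theorem exists_isHolomorphic_covers (hA : IsSmoothForm A)
    (hU : ∀ q, HasMFDerivAt 𝓘(ℝ, ℝ × ℂ) 𝓘(ℝ, ℝ × ℂ) U q (potentialFrame Φ A q)) :
    ∃ f : Surface lam₀ → Surface lam, IsHolomorphic f ∧ Covers U f := by
  obtain ⟨f, hf⟩ : ∃ f : Surface lam₀ → Surface lam, Covers U f :=
    ⟨fun x => proj (U (Function.surjInv surjective_proj x)), fun h =>
      proj_comp_eq hA hU (Function.surjInv_eq surjective_proj (proj h)).symm⟩
  refine ⟨f, fun x => ?_, hf⟩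
  obtain ⟨h₀, rfl⟩ := surjective_proj x
  obtain ⟨c, hc, hch⟩ := exists_chartAt_eq h₀
  set w := ratio c (coords h₀) with hw
  have hpos : 0 < normForm lam₀ (homog c (1, w)) := normForm_homog_pos hc
  set s := localSection lam₀ c with hs
  have hsw : proj (s w) = proj h₀ :=
    proj_localSection hpos (proj_mem_source hc) (sphereCoord_proj hc)
  have hsc : ContinuousAt s w := isInducing_coords.continuousAt_iff.2
    (differentiableAt_coords_localSection hpos).continuousAt
  have hUc : Continuous U := continuous_iff_continuousAt.2 fun q => (hU q).1
  obtain ⟨c', hc', hch'⟩ := exists_chartAt_eq (U (s w))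
  rw [hf, hsw] at hch'
  rw [mdifferentiableAt_iff]
  constructor
  · have h1 : ContinuousAt (fun y : Surface lam₀ => sphereCoord c (y : OnePoint ℂ)) (proj h₀) :=
      ((sphereCoord c).continuousAt (proj_mem_source hc)).comp continuous_subtype_val.continuousAt
    have hw' : sphereCoord c (proj h₀ : OnePoint ℂ) = w := sphereCoord_proj hc
    have h2 : ContinuousAt (fun v => proj (U (s v))) (sphereCoord c (proj h₀ : OnePoint ℂ)) := by
      rw [hw']
      exact (continuous_proj.comp hUc).continuousAt.comp hsc
    refine (ContinuousAt.comp (f := fun y : Surface lam₀ => sphereCoord c (y : OnePoint ℂ))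
      h2 h1).congr ?_
    have h3 := eventually_normForm_pos hpos
    rw [← hw'] at h3
    have h4 : ∀ᶠ y : Surface lam₀ in 𝓝 (proj h₀), (y : OnePoint ℂ) ∈ (sphereCoord c).source :=
      continuous_subtype_val.continuousAt.eventually_mem
        ((sphereCoord c).open_source.mem_nhds (proj_mem_source hc))
    filter_upwards [h1.eventually h3, h4] with y hy hy'
    change proj (U (s (sphereCoord c (y : OnePoint ℂ)))) = f y
    rw [hf, proj_localSection hy hy' rfl]
  · obtain ⟨κ, hκ⟩ := exists_hasDerivAt_ratio hU hpos hc'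
    have hw' : extChartAt 𝓘(ℂ) (proj h₀) (proj h₀) = w := by
      rw [extChartAt_surface_apply, hch, sphereCoord_proj hc]
    rw [hw']
    refine (hκ.differentiableAt.congr_of_eventuallyEq ?_).differentiableWithinAt
    filter_upwards [eventually_normForm_pos hpos,
      eventually_homog_ne (ContinuousAt.comp hUc.continuousAt hsc) hc'] with v hv hv'
    obtain ⟨h1, h2⟩ := homog_coords_localSection hv
    have h3 : (extChartAt 𝓘(ℂ) (proj h₀)).symm v = proj (s v) := by
      have h4 : extChartAt 𝓘(ℂ) (proj h₀) (proj (s v)) = v := by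
        rw [extChartAt_surface_apply, hch, sphereCoord_proj h1, h2]
      have h5 : proj (s v) ∈ (extChartAt 𝓘(ℂ) (proj h₀)).source := by
        refine mem_extChartAt_surface_source ?_
        rw [hch]
        exact proj_mem_source h1
      rw [← h4]
      exact ((extChartAt 𝓘(ℂ) (proj h₀)).left_inv h5).trans (by rw [h4])
    rw [writtenInExtChartAt, Function.comp_apply, Function.comp_apply, h3,
      extChartAt_surface_apply, hch', ← hf]
    exact sphereCoord_proj hv'

/-- With `F₁, F₂` the coordinates of `U` the normalising factor is `1`. -/
theorem hasForm_coords (U : HGroup lam₀ → HGroup lam) :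
    HasForm U (fun q => (U q).z₁) fun q => (U q).z₂ := by
  intro q
  have h := (U q).norm_rel
  refine ⟨by linarith, ?_⟩
  simp only [h]
  simp [HGroup.mat]

theorem contMDiff_z₁_comp (hU : ContMDiff 𝓘(ℝ, ℝ × ℂ) 𝓘(ℝ, ℝ × ℂ) ∞ U) :
    ContMDiff 𝓘(ℝ, ℝ × ℂ) 𝓘(ℝ, ℂ) ∞ fun q => (U q).z₁ :=
  (contDiff_fst.comp_contMDiff contMDiff_coords).comp hU

theorem contMDiff_z₂_comp (hU : ContMDiff 𝓘(ℝ, ℝ × ℂ) 𝓘(ℝ, ℝ × ℂ) ∞ U) :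
    ContMDiff 𝓘(ℝ, ℝ × ℂ) 𝓘(ℝ, ℂ) ∞ fun q => (U q).z₂ :=
  (contDiff_snd.comp_contMDiff contMDiff_coords).comp hU

theorem mul_sigma_eq_pullback {q : HGroup lam₀}
    (hU : HasMFDerivAt 𝓘(ℝ, ℝ × ℂ) 𝓘(ℝ, ℝ × ℂ) U q (potentialFrame Φ A q)) (v : TH q) :
    Φ q * sigma q v = pullback U sigma q v := by
  have h1 : pullback U sigma q v = sigma (U q) (potentialFrame Φ A q v) :=
    congrArg (fun w : ℝ × ℂ => sigma (U q) w) (DFunLike.congr_fun hU.mfderiv v)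
  rw [h1]
  exact (congrArg (Φ q * ·) (sigma_apply q v)).trans
    (sigma_apply (U q) (potentialFrame Φ A q v)).symm

theorem eq_pullback_sub_sigma₀ {q : HGroup lam₀}
    (hU : HasMFDerivAt 𝓘(ℝ, ℝ × ℂ) 𝓘(ℝ, ℝ × ℂ) U q (potentialFrame Φ A q)) (v : TH q) :
    A q v = pullback U sigma₀ q v - sigma₀ q v := by
  have h1 : pullback U sigma₀ q v = sigma₀ (U q) (potentialFrame Φ A q v) :=
    congrArg (fun w : ℝ × ℂ => sigma₀ (U q) w) (DFunLike.congr_fun hU.mfderiv v)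
  have h2 : sigma₀ (U q) (potentialFrame Φ A q v) = A q v + sigma₀ q v :=
    (sigma₀_apply (U q) (potentialFrame Φ A q v)).trans
      (congrArg (frame A q v + ·) (sigma₀_apply q v).symm)
  rw [h1, h2, add_sub_cancel_right]

end Covering

end Vortex

theorem mainTheorem1 (lam₀ lam : ℝ)
    (h₀ : lam₀ = -1 ∨ lam₀ = 0 ∨ lam₀ = 1) (h : lam = -1 ∨ lam = 0 ∨ lam = 1) :
    -- vortex configurations are exactly the pairs whose potential is a flat connection
    (∀ (Φ : HGroup lam₀ → ℂ) (A : OneForm lam₀ ℝ),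
      IsVortexConfiguration lam₀ lam Φ A ↔ IsFlatConnection (vortexPotential lam Φ A)) ∧
    -- the converse construction
    (∀ 𝒜 : Connection lam₀ lam, IsFlatConnection 𝒜 →
      ∀ (p : HGroup lam₀ → ℝ) (α Φ : HGroup lam₀ → ℂ),
        (∀ q, 𝒜 q (X 0 q) = p q • lieGen lam 0) →
        (∀ q, complexify (𝒜 q) (XMinus q) = α q • tZero lam + Φ q • tMinus lam) →
        ∃! A : OneForm lam₀ ℝ,
          𝒜 = vortexPotential lam Φ A ∧ IsVortexConfiguration lam₀ lam Φ A) ∧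
    -- trivialisation by a bundle map
    (∀ (Φ : HGroup lam₀ → ℂ) (A : OneForm lam₀ ℝ),
      IsFlatConnection (vortexPotential lam Φ A) →
      (∃ n : ℤ, integralGamma (vortexPotential lam Φ A) = (4 * Real.pi * n) • gen lam 0) →
      (∃ U : HGroup lam₀ → HGroup lam,
        ContMDiff 𝓘(ℝ, ℝ × ℂ) 𝓘(ℝ, ℝ × ℂ) ∞ U ∧ Trivialises U (vortexPotential lam Φ A)) ∧
      ∀ U : HGroup lam₀ → HGroup lam,
        ContMDiff 𝓘(ℝ, ℝ × ℂ) 𝓘(ℝ, ℝ × ℂ) ∞ U → Trivialises U (vortexPotential lam Φ A) →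
        (∃ f : Surface lam₀ → Surface lam, IsHolomorphic f ∧ Covers U f) ∧
        (∃ F₁ F₂ : HGroup lam₀ → ℂ,
          ContMDiff 𝓘(ℝ, ℝ × ℂ) 𝓘(ℝ, ℂ) ∞ F₁ ∧ ContMDiff 𝓘(ℝ, ℝ × ℂ) 𝓘(ℝ, ℂ) ∞ F₂ ∧
          HasForm U F₁ F₂) ∧
        (∀ q v, Φ q * sigma q v = pullback U sigma q v) ∧
        (∀ q v, A q v = pullback U sigma₀ q v - sigma₀ q v)) := by
  refine ⟨fun Φ A => isVortexConfiguration_iff_isFlatConnection Φ A,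
    fun 𝒜 h𝒜 p α Φ h0 hm => existsUnique_vortexConfiguration h𝒜 h0 hm,
    fun Φ A hflat hint => ⟨exists_trivialisation_of_flat h₀ hflat hint, fun U hU ht => ?_⟩⟩
  have hd := (trivialises_iff (hU.mdifferentiable (by simp))).1 ht
  exact ⟨exists_isHolomorphic_covers (smooth_of_smooth_entries hflat.smooth).2 hd,
    ⟨_, _, contMDiff_z₁_comp hU, contMDiff_z₂_comp hU, hasForm_coords U⟩,
    fun q v => mul_sigma_eq_pullback (hd q) v, fun q v => eq_pullback_sub_sigma₀ (hd q) v⟩
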